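/- **Setting.** Let $\mathbb{S}\subset\mathbb{R}^3$ be the unit sphere with surface measure $\omega$ (total mass $4\pi$), $\nabla^*$ the surface gradient, $\mathrm{L}^*=x\times\nabla^*$ the surface curl gradient, $\Delta^*$ the Beltrami operator and $\mathrm{D}=(-\Delta^*+\tfrac14)^{1/2}$. For $n\in\mathbb{N}_0$, $k=-n,\dots,n$ let $Y_{n,k}$ be the complex-valued orthonormal spherical harmonics with the Condon–Shortley phase, i.e. $Y_{n,k}=(-1)^k\sqrt{\tfrac{2n+1}{4\pi}\tfrac{(n-k)!}{(n+k)!}}\,(\sin\theta)^kP_n^{(k)}(\cos\theta)e^{ik\varphi}$ for $k\ge 0$ ($P_n^{(k)}$ the $k$-th derivative of the Legendre polynomial) and $Y_{n,-k}=(-1)^k\overline{Y_{n,k}}$. The Hardy–Hodge vector spherical harmonics are $$\tilde{\mathbf y}^{(1)}_{n,k}=\frac{x(\mathrm D+\frac12)Y_{n,k}-\nabla^*Y_{n,k}}{\sqrt{(n+1)(2n+1)}},\qquad \tilde{\mathbf y}^{(2)}_{n,k}=\frac{x(\mathrm D-\frac12)Y_{n,k}+\nabla^*Y_{n,k}}{\sqrt{n(2n+1)}},\qquad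 \tilde{\mathbf y}^{(3)}_{n,k}=\frac{\mathrm L^*Y_{n,k}}{\sqrt{n(n+1)}},$$ where $n\ge 0$ for type (1) and $n\ge1$ for types (2) and (3); types (2) and (3) are regarded as void for $n=0$. For $Q\in L^2(\mathbb{S})$ real-valued set $Q^\wedge(m,l)=\int_{\mathbb S}Q\,\overline{Y_{m,l}}\,d\omega$ for $m\geq 0$, $|l|\le m$, and $Q^\wedge(m,l)=0$ if $m<0$ or $|l|>m$. For $l\in\{q-1,q,q+1\}$ let $k_{l,q}=q-l$. With round brackets for Wigner 3j symbols and braces for Wigner 6j symbols (a symbol is zero unless its triangle and selection rules hold), put $$\alpha^{(1)}_{p,q,m,l}=(-1)^q\sqrt{\tfrac{3(2m+1)(2p+1)}{4\pi}}\begin{pmatrix}1&p&m\\0&0&0\end{pmatrix}\begin{pmatrix}1&p&m\\k_{l,q}&-q&l\end{pmatrix},$$ $$\alpha^{(2)}_{p,q,m,l}=-\frac{2-m(m+1)+p(p+1)}{4\sqrt{p(p+1)}}\,\alpha^{(1)}_{p,q,m,l}\quad(p\ge1),$$ $$\alpha^{(3)}_{p,q,m,l}=i(-1)^q(2p+1)\sqrt{\tfrac{2m+1}{4\pi}}\begin{pmatrix}p&m&1\\-q&l&k_{l,q}\end{pmatrix}\left(\begin{Bmatrix}p&p&1\\0&1&m\end{Bmatrix}\begin{pmatrix}p&m&0\\0&0&0\end{pmatrix}+\sqrt{\tfrac52}\begin{Bmatrix}p&p&1\\2&1&m\end{Bmatrix}\begin{pmatrix}p&m&2\\0&0&0\end{pmatrix}\right),$$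 with $\alpha^{(2)}_{0,0,m,l}:=0$, and $$\tilde\alpha^{(1)}=\sqrt{\tfrac{p+1}{2p+1}}\,\alpha^{(1)}-\sqrt{\tfrac{p}{2p+1}}\,\alpha^{(2)},\qquad \tilde\alpha^{(2)}=\sqrt{\tfrac{p}{2p+1}}\,\alpha^{(1)}+\sqrt{\tfrac{p+1}{2p+1}}\,\alpha^{(2)},\qquad\tilde\alpha^{(3)}=\alpha^{(3)}$$ (all with the indices $p,q,m,l$). **Proposition 4.2.** Let $Q\in L^2(\mathbb{S})$ and $\mathbf d\in\mathbb{S}$. Then the dipole-induced magnetization $\mathbf m(x)=Q(x)\left(3(\mathbf d\cdot x)x-\mathbf d\right)$ is square-integrable on $\mathbb{S}$ and has the Fourier expansion $$\mathbf m=\frac{8\pi}{3}\sum_{i=1}^3\sum_{p=0}^\infty\sum_{q=-p}^p\ \sum_{m=p-1}^{p+1}\ \sum_{l=q-1}^{q+1}Q^\wedge(m,l)\,\overline{Y_{1,k_{l,q}}(\mathbf d)}\,\tilde\alpha^{(i)}_{p,q,m,l}\,\tilde{\mathbf y}^{(i)}_{p,q},$$ with unconditional convergence, over $(i,p,q)$,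 in the square-integrable vector fields on $\mathbb{S}$; for every $(i,p,q)$ (with $p\ge1$ if $i\in\{2,3\}$) the factor of $\tilde{\mathbf y}^{(i)}_{p,q}$ is the Fourier coefficient $\int_{\mathbb S}\mathbf m\cdot\overline{\tilde{\mathbf y}^{(i)}_{p,q}}\,d\omega$. Moreover $\tilde\alpha^{(1)}_{p,q,m,l}=\tilde\alpha^{(2)}_{p,q,m,l}=0$ if $m=p$, so that for the types $i=1,2$ only $m\in\{p-1,p+1\}$ contributes. -/

import Mathlib

open MeasureTheory
open scoped ComplexConjugate

noncomputable section

namespace DipoleMag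

/-! ### The unit sphere and its surface measure -/

/-- Euclidean space `ℝ³`. -/
abbrev E3 : Type := EuclideanSpace ℝ (Fin 3)

/-- The complexification `ℂ³`, with its Hermitian inner product. -/
abbrev C3 : Type := EuclideanSpace ℂ (Fin 3)

/-- The unit sphere of `ℝ³`. -/
abbrev S2 : Type := Metric.sphere (0 : E3) 1

/-- The surface measure `dω` of the unit sphere (total mass `4π`). -/
abbrev surfaceMeasure : Measure S2 := (volume : Measure E3).toSphere

/-- The embedding of `ℝ³` into `ℂ³`. -/
def complexify (v : E3) : C3 := WithLp.toLp 2 (fun j => ((v j : ℝ) : ℂ))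

/-! ### Scalar spherical harmonics -/

/-- The Legendre polynomial `Pₙ`, by the Rodrigues formula
`Pₙ(t) = (2ⁿ n!)⁻¹ (d/dt)ⁿ (t² - 1)ⁿ`. -/
def legendre (n : ℕ) : Polynomial ℝ :=
  Polynomial.C (1 / (2 ^ n * (n.factorial : ℝ))) *
    (Polynomial.derivative)^[n] ((Polynomial.X ^ 2 - 1) ^ n)

/-- The fully normalized complex spherical harmonic `Y_{n,k}` of degree `n` and order `k ≥ 0`, with
the Condon–Shortley phase, in Cartesian coordinates:
`Y_{n,k} = (-1)ᵏ √((2n+1)/(4π) · (n-k)!/(n+k)!) · (sin θ)ᵏ Pₙ⁽ᵏ⁾(cos θ) · exp(ikφ)`,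
where `cos θ = x₃` and `sin θ · exp(iφ) = x₁ + i x₂`. -/
def sphHarmNonneg (n k : ℕ) (x : S2) : ℂ :=
  (((-1) ^ k * √((2 * n + 1) / (4 * Real.pi) * ((n - k).factorial / (n + k).factorial)) *
      ((Polynomial.derivative)^[k] (legendre n)).eval ((x : E3) 2) : ℝ) : ℂ) *
    ((((x : E3) 0 : ℝ) : ℂ) + (((x : E3) 1 : ℝ) : ℂ) * Complex.I) ^ k

/-- The complex spherical harmonics `Y_{n,k}` for all orders `k ∈ ℤ`: for `k < 0`,
`Y_{n,k} = (-1)ᵏ conj Y_{n,-k}`; and `Y_{n,k} = 0` if `|k| > n`. -/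
def sphHarm (n : ℕ) (k : ℤ) (x : S2) : ℂ :=
  if k.natAbs ≤ n then
    if 0 ≤ k then sphHarmNonneg n k.natAbs x
    else (-1) ^ k.natAbs * conj (sphHarmNonneg n k.natAbs x)
  else 0

/-- The pairs `(n, k)` with `n ∈ ℕ` and `k = -n, …, n`. -/
abbrev SHIndex : Type := Σ n : ℕ, Finset.Icc (-(n : ℤ)) (n : ℤ)

/-- The degree `n` of the pair `(n, k)`. -/
def SHIndex.deg (j : SHIndex) : ℕ := j.1

/-- The order `k` of the pair `(n, k)`. -/
def SHIndex.ord (j : SHIndex) : ℤ := (j.2 : ℤ)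

/-- The Fourier coefficient `f^(m,l) = ∫ f conj(Y_{m,l}) dω`; it is zero for `|l| > m`. -/
def shCoeff (f : S2 → ℂ) (m : ℕ) (l : ℤ) : ℂ :=
  ∫ x, f x * conj (sphHarm m l x) ∂surfaceMeasure

/-! ### The surface operators -/

/-- The extension of a function on the unit sphere to `ℝ³ \ {0}` that is constant along rays. -/
def radialExtension (f : S2 → ℂ) (y : E3) : ℂ :=
  if h : y ≠ 0 then
    f ⟨‖y‖⁻¹ • y, by
      simp [norm_smul, inv_mul_cancel₀ (norm_ne_zero_iff.mpr h)]⟩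
  else 0

/-- The surface gradient `∇* f` at a point of the unit sphere: the Euclidean gradient of the
extension of `f` that is constant along rays. -/
def surfGrad (f : S2 → ℂ) (x : S2) : C3 :=
  WithLp.toLp 2 (fun j =>
    fderiv ℝ (radialExtension f) (x : E3) (EuclideanSpace.single j (1 : ℝ)))

/-- The surface curl gradient `L* f = x × ∇* f`. -/
def surfCurlGrad (f : S2 → ℂ) (x : S2) : C3 :=
  WithLp.toLp 2 (crossProduct (complexify (x : E3)).ofLp (surfGrad f x).ofLp)

/-- The pseudodifferential operator `D = (-Δ* + 1/4)^(1/2)`, through its spectral representation: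
`Δ* Y_{n,k} = -n(n+1) Y_{n,k}`, so that `D f = ∑ √(n(n+1) + 1/4) f^(n,k) Y_{n,k}`. -/
def opD (f : S2 → ℂ) (x : S2) : ℂ :=
  ∑' j : SHIndex, ((√(j.deg * (j.deg + 1) + 1 / 4) : ℝ) : ℂ) *
    shCoeff f j.deg j.ord * sphHarm j.deg j.ord x

/-- The Hardy–Hodge operators `õ⁽¹⁾ = x (D + 1/2) - ∇*`, `õ⁽²⁾ = x (D - 1/2) + ∇*`, `õ⁽³⁾ = L*`,
numbered by `0, 1, 2 : Fin 3`. -/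
def hardyHodgeOp : Fin 3 → (S2 → ℂ) → S2 → C3
  | 0, f, x => (opD f x + 1 / 2 * f x) • complexify (x : E3) - surfGrad f x
  | 1, f, x => (opD f x - 1 / 2 * f x) • complexify (x : E3) + surfGrad f x
  | 2, f, x => surfCurlGrad f x

/-- The normalization constants `(n+1)(2n+1)`, `n(2n+1)`, `n(n+1)`. -/
def hardyHodgeNorm : Fin 3 → ℕ → ℝ
  | 0, n => (n + 1) * (2 * n + 1)
  | 1, n => n * (2 * n + 1)
  | 2, n => n * (n + 1)

/-- The Hardy–Hodge vector spherical harmonics `ỹ⁽ⁱ⁾_{n,k}`; types (2) and (3) are meant for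
`n ≥ 1` only. -/
def hardyHodgeHarm (i : Fin 3) (n : ℕ) (k : ℤ) (x : S2) : C3 :=
  (((√(hardyHodgeNorm i n))⁻¹ : ℝ) : ℂ) • hardyHodgeOp i (sphHarm n k) x

/-- The triples `(i, n, k)` which number the Hardy–Hodge vector spherical harmonics: `n ≥ 0` for
type (1), `n ≥ 1` for the types (2) and (3). -/
abbrev HHIndex : Type := {j : Fin 3 × SHIndex // j.1 = 0 ∨ 1 ≤ j.2.deg}

/-! ### Wigner symbols for integer angular momenta -/

/-- `1 / z!` for an integer `z`, equal to zero if `z < 0`. -/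
def invFact (z : ℤ) : ℝ := if 0 ≤ z then 1 / (z.toNat.factorial : ℝ) else 0

/-- The triangle condition for three angular momenta. -/
def Triangle (a b c : ℕ) : Prop := a ≤ b + c ∧ b ≤ a + c ∧ c ≤ a + b

/-- `(a+b-c)! (a-b+c)! (-a+b+c)! / (a+b+c+1)!`, for `a, b, c` that satisfy the triangle
condition (no subtraction is truncated then). -/
def triangleCoeff (a b c : ℕ) : ℝ :=
  ((a + b - c).factorial * (a + c - b).factorial * (b + c - a).factorial : ℝ) /
    ((a + b + c + 1).factorial : ℝ)

open Classical in
/-- The Wigner 3j symbol with first row `j₁ j₂ j₃` and second row `m₁ m₂ m₃`, by Racah's formula. -/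
def wigner3j (j₁ j₂ j₃ : ℕ) (m₁ m₂ m₃ : ℤ) : ℝ :=
  if m₁ + m₂ + m₃ = 0 ∧ |m₁| ≤ j₁ ∧ |m₂| ≤ j₂ ∧ |m₃| ≤ j₃ ∧ Triangle j₁ j₂ j₃ then
    (-1 : ℝ) ^ ((j₁ : ℤ) - j₂ - m₃) * √(triangleCoeff j₁ j₂ j₃) *
      √(((j₁ + m₁).toNat.factorial : ℝ) * ((j₁ - m₁).toNat.factorial : ℝ) *
        ((j₂ + m₂).toNat.factorial : ℝ) * ((j₂ - m₂).toNat.factorial : ℝ) *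
        ((j₃ + m₃).toNat.factorial : ℝ) * ((j₃ - m₃).toNat.factorial : ℝ)) *
      ∑ t ∈ Finset.range (j₁ + j₂ + 1),
        (-1 : ℝ) ^ t * invFact t * invFact (j₃ - j₂ + t + m₁) * invFact (j₃ - j₁ + t - m₂) *
          invFact (j₁ + j₂ - j₃ - t) * invFact (j₁ - t - m₁) * invFact (j₂ - t + m₂)
  else 0

open Classical in
/-- The Wigner 6j symbol with first row `j₁ j₂ j₃` and second row `j₄ j₅ j₆`, by Racah's formula. -/
def wigner6j (j₁ j₂ j₃ j₄ j₅ j₆ : ℕ) : ℝ :=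
  if Triangle j₁ j₂ j₃ ∧ Triangle j₁ j₅ j₆ ∧ Triangle j₄ j₂ j₆ ∧ Triangle j₄ j₅ j₃ then
    √(triangleCoeff j₁ j₂ j₃ * triangleCoeff j₁ j₅ j₆ * triangleCoeff j₄ j₂ j₆ *
        triangleCoeff j₄ j₅ j₃) *
      ∑ t ∈ Finset.range (j₁ + j₂ + j₄ + j₅ + 1),
        (-1 : ℝ) ^ t * ((t + 1).factorial : ℝ) *
          invFact ((t : ℤ) - j₁ - j₂ - j₃) * invFact ((t : ℤ) - j₁ - j₅ - j₆) *
          invFact ((t : ℤ) - j₄ - j₂ - j₆) * invFact ((t : ℤ) - j₄ - j₅ - j₃) *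
          invFact ((j₁ : ℤ) + j₂ + j₄ + j₅ - t) * invFact ((j₂ : ℤ) + j₃ + j₅ + j₆ - t) *
          invFact ((j₃ : ℤ) + j₁ + j₆ + j₄ - t)
  else 0

/-! ### The coefficients -/

/-- `k_{l,q}`, which is `-1, 0, 1` for `l = q + 1, q, q - 1` respectively. -/
def kIndex (l q : ℤ) : ℤ := q - l

/-- `α⁽¹⁾_{p,q,m,l}`. -/
def alpha1 (p : ℕ) (q : ℤ) (m : ℕ) (l : ℤ) : ℝ :=
  (-1 : ℝ) ^ q * √(3 * (2 * m + 1) * (2 * p + 1) / (4 * Real.pi)) *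
    wigner3j 1 p m 0 0 0 * wigner3j 1 p m (kIndex l q) (-q) l

/-- `α⁽²⁾_{p,q,m,l}`, for `p ≥ 1`. -/
def alpha2 (p : ℕ) (q : ℤ) (m : ℕ) (l : ℤ) : ℝ :=
  -(1 / (4 * √(p * (p + 1)))) * (2 - m * (m + 1) + p * (p + 1)) * alpha1 p q m l

/-- `α⁽³⁾_{p,q,m,l}`. -/
def alpha3 (p : ℕ) (q : ℤ) (m : ℕ) (l : ℤ) : ℂ :=
  Complex.I *
    (((-1 : ℝ) ^ q * (2 * p + 1) * √((2 * m + 1) / (4 * Real.pi)) *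
      wigner3j p m 1 (-q) l (kIndex l q) *
      (wigner6j p p 1 0 1 m * wigner3j p m 0 0 0 0 +
        √(5 / 2) * wigner6j p p 1 2 1 m * wigner3j p m 2 0 0 0) : ℝ) : ℂ)

/-- The coefficients `α̃⁽ⁱ⁾_{p,q,m,l}`. For `p = 0` the term with `α⁽²⁾` in type (1) is void (its
factor `√(p/(2p+1))` vanishes). -/
def alphaTilde : Fin 3 → ℕ → ℤ → ℕ → ℤ → ℂ
  | 0, p, q, m, l =>
    ((√((p + 1) / (2 * p + 1)) * alpha1 p q m l - √(p / (2 * p + 1)) * alpha2 p q m l : ℝ) : ℂ)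
  | 1, p, q, m, l =>
    ((√(p / (2 * p + 1)) * alpha1 p q m l + √((p + 1) / (2 * p + 1)) * alpha2 p q m l : ℝ) : ℂ)
  | 2, p, q, m, l => alpha3 p q m l

/-! ### Dipole-induced magnetizations -/

/-- The dipole-induced magnetization `𝐦(x) = Q(x) (3 (d · x) x - d)`. -/
def magnetization (Q : S2 → ℝ) (d : S2) (x : S2) : E3 :=
  Q x • ((3 * inner ℝ (d : E3) (x : E3)) • (x : E3) - (d : E3))

/-- The coefficient of `ỹ⁽ⁱ⁾_{p,q}` in the expansion. The truncated subtraction in the range of `m`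
drops, for `p = 0`, only the void degree `m = -1`. -/
def expansionCoeff (Q : S2 → ℝ) (d : S2) (i : Fin 3) (p : ℕ) (q : ℤ) : ℂ :=
  ((8 * Real.pi / 3 : ℝ) : ℂ) *
    ∑ m ∈ Finset.Icc (p - 1) (p + 1), ∑ l ∈ Finset.Icc (q - 1) (q + 1),
      shCoeff (fun x => (Q x : ℂ)) m l * conj (sphHarm 1 (kIndex l q) d) * alphaTilde i p q m l

end DipoleMag

end

set_option linter.unusedSimpArgs false

noncomputable section

namespace DipoleMag

/-! ### Legendre polynomials -/

section Legendre

open Polynomial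

/-! The Hardy–Hodge harmonics form a Hilbert basis of the square-integrable complex vector fields,
so the expansion is the basis expansion `hasSum_hhLp`, and the real content is the value of each
Fourier coefficient.

The basis property comes from components. In the frame `v 2`, `cPlus v`, `cMinus v`, every harmonic
of type (1), (2), (3) and degree n is a multiple of one single scalar harmonic, of degree n+1, n-1,
n respectively (`hardyHodgeHarm_two`, `cPlus_hardyHodgeHarm`, `cMinus_hardyHodgeHarm`).
Orthonormality (`orthonormal_hhLp`) thus reduces to that of the scalar harmonics and to a Gram
identity with three terms. Completeness (`topologicalClosure_span_hhLp`) reduces to a dimension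
count for each degree and to the density of scalar harmonics, which is Stone–Weierstrass. The scalar
theory itself rests on Legendre recurrences, the ladder operators and rotation invariance.

For the coefficients, write (d·x)Y_{p,q} = U + D with parts U, D of degrees p+1, p-1 (`dirUp`,
`dirDown`). Up to normalization, x·y is (p+1)Y, pY, 0 for the three types, while d·y is (2p+1)U for
type (1) and (2p+1)D for type (2). Hence 3(d·x)(x·y) - d·y is (p+2)U + 3(p+1)D for type (1), 3pU +
(p-1)D for type (2), and -d·y for type (3). On the other side, the Racah sums of all Wigner symbols
involved have at most three non-zero terms and are evaluated in closed form; the sums over l then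
reproduce the same U and D with the same weights. This is `dipole_expansion`; integration against Q
gives `integral_inner_magnetization`. For types (1) and (2) the degree m = p drops out because the
3j symbol with rows 1, p, p and 0, 0, 0 vanishes by parity. -/

theorem C_mul_legendre (n : ℕ) :
    C (2 ^ n * (n.factorial : ℝ)) * legendre n = derivative^[n] ((X ^ 2 - 1 : ℝ[X]) ^ n) := by
  have h : (2 ^ n * (n.factorial : ℝ)) ≠ 0 := by positivity
  rw [legendre, ← mul_assoc, ← C_mul, mul_one_div_cancel h, C_1, one_mul]

theorem legendre_zero : legendre 0 = 1 := by simp [legendre]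

theorem derivative_sq_sub_one_pow (n : ℕ) :
    derivative ((X ^ 2 - 1 : ℝ[X]) ^ (n + 1)) =
      C (2 * (n + 1 : ℝ)) * ((X ^ 2 - 1 : ℝ[X]) ^ n * X) := by
  rw [derivative_pow]
  simp only [derivative_sub, derivative_X_pow, derivative_one, Nat.add_sub_cancel, C_mul, C_add,
    map_natCast, map_ofNat, C_1]
  push_cast
  ring

theorem C_legendre_succ (n : ℕ) :
    C (2 ^ (n + 1) * ((n + 1).factorial : ℝ)) =
      C (2 * (n + 1 : ℝ)) * C (2 ^ n * (n.factorial : ℝ)) := by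
  rw [← C_mul, Nat.factorial_succ]
  push_cast
  ring_nf

theorem C_legendre_ne_zero (n : ℕ) : C (2 ^ n * (n.factorial : ℝ)) ≠ 0 := by
  rw [Ne, C_eq_zero]; positivity

/-- Differentiate the power in Rodrigues' formula once to get a multiple of (X² - 1)ⁿ X; in the
remaining derivatives Leibniz' rule stops after the first derivative of X. -/
theorem derivative_legendre_succ (n : ℕ) :
    derivative (legendre (n + 1)) = X * derivative (legendre n) + ((n : ℝ[X]) + 1) * legendre n := by
  apply mul_left_cancel₀ (C_legendre_ne_zero (n + 1))
  rw [← derivative_C_mul, C_mul_legendre, ← Function.iterate_succ_apply' derivative,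
    Function.iterate_succ_apply, derivative_sq_sub_one_pow, iterate_derivative_C_mul,
    iterate_derivative_mul_X, C_legendre_succ, nsmul_eq_mul, Nat.add_sub_cancel,
    Function.iterate_succ_apply' derivative n, ← C_mul_legendre, derivative_C_mul]
  push_cast
  ring

/-- The next power of W = X² - 1 is differentiated once as the product of W with the previous power
and once by the chain rule. The term `derivative^[k] (W ^ (k + 1))`, which is no Legendre
polynomial, cancels in the final combination. -/
theorem one_sub_sq_mul_derivative_legendre (n : ℕ) :
    (1 - X ^ 2) * derivative (legendre n) =
      ((n : ℝ[X]) + 1) * (X * legendre n - legendre (n + 1)) := by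
  rcases Nat.eq_zero_or_pos n with rfl | hn
  · have h := C_mul_legendre 1
    have h2 := C_mul_legendre 0
    simp only [legendre_zero]
    rw [Function.iterate_one, derivative_sq_sub_one_pow] at h
    have h3 : legendre 1 = X := by
      apply mul_left_cancel₀ (C_legendre_ne_zero 1)
      rw [h]; simp
    simp [h3]
  obtain ⟨k, rfl⟩ : ∃ k, n = k + 1 := ⟨n - 1, by omega⟩
  set W : ℝ[X] := X ^ 2 - 1 with hW
  -- two ways to differentiate the next power
  have h1 : derivative^[k + 2] (W ^ (k + 2)) =
      derivative^[k + 2] (W ^ (k + 1)) * X * X - derivative^[k + 2] (W ^ (k + 1))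
        + (2 * ((k : ℝ[X]) + 2)) * (derivative^[k + 1] (W ^ (k + 1)) * X)
        + (((k : ℝ[X]) + 2) * ((k : ℝ[X]) + 1)) * derivative^[k] (W ^ (k + 1)) := by
    have e : W ^ (k + 2) = W ^ (k + 1) * X * X - W ^ (k + 1) := by rw [hW]; ring
    rw [e, iterate_derivative_sub, iterate_derivative_mul_X, iterate_derivative_mul_X]
    simp only [nsmul_eq_mul, Nat.add_sub_cancel, show k + 2 - 1 = k + 1 by omega]
    rw [iterate_derivative_mul_X]
    simp only [nsmul_eq_mul, Nat.add_sub_cancel]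
    push_cast
    ring
  have h2 : derivative^[k + 2] (W ^ (k + 2)) =
      C (2 * ((k + 1 : ℕ) + 1 : ℝ)) * (derivative^[k + 1] (W ^ (k + 1)) * X
        + ((k : ℝ[X]) + 1) * derivative^[k] (W ^ (k + 1))) := by
    rw [Function.iterate_succ_apply, hW, derivative_sq_sub_one_pow, iterate_derivative_C_mul,
      iterate_derivative_mul_X, nsmul_eq_mul, Nat.add_sub_cancel]
    push_cast
    ring
  have e1 : derivative^[k + 2] (W ^ (k + 1)) =
      C (2 ^ (k + 1) * ((k + 1).factorial : ℝ)) * derivative (legendre (k + 1)) := by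
    rw [Function.iterate_succ_apply', hW, ← C_mul_legendre, derivative_C_mul]
  have e2 := C_mul_legendre (k + 1)
  have e3 := C_mul_legendre (k + 2)
  rw [← hW] at e2 e3
  rw [C_legendre_succ] at e3
  have hc : C (2 * ((k + 1 : ℕ) + 1 : ℝ)) = 2 * ((k : ℝ[X]) + 2) := by
    simp only [C_mul, C_add, map_natCast, map_ofNat, C_1]; push_cast; ring
  rw [hc] at e3 h2
  apply mul_left_cancel₀ (C_legendre_ne_zero (k + 1))
  apply mul_left_cancel₀ (two_ne_zero : (2 : ℝ[X]) ≠ 0)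
  push_cast
  rw [← e2, e1] at h1
  rw [← e2] at h2
  linear_combination 2 * h1 - h2 + e3

/-- In this recurrence and in those that follow from it, the truncated index n - 1 is harmless at n
= 0: the term carrying it is either the derivative of a constant or has a vanishing factor. -/
theorem derivative_legendre_sub (n : ℕ) :
    (2 * (n : ℝ[X]) + 1) * legendre n = derivative (legendre (n + 1)) - derivative (legendre (n - 1)) := by
  rcases n with _ | n
  · rw [derivative_legendre_succ]; simp [legendre_zero]
  · have h1 := derivative_legendre_succ n
    have h2 := derivative_legendre_succ (n + 1)
    have h3 := one_sub_sq_mul_derivative_legendre n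
    rw [Nat.add_sub_cancel]
    push_cast at *
    linear_combination (-1) * h2 + h3 - X * h1

theorem X_mul_legendre (n : ℕ) :
    (2 * (n : ℝ[X]) + 1) * (X * legendre n) =
      ((n : ℝ[X]) + 1) * legendre (n + 1) + (n : ℝ[X]) * legendre (n - 1) := by
  rcases n with _ | n
  · have h3 := one_sub_sq_mul_derivative_legendre 0
    simp [legendre_zero] at h3 ⊢
    linear_combination -h3
  · have h1 := derivative_legendre_succ n
    have h2 := one_sub_sq_mul_derivative_legendre (n + 1)
    have h3 := one_sub_sq_mul_derivative_legendre n
    rw [Nat.add_sub_cancel]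
    push_cast at *
    linear_combination (-1) * h2 + (1 - X ^ 2) * h1 + X * h3

/-- The `k`-th derivative of the Legendre polynomial of degree `n`. -/
abbrev legendreD (n k : ℕ) : ℝ[X] := derivative^[k] (legendre n)

theorem derivative_legendreD (n k : ℕ) : derivative (legendreD n k) = legendreD n (k + 1) :=
  (Function.iterate_succ_apply' _ _ _).symm

theorem legendreD_sub (n k : ℕ) :
    (2 * (n : ℝ[X]) + 1) * legendreD n k = legendreD (n + 1) (k + 1) - legendreD (n - 1) (k + 1) := by
  induction k with
  | zero => simpa [legendreD] using derivative_legendre_sub n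
  | succ k ih =>
    have h := congrArg derivative ih
    have e : (2 * n + 1 : ℝ[X]) = C (2 * n + 1 : ℝ) := by
      simp only [map_add, map_mul, map_natCast, map_ofNat, map_one]
    rw [e, derivative_C_mul, derivative_sub, derivative_legendreD, derivative_legendreD,
      derivative_legendreD] at h
    rw [e, h]

theorem X_mul_legendreD (n k : ℕ) :
    (2 * (n : ℝ[X]) + 1) * (X * legendreD n k) =
      ((n : ℝ[X]) + 1 - (k : ℝ[X])) * legendreD (n + 1) k + ((n : ℝ[X]) + (k : ℝ[X])) * legendreD (n - 1) k := by
  induction k with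
  | zero => simpa [legendreD] using X_mul_legendre n
  | succ k ih =>
    have h := congrArg derivative ih
    have e1 : (2 * (n : ℝ[X]) + 1) = C (2 * n + 1 : ℝ) := by
      simp only [map_add, map_mul, map_natCast, map_ofNat, map_one, map_sub, map_neg]
    have e2 : ((n : ℝ[X]) + 1 - (k : ℝ[X])) = C (n + 1 - k : ℝ) := by
      simp only [map_add, map_mul, map_natCast, map_ofNat, map_one, map_sub, map_neg]
    have e3 : ((n : ℝ[X]) + (k : ℝ[X])) = C (n + k : ℝ) := by
      simp only [map_add, map_mul, map_natCast, map_ofNat, map_one, map_sub, map_neg]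
    rw [e1, e2, e3, derivative_C_mul, derivative_add, derivative_C_mul, derivative_C_mul,
      derivative_mul, derivative_X, derivative_legendreD, derivative_legendreD,
      derivative_legendreD, ← e1, ← e2, ← e3] at h
    have h2 := legendreD_sub n k
    push_cast
    linear_combination h - h2

theorem one_sub_sq_mul_legendreD (n k : ℕ) :
    (2 * (n : ℝ[X]) + 1) * ((1 - X ^ 2) * legendreD n (k + 1)) =
      ((n : ℝ[X]) + (k : ℝ[X]) + 1) * ((n : ℝ[X]) + (k : ℝ[X])) * legendreD (n - 1) k
        - ((n : ℝ[X]) - (k : ℝ[X])) * ((n : ℝ[X]) - (k : ℝ[X]) + 1) * legendreD (n + 1) k := by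
  induction k with
  | zero =>
    have h1 := one_sub_sq_mul_derivative_legendre n
    have h2 := X_mul_legendre n
    simp only [legendreD, Function.iterate_zero, id_eq, zero_add, Function.iterate_one,
      Nat.cast_zero]
    linear_combination (2 * n + 1) * h1 + (n + 1) * h2
  | succ k ih =>
    have h := congrArg derivative ih
    have e1 : (2 * (n : ℝ[X]) + 1) = C (2 * n + 1 : ℝ) := by
      simp only [map_add, map_mul, map_natCast, map_ofNat, map_one, map_sub, map_neg]
    have e2 : (((n : ℝ[X]) + (k : ℝ[X]) + 1) * ((n : ℝ[X]) + (k : ℝ[X]))) = C ((n + k + 1) * (n + k) : ℝ) := by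
      simp only [map_add, map_mul, map_natCast, map_ofNat, map_one, map_sub, map_neg]
    have e3 : (((n : ℝ[X]) - (k : ℝ[X])) * ((n : ℝ[X]) - (k : ℝ[X]) + 1)) = C ((n - k) * (n - k + 1) : ℝ) := by
      simp only [map_add, map_mul, map_natCast, map_ofNat, map_one, map_sub, map_neg]
    rw [e1, e2, e3, derivative_C_mul, derivative_sub, derivative_C_mul, derivative_C_mul,
      derivative_mul, derivative_sub, derivative_one, derivative_X_pow, derivative_legendreD,
      derivative_legendreD, derivative_legendreD, ← e1, ← e2, ← e3] at h
    have h2 := X_mul_legendreD n (k + 1)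
    push_cast at *
    simp only [map_ofNat, Nat.add_one_sub_one, pow_one] at h
    linear_combination h + 2 * h2

/-- The associated Legendre equation: the base case is the derivative of
`one_sub_sq_mul_derivative_legendre`, and each induction step differentiates once more. -/
theorem legendreD_ode (n k : ℕ) :
    (1 - X ^ 2) * legendreD n (k + 2) - 2 * ((k : ℝ[X]) + 1) * X * legendreD n (k + 1) =
      -(((n : ℝ[X]) + (k : ℝ[X]) + 1) * ((n : ℝ[X]) - (k : ℝ[X]))) * legendreD n k := by
  induction k with
  | zero =>
    have h1 := congrArg derivative (one_sub_sq_mul_derivative_legendre n)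
    have h2 := derivative_legendre_succ n
    have e1 : ((n : ℝ[X]) + 1) = C (n + 1 : ℝ) := by
      simp only [map_add, map_mul, map_natCast, map_ofNat, map_one, map_sub, map_neg]
    rw [e1, derivative_mul, derivative_C_mul, derivative_sub, derivative_sub, derivative_mul,
      derivative_one, derivative_X_pow, derivative_X, ← e1] at h1
    simp only [legendreD, Function.iterate_succ, Function.iterate_zero, Function.comp_apply, id_eq,
      Nat.cast_zero, zero_add]
    simp only [map_ofNat, Nat.add_one_sub_one, pow_one, Nat.cast_ofNat] at h1
    linear_combination h1 - (n + 1) * h2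
  | succ k ih =>
    have h := congrArg derivative ih
    have e1 : (2 * ((k : ℝ[X]) + 1) * X) = C (2 * (k + 1) : ℝ) * X := by
      simp only [map_add, map_mul, map_natCast, map_ofNat, map_one, map_sub, map_neg]
    have e2 : (-(((n : ℝ[X]) + (k : ℝ[X]) + 1) * ((n : ℝ[X]) - (k : ℝ[X])))) = C (-((n + k + 1) * (n - k)) : ℝ) := by
      simp only [map_add, map_mul, map_natCast, map_ofNat, map_one, map_sub, map_neg]
    have e3 : (2 * ((k : ℝ[X]) + 1)) = C (2 * (k + 1) : ℝ) := by
      simp only [map_add, map_mul, map_natCast, map_ofNat, map_one, map_sub, map_neg]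
    rw [e1, e2, mul_assoc, derivative_sub, derivative_C_mul, derivative_C_mul, derivative_mul,
      derivative_mul, derivative_X, derivative_sub, derivative_one, derivative_X_pow,
      derivative_legendreD, derivative_legendreD, derivative_legendreD, ← e2, ← e3] at h
    simp only [map_ofNat, Nat.add_one_sub_one, pow_one, Nat.cast_ofNat] at h
    push_cast at *
    linear_combination h

theorem legendreD_eq_zero {n k : ℕ} (h : n < k) : legendreD n k = 0 := by
  apply iterate_derivative_eq_zero
  refine lt_of_le_of_lt ?_ h
  rw [legendre]
  refine (natDegree_C_mul_le _ _).trans ((natDegree_iterate_derivative _ _).trans ?_)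
  have : (X ^ 2 - 1 : ℝ[X]).natDegree ≤ 2 := by compute_degree
  have h2 := natDegree_pow_le_of_le n this
  omega

end Legendre

/-! ### Normalization and coupling coefficients -/

/-- The normalization constant of `Y_{n,k}` for `k ≥ 0`. -/
def shNorm (n k : ℕ) : ℝ :=
  (-1) ^ k * √((2 * n + 1) / (4 * Real.pi) * ((n - k).factorial / (n + k).factorial))

/-- Coefficient of `Y_{n+1,k}` in `x₃ Y_{n,k}`. -/
def coeffA (n : ℕ) (k : ℤ) : ℝ := √((n + 1 - k) * (n + 1 + k) / ((2 * n + 1) * (2 * n + 3)))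

/-- Coefficient of `Y_{n-1,k}` in `x₃ Y_{n,k}`. -/
def coeffA' (n : ℕ) (k : ℤ) : ℝ := √((n - k) * (n + k) / ((2 * n - 1) * (2 * n + 1)))

/-- Coefficient of `Y_{n+1,k-1}` in `(x₁ - i x₂) Y_{n,-k}`. -/
def coeffB (n : ℕ) (k : ℤ) : ℝ := √((n + k + 1) * (n + k + 2) / ((2 * n + 1) * (2 * n + 3)))

/-- Coefficient of `Y_{n-1,k+1}` in `(x₁ + i x₂) Y_{n,-k}`. -/
def coeffB' (n : ℕ) (k : ℤ) : ℝ := √((n + k) * (n + k - 1) / ((2 * n - 1) * (2 * n + 1)))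

/-- The coefficient of the ladder operators of the angular momentum. -/
def coeffL (n : ℕ) (k : ℤ) : ℝ := √((n - k) * (n + k + 1))

/-- Multiplication by x₃ is symmetric, so its matrix entry from degree n+1 down to n equals the one
from n up to n+1. Such shifts let most later identities use the unprimed coefficients only. -/
theorem coeffA'_succ (n : ℕ) (k : ℤ) : coeffA' (n + 1) k = coeffA n k := by
  unfold coeffA' coeffA; congr 1; push_cast; ring_nf

theorem coeffB'_succ (n : ℕ) (k : ℤ) : coeffB' (n + 1) k = coeffB n (k - 1) := by
  unfold coeffB' coeffB; congr 1; push_cast; ring_nf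

theorem coeffA_neg (n : ℕ) (k : ℤ) : coeffA n (-k) = coeffA n k := by
  unfold coeffA; congr 1; push_cast; ring_nf

theorem coeffA'_neg (n : ℕ) (k : ℤ) : coeffA' n (-k) = coeffA' n k := by
  unfold coeffA'; congr 1; push_cast; ring_nf

/-- For this and the next ratios of normalization constants: once the sign is removed both sides are
nonnegative, so their squares are compared. Writing the degree as the order plus j removes the
truncated subtractions inside the factorials. -/
theorem shNorm_succ_left {m k : ℕ} (h : k ≤ m) :
    (m + 1 + k) * shNorm (m + 1) k = (2 * m + 3) * coeffA m k * shNorm m k := by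
  obtain ⟨j, rfl⟩ := Nat.exists_eq_add_of_le h
  unfold shNorm coeffA
  rw [mul_left_comm, mul_left_comm _ ((-1 : ℝ) ^ k)]
  congr 1
  rw [← sq_eq_sq₀ (by positivity) (by positivity), mul_pow, mul_pow, mul_pow, Real.sq_sqrt,
    Real.sq_sqrt, Real.sq_sqrt]
  · rw [show k + j + 1 - k = j + 1 by omega, show k + j - k = j by omega,
      show k + j + 1 + k = k + j + k + 1 by omega, Nat.factorial_succ, Nat.factorial_succ]
    push_cast
    have := Real.pi_pos
    field_simp
    ring
  · positivity
  · push_cast; ring_nf; positivity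
  · positivity

theorem shNorm_eq_coeffB_mul {n k : ℕ} (h : k ≤ n) :
    shNorm n k = -((2 * n + 1) * coeffB n k * shNorm (n + 1) (k + 1)) := by
  obtain ⟨j, rfl⟩ := Nat.exists_eq_add_of_le h
  unfold shNorm coeffB
  rw [pow_succ, mul_left_comm, mul_assoc ((-1 : ℝ) ^ k), neg_one_mul, mul_neg, neg_neg]
  congr 1
  rw [← sq_eq_sq₀ (by positivity) (by positivity), mul_pow, mul_pow, Real.sq_sqrt,
    Real.sq_sqrt, Real.sq_sqrt]
  · rw [show k + j + 1 - (k + 1) = j by omega, show k + j - k = j by omega,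
      show k + j + 1 + (k + 1) = k + j + k + 1 + 1 by omega, Nat.factorial_succ, Nat.factorial_succ]
    push_cast
    have := Real.pi_pos
    field_simp
    ring
  · positivity
  · push_cast; positivity
  · positivity

theorem shNorm_succ_eq_coeffB_mul {m k : ℕ} (h : k + 1 ≤ m) :
    shNorm (m + 1) k = -((2 * m + 3) * coeffB m (-k - 1) * shNorm m (k + 1)) := by
  obtain ⟨j, rfl⟩ := Nat.exists_eq_add_of_le h
  unfold shNorm coeffB
  rw [pow_succ, mul_left_comm, mul_assoc ((-1 : ℝ) ^ k), neg_one_mul, mul_neg, neg_neg]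
  congr 1
  rw [← sq_eq_sq₀ (by positivity) (by positivity), mul_pow, mul_pow, Real.sq_sqrt,
    Real.sq_sqrt, Real.sq_sqrt]
  · rw [show k + 1 + j + 1 - k = j + 1 + 1 by omega, show k + 1 + j - (k + 1) = j by omega,
      show k + 1 + j + 1 + k = k + 1 + j + (k + 1) by omega, Nat.factorial_succ,
      Nat.factorial_succ]
    push_cast
    have := Real.pi_pos
    field_simp
    ring
  · positivity
  · push_cast; ring_nf; positivity
  · positivity

theorem shNorm_eq_coeffL_mul {n k : ℕ} (h : k < n) :
    shNorm n k = -(coeffL n k * shNorm n (k + 1)) := by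
  obtain ⟨j, rfl⟩ := Nat.exists_eq_add_of_lt h
  unfold shNorm coeffL
  rw [pow_succ, mul_left_comm, mul_assoc ((-1 : ℝ) ^ k), neg_one_mul, mul_neg, neg_neg]
  congr 1
  rw [← sq_eq_sq₀ (by positivity) (by positivity), mul_pow, Real.sq_sqrt,
    Real.sq_sqrt, Real.sq_sqrt]
  · rw [show k + j + 1 - (k + 1) = j by omega, show k + j + 1 - k = j + 1 by omega,
      show k + j + 1 + (k + 1) = k + j + 1 + k + 1 by omega, Nat.factorial_succ,
      Nat.factorial_succ (k + j + 1 + k)]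
    push_cast
    have := Real.pi_pos
    field_simp
    ring
  · positivity
  · push_cast; ring_nf; positivity
  · positivity

theorem coeffA_sq {n : ℕ} {k : ℤ} (h : k.natAbs ≤ n) :
    coeffA n k ^ 2 = (n + 1 - k) * (n + 1 + k) / ((2 * n + 1) * (2 * n + 3)) := by
  refine Real.sq_sqrt ?_
  have h1 : (k : ℝ) ≤ n := by exact_mod_cast (by omega : k ≤ n)
  have h2 : -(n : ℝ) ≤ k := by exact_mod_cast (by omega : -(n : ℤ) ≤ k)
  have h3 : 0 ≤ (n : ℝ) + 1 - k := by linarith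
  have h4 : 0 ≤ (n : ℝ) + 1 + k := by linarith
  positivity

theorem coeffB_sq {n : ℕ} {k : ℤ} (h : -(n : ℤ) - 2 ≤ k) :
    coeffB n k ^ 2 = (n + k + 1) * (n + k + 2) / ((2 * n + 1) * (2 * n + 3)) := by
  refine Real.sq_sqrt ?_
  -- At k = -n-2 one factor of the radicand is negative, but the other one vanishes. This boundary
  -- value occurs for the type (2) harmonics of extreme order.
  rcases eq_or_lt_of_le h with h | h
  · rw [← h]; push_cast; ring_nf; simp
  · have h2 : -(n : ℝ) - 1 ≤ k := by exact_mod_cast (by omega : -(n : ℤ) - 1 ≤ k)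
    have h3 : 0 ≤ (n : ℝ) + k + 1 := by linarith
    have h4 : 0 ≤ (n : ℝ) + k + 2 := by linarith
    positivity

theorem coeffL_sq {n : ℕ} {k : ℤ} (h : k.natAbs ≤ n) :
    coeffL n k ^ 2 = (n - k) * (n + k + 1) := by
  refine Real.sq_sqrt ?_
  have h1 : (k : ℝ) ≤ n := by exact_mod_cast (by omega : k ≤ n)
  have h2 : -(n : ℝ) ≤ k := by exact_mod_cast (by omega : -(n : ℤ) ≤ k)
  have h3 : 0 ≤ (n : ℝ) - k := by linarith
  have h4 : 0 ≤ (n : ℝ) + k + 1 := by linarith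
  positivity

theorem coeffL_self (n : ℕ) : coeffL n n = 0 := by simp [coeffL]

/-! ### Spherical harmonics and multiplication by the coordinates -/

/-- `x₁ + i x₂`. -/
def ePlus (x : E3) : ℂ := ((x 0 : ℝ) : ℂ) + ((x 1 : ℝ) : ℂ) * Complex.I

/-- `x₁ - i x₂`. -/
def eMinus (x : E3) : ℂ := ((x 0 : ℝ) : ℂ) - ((x 1 : ℝ) : ℂ) * Complex.I

theorem conj_ePlus (x : E3) : conj (ePlus x) = eMinus x := by
  simp [ePlus, eMinus, sub_eq_add_neg]

theorem conj_eMinus (x : E3) : conj (eMinus x) = ePlus x := by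
  rw [← conj_ePlus, Complex.conj_conj]

theorem sphere_sq_add (x : S2) : (x : E3) 0 ^ 2 + (x : E3) 1 ^ 2 + (x : E3) 2 ^ 2 = 1 := by
  have h : ‖(x : E3)‖ = 1 := by simp
  have h2 := EuclideanSpace.norm_sq_eq (x : E3)
  rw [h, Fin.sum_univ_three] at h2
  simp only [Real.norm_eq_abs, sq_abs] at h2
  linarith

theorem ePlus_mul_eMinus (x : S2) :
    ePlus (x : E3) * eMinus (x : E3) = 1 - (((x : E3) 2 : ℝ) : ℂ) ^ 2 := by
  have h := congrArg (fun t : ℝ => (t : ℂ)) (sphere_sq_add x)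
  push_cast at h
  unfold ePlus eMinus
  linear_combination h - (((x : E3) 1 : ℝ) : ℂ) ^ 2 * Complex.I_sq

theorem sphHarm_natCast {n k : ℕ} (h : k ≤ n) (x : S2) :
    sphHarm n (k : ℤ) x =
      ((shNorm n k * (legendreD n k).eval ((x : E3) 2) : ℝ) : ℂ) * ePlus x ^ k := by
  simp [sphHarm, h, sphHarmNonneg, shNorm, ePlus]

theorem sphHarm_eq_zero {n : ℕ} {k : ℤ} (h : n < k.natAbs) (x : S2) : sphHarm n k x = 0 := by
  simp [sphHarm, h]

theorem conj_sphHarm (n : ℕ) (k : ℤ) (x : S2) :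
    conj (sphHarm n k x) = (-1) ^ k * sphHarm n (-k) x := by
  have e : ((-1 : ℂ) ^ k) = (-1) ^ k.natAbs := by
    rcases Int.natAbs_eq k with h | h
    · conv_lhs => rw [h, zpow_natCast]
    · conv_lhs => rw [h, zpow_neg, zpow_natCast, ← inv_pow, inv_neg_one]
  have e2 : ((-1 : ℂ) ^ k.natAbs) * (-1) ^ k.natAbs = 1 := by
    rw [← mul_pow]; simp
  rw [e]
  rcases lt_trichotomy k 0 with h | rfl | h
  · simp only [sphHarm, Int.natAbs_neg]
    split_ifs <;> first | omega | simp
  · simp [sphHarm, sphHarmNonneg]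
  · simp only [sphHarm, Int.natAbs_neg]
    split_ifs <;> first | omega | simp [← mul_assoc, e2]

theorem sphHarm_neg (n : ℕ) (k : ℤ) (x : S2) :
    sphHarm n (-k) x = (-1) ^ k * conj (sphHarm n k x) := by
  rw [conj_sphHarm, ← mul_assoc, ← mul_zpow]; simp

theorem neg_one_zpow_succ (k : ℤ) : (-1 : ℂ) ^ (k + 1) = -(-1) ^ k := by
  rw [zpow_add₀ (by simp)]; simp

theorem eval_X_mul_legendreD (n k : ℕ) (z : ℝ) :
    (2 * n + 1) * (z * (legendreD n k).eval z) =
      (n + 1 - k) * (legendreD (n + 1) k).eval z + (n + k) * (legendreD (n - 1) k).eval z := by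
  simpa using congrArg (Polynomial.eval z) (X_mul_legendreD n k)

theorem eval_legendreD_sub (n k : ℕ) (z : ℝ) :
    (2 * n + 1) * (legendreD n k).eval z =
      (legendreD (n + 1) (k + 1)).eval z - (legendreD (n - 1) (k + 1)).eval z := by
  simpa [-Function.iterate_succ] using congrArg (Polynomial.eval z) (legendreD_sub n k)

theorem eval_one_sub_sq_mul_legendreD (n k : ℕ) (z : ℝ) :
    (2 * n + 1) * ((1 - z ^ 2) * (legendreD n (k + 1)).eval z) =
      (n + k + 1) * (n + k) * (legendreD (n - 1) k).eval z
        - (n - k) * (n - k + 1) * (legendreD (n + 1) k).eval z := by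
  simpa [-Function.iterate_succ] using congrArg (Polynomial.eval z) (one_sub_sq_mul_legendreD n k)

theorem eval_legendreD_ode (n k : ℕ) (z : ℝ) :
    (1 - z ^ 2) * (legendreD n (k + 2)).eval z - 2 * (k + 1) * z * (legendreD n (k + 1)).eval z =
      -((n + k + 1) * (n - k)) * (legendreD n k).eval z := by
  simpa [-Function.iterate_succ] using congrArg (Polynomial.eval z) (legendreD_ode n k)

theorem x2_mul_sphHarm_natCast {n k : ℕ} (h : k ≤ n) (x : S2) :
    (((x : E3) 2 : ℝ) : ℂ) * sphHarm n (k : ℤ) x =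
      coeffA n k * sphHarm (n + 1) k x + coeffA' n k * sphHarm (n - 1) k x := by
  rw [sphHarm_natCast h, sphHarm_natCast (by omega : k ≤ n + 1)]
  set z := (x : E3) 2
  have h1 := eval_X_mul_legendreD n k z
  have hup : (2 * n + 1) * (coeffA n k * shNorm (n + 1) k) = (n + 1 - k) * shNorm n k := by
    have h2 := shNorm_succ_left h
    have h3 := coeffA_sq (n := n) (k := k) (by simpa using h)
    have h4 : ((n : ℝ) + 1 + k) ≠ 0 := by positivity
    have h5 : (2 * (n : ℝ) + 3) ≠ 0 := by positivity
    have h6 : (2 * (n : ℝ) + 1) ≠ 0 := by positivity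
    push_cast at h3
    field_simp at h3
    apply mul_left_cancel₀ h4
    linear_combination (2 * n + 1) * coeffA n k * h2 + shNorm n k * h3
  -- If k > n - 1, the harmonic and the derivative of the Legendre polynomial are both zero. For n =
  -- k = 0, where n - 1 is truncated, both coefficients are zero.
  have hdown : ((coeffA' n k : ℝ) : ℂ) * sphHarm (n - 1) k x =
      (((n + k) / (2 * n + 1) * shNorm n k * (legendreD (n - 1) k).eval z : ℝ) : ℂ) *
        ePlus x ^ k := by
    rcases Nat.lt_or_ge (n - 1) k with h2 | h2
    · rw [sphHarm_eq_zero (by simpa using h2), legendreD_eq_zero h2]; simp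
    · rcases Nat.eq_zero_or_pos n with rfl | hn
      · obtain rfl : k = 0 := by omega
        simp [coeffA']
      · obtain ⟨m, rfl⟩ : ∃ m, n = m + 1 := ⟨n - 1, by omega⟩
        rw [coeffA'_succ, sphHarm_natCast h2, ← mul_assoc, ← Complex.ofReal_mul]
        congr 2
        have h3 := shNorm_succ_left (m := m) (k := k) (by omega)
        simp only [Nat.add_sub_cancel]
        push_cast
        have h5 : (2 * ((m : ℝ) + 1) + 1) ≠ 0 := by positivity
        field_simp
        linear_combination (-1) * Polynomial.eval z (legendreD m k) * h3
  rw [hdown, ← mul_assoc, ← mul_assoc, ← Complex.ofReal_mul, ← Complex.ofReal_mul, ← add_mul,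
    ← Complex.ofReal_add]
  congr 2
  have h6 : (2 * (n : ℝ) + 1) ≠ 0 := by positivity
  field_simp
  linear_combination shNorm n k * h1 - Polynomial.eval z (legendreD (n + 1) k) * hup

theorem x2_mul_sphHarm {n : ℕ} {k : ℤ} (h : k.natAbs ≤ n) (x : S2) :
    (((x : E3) 2 : ℝ) : ℂ) * sphHarm n k x =
      coeffA n k * sphHarm (n + 1) k x + coeffA' n k * sphHarm (n - 1) k x := by
  obtain ⟨j, rfl | rfl⟩ := Int.eq_nat_or_neg k
  · exact x2_mul_sphHarm_natCast (by simpa using h) x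
  · have h1 := congrArg conj (x2_mul_sphHarm_natCast (n := n) (k := j) (by simpa using h) x)
    simp only [map_mul, map_add, Complex.conj_ofReal] at h1
    simp only [sphHarm_neg, coeffA_neg, coeffA'_neg]
    linear_combination (-1) ^ (j : ℤ) * h1

theorem ePlus_mul_sphHarm_natCast {n k : ℕ} (h : k ≤ n) (x : S2) :
    ePlus x * sphHarm n (k : ℤ) x =
      -coeffB n k * sphHarm (n + 1) (k + 1) x + coeffB' n (-k) * sphHarm (n - 1) (k + 1) x := by
  have e : (k : ℤ) + 1 = ((k + 1 : ℕ) : ℤ) := by push_cast; rfl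
  rw [sphHarm_natCast h, e, sphHarm_natCast (by omega : k + 1 ≤ n + 1)]
  set z := (x : E3) 2
  have h1 := eval_legendreD_sub n k z
  have hup := shNorm_eq_coeffB_mul h
  have h6 : (2 * (n : ℝ) + 1) ≠ 0 := by positivity
  have hdown : ((coeffB' n (-k) : ℝ) : ℂ) * sphHarm (n - 1) ((k + 1 : ℕ) : ℤ) x =
      ((-1 / (2 * n + 1) * shNorm n k * (legendreD (n - 1) (k + 1)).eval z : ℝ) : ℂ) *
        ePlus x ^ (k + 1) := by
    rcases Nat.lt_or_ge (n - 1) (k + 1) with h2 | h2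
    · rw [sphHarm_eq_zero (by omega), legendreD_eq_zero h2]; simp
    · obtain ⟨m, rfl⟩ : ∃ m, n = m + 1 := ⟨n - 1, by omega⟩
      rw [coeffB'_succ, sphHarm_natCast h2, ← mul_assoc, ← Complex.ofReal_mul]
      congr 2
      have h3 := shNorm_succ_eq_coeffB_mul (m := m) (k := k) (by omega)
      simp only [Nat.add_sub_cancel]
      push_cast at h6 ⊢
      field_simp
      linear_combination Polynomial.eval z (legendreD m (k + 1)) * h3
  rw [hdown, pow_succ, mul_left_comm, mul_comm (ePlus (x : E3)), ← mul_assoc, ← Complex.ofReal_neg,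
    ← mul_assoc ((-coeffB n k : ℝ) : ℂ), ← Complex.ofReal_mul, ← add_mul,
    ← Complex.ofReal_add, mul_assoc]
  congr 2
  field_simp
  linear_combination shNorm n k * h1
    + Polynomial.eval z (legendreD (n + 1) (k + 1)) * hup

/-- Lowering the order uses up one factor `ePlus x`, since the product of `ePlus x` and `eMinus x`
is 1 - x₃². This is where the recurrence for (1 - X²) times a derivative of the Legendre polynomial
enters. -/
theorem eMinus_mul_sphHarm_natCast {n k : ℕ} (h : k + 1 ≤ n) (x : S2) :
    eMinus x * sphHarm n ((k + 1 : ℕ) : ℤ) x =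
      coeffB n (-(k + 1 : ℕ)) * sphHarm (n + 1) k x
        - coeffB' n (k + 1 : ℕ) * sphHarm (n - 1) k x := by
  rw [sphHarm_natCast h, sphHarm_natCast (by omega : k ≤ n + 1),
    sphHarm_natCast (by omega : k ≤ n - 1)]
  obtain ⟨m, rfl⟩ : ∃ m, n = m + 1 := ⟨n - 1, by omega⟩
  set z := (x : E3) 2 with hz
  have h1 := eval_one_sub_sq_mul_legendreD (m + 1) k z
  have h3 := shNorm_eq_coeffB_mul (n := m) (k := k) (by omega)
  have h3' := coeffB_sq (n := m) (k := k) (by omega)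
  have h4 := shNorm_succ_eq_coeffB_mul (m := m + 1) (k := k) (by omega)
  have h4' := coeffB_sq (n := m + 1) (k := -k - 1) (by omega)
  rw [coeffB'_succ, show ((k + 1 : ℕ) : ℤ) - 1 = k by push_cast; ring,
    show -((k + 1 : ℕ) : ℤ) = -k - 1 by push_cast; ring]
  have h6 : (2 * ((m : ℝ) + 1) + 1) ≠ 0 := by positivity
  have h7 : (2 * (m : ℝ) + 1) ≠ 0 := by positivity
  have h8 : (2 * (m : ℝ) + 3) ≠ 0 := by positivity
  have hup : (2 * (m + 1) + 1) * (coeffB (m + 1) (-k - 1) * shNorm (m + 1 + 1) k) =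
      -((m + 1 - k) * (m + 1 - k + 1) * shNorm (m + 1) (k + 1)) := by
    have h9 : (2 * ((m : ℝ) + 1) + 3) ≠ 0 := by positivity
    push_cast at h4 h4' h1
    field_simp at h4'
    linear_combination (2 * (m + 1) + 1) * coeffB (m + 1) (-k - 1) * h4
      - shNorm (m + 1) (k + 1) * h4'
  have hdown : (2 * (m + 1) + 1) * (coeffB m k * shNorm m k) =
      -((m + 1 + k + 1) * (m + 1 + k) * shNorm (m + 1) (k + 1)) := by
    push_cast at h3'
    field_simp at h3'
    linear_combination (2 * (m + 1) + 1) * coeffB m k * h3 - shNorm (m + 1) (k + 1) * h3'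
  have hpm := ePlus_mul_eMinus x
  rw [← hz] at hpm
  have h1' := congrArg (fun t : ℝ => (t : ℂ)) h1
  have hup' := congrArg (fun t : ℝ => (t : ℂ)) hup
  have hdown' := congrArg (fun t : ℝ => (t : ℂ)) hdown
  have h6' : (2 * ((m : ℂ) + 1) + 1) ≠ 0 := by exact_mod_cast h6
  apply mul_left_cancel₀ h6'
  simp only [Nat.add_sub_cancel] at h1' ⊢
  push_cast at h1' hup' hdown' ⊢
  rw [pow_succ]
  linear_combination (2 * ((m : ℂ) + 1) + 1) * (shNorm (m + 1) (k + 1)) *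
      (Polynomial.eval z (legendreD (m + 1) (k + 1)) : ℝ) * ePlus x ^ k * hpm
    + (shNorm (m + 1) (k + 1)) * ePlus x ^ k * h1'
    - ((Polynomial.eval z (legendreD (m + 1 + 1) k) : ℝ) : ℂ) * ePlus x ^ k * hup'
    + ((Polynomial.eval z (legendreD m k) : ℝ) : ℂ) * ePlus x ^ k * hdown'

/-- Conjugation exchanges x₁ + i x₂ and x₁ - i x₂ and reverses the order, so negative orders follow
from the lowering formula at positive orders. -/
theorem ePlus_mul_sphHarm {n : ℕ} {k : ℤ} (h : k.natAbs ≤ n) (x : S2) :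
    ePlus x * sphHarm n k x =
      -coeffB n k * sphHarm (n + 1) (k + 1) x + coeffB' n (-k) * sphHarm (n - 1) (k + 1) x := by
  rcases le_or_gt 0 k with h0 | h0
  · obtain ⟨j, rfl⟩ := Int.eq_ofNat_of_zero_le h0
    exact ePlus_mul_sphHarm_natCast (by simpa using h) x
  · obtain ⟨j, rfl⟩ : ∃ j : ℕ, k = -((j + 1 : ℕ) : ℤ) := ⟨(-k - 1).toNat, by omega⟩
    have h1 := congrArg conj (eMinus_mul_sphHarm_natCast (n := n) (k := j) (by omega) x)
    simp only [map_mul, map_sub, Complex.conj_ofReal, conj_eMinus] at h1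
    rw [show -((j + 1 : ℕ) : ℤ) + 1 = -(j : ℤ) by push_cast; ring]
    simp only [sphHarm_neg, neg_neg]
    have h2 : (-1 : ℂ) ^ ((j + 1 : ℕ) : ℤ) = -(-1) ^ (j : ℤ) := by
      push_cast; exact neg_one_zpow_succ _
    rw [h2]
    linear_combination -(-1) ^ (j : ℤ) * h1

theorem eMinus_mul_sphHarm {n : ℕ} {k : ℤ} (h : k.natAbs ≤ n) (x : S2) :
    eMinus x * sphHarm n k x =
      coeffB n (-k) * sphHarm (n + 1) (k - 1) x - coeffB' n k * sphHarm (n - 1) (k - 1) x := by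
  obtain ⟨j, rfl⟩ : ∃ j : ℤ, k = -j := ⟨-k, by simp⟩
  have h1 := congrArg conj (ePlus_mul_sphHarm (n := n) (k := j) (by simpa using h) x)
  simp only [map_mul, map_add, map_neg, Complex.conj_ofReal, conj_ePlus] at h1
  rw [show -j - 1 = -(j + 1) by ring]
  simp only [sphHarm_neg, neg_neg]
  rw [neg_one_zpow_succ]
  linear_combination (-1) ^ j * h1

/-! ### Surface gradient and surface curl gradient -/

theorem norm_sphere (x : S2) : ‖(x : E3)‖ = 1 := by simp

theorem sphere_ne_zero (x : S2) : (x : E3) ≠ 0 := by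
  intro h; have := norm_sphere x; rw [h] at this; simp at this

theorem radialExtension_comp_coe (F : E3 → ℂ) {y : E3} (hy : y ≠ 0) :
    radialExtension (fun z : S2 => F z) y = F (‖y‖⁻¹ • y) := by
  simp [radialExtension, hy]

theorem hasDerivAt_normalize_line (x : S2) (v : E3) :
    HasDerivAt (fun t : ℝ => ‖(x : E3) + t • v‖⁻¹ • ((x : E3) + t • v))
      (v - inner ℝ (x : E3) v • (x : E3)) 0 := by
  have hx := norm_sphere x
  have h1 : HasDerivAt (fun t : ℝ => (x : E3) + t • v) v 0 := by
    simpa using ((hasDerivAt_id (0 : ℝ)).smul_const v).const_add (x : E3)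
  have h2 : HasDerivAt (fun t : ℝ => ‖(x : E3) + t • v‖ ^ 2) (2 * inner ℝ (x : E3) v) 0 := by
    simpa using h1.norm_sq
  have h3 : HasDerivAt (fun t : ℝ => ‖(x : E3) + t • v‖) (inner ℝ (x : E3) v) 0 := by
    have h4 := h2.sqrt (by simp [hx])
    simp only [Real.sqrt_sq (norm_nonneg _), zero_smul, add_zero, hx] at h4
    convert h4 using 1
    ring
  have h5 := (h3.inv (by simp [hx])).smul h1
  refine h5.congr_deriv ?_
  simp [hx, sub_eq_add_neg]

theorem differentiableAt_normalize (x : S2) :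
    DifferentiableAt ℝ (fun y : E3 => ‖y‖⁻¹ • y) (x : E3) := by
  have h : DifferentiableAt ℝ (fun y : E3 => ‖y‖) (x : E3) :=
    differentiableAt_id.norm ℝ (sphere_ne_zero x)
  exact (h.inv (by simp)).smul differentiableAt_id

/-- The derivative of y ↦ y/‖y‖ at a unit vector is the orthogonal projection onto the tangent
plane; `hasDerivAt_normalize_line` computes it along lines. -/
theorem fderiv_radialExtension {F : E3 → ℂ} (x : S2) (hF : DifferentiableAt ℝ F x) (v : E3) :
    fderiv ℝ (radialExtension (fun z : S2 => F z)) (x : E3) v =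
      fderiv ℝ F x (v - inner ℝ (x : E3) v • (x : E3)) := by
  have e : radialExtension (fun z : S2 => F z) =ᶠ[nhds (x : E3)] F ∘ (fun y => ‖y‖⁻¹ • y) := by
    filter_upwards [isOpen_ne.mem_nhds (sphere_ne_zero x)] with y hy
    exact radialExtension_comp_coe F hy
  rw [e.fderiv_eq]
  have hn : ‖(x : E3)‖⁻¹ • (x : E3) = x := by simp
  have hF' : DifferentiableAt ℝ F (‖(x : E3)‖⁻¹ • (x : E3)) := by rwa [hn]
  rw [fderiv_comp (f := fun y : E3 => ‖y‖⁻¹ • y) (x : E3) hF' (differentiableAt_normalize x), hn, ContinuousLinearMap.comp_apply]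
  congr 1
  have h1 : HasDerivAt (fun t : ℝ => (x : E3) + t • v) v 0 := by
    simpa using ((hasDerivAt_id (0 : ℝ)).smul_const v).const_add (x : E3)
  have h2 : HasFDerivAt (fun y : E3 => ‖y‖⁻¹ • y) (fderiv ℝ (fun y : E3 => ‖y‖⁻¹ • y) (x : E3))
      ((x : E3) + (0 : ℝ) • v) := by
    simpa using (differentiableAt_normalize x).hasFDerivAt
  have h3 := h2.comp_hasDerivAt (0 : ℝ) h1
  exact h3.unique (hasDerivAt_normalize_line x v)

/-- The generator `e_j × x` of the rotations about the `j`-th axis. -/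
def rotField (j : Fin 3) (x : E3) : E3 :=
  match j with
  | 0 => !₂[0, -x 2, x 1]
  | 1 => !₂[x 2, 0, -x 0]
  | 2 => !₂[-x 1, x 0, 0]

theorem inner_rotField (j : Fin 3) (x : E3) : inner ℝ x (rotField j x) = 0 := by
  fin_cases j <;> simp [rotField, PiLp.inner_apply, Fin.sum_univ_three] <;> ring

theorem fderiv_radialExtension_eq_sum (f : S2 → ℂ) (x : S2) (v : E3) :
    fderiv ℝ (radialExtension f) (x : E3) v =
      v 0 * surfGrad f x 0 + v 1 * surfGrad f x 1 + v 2 * surfGrad f x 2 := by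
  have e : v = v 0 • EuclideanSpace.single 0 (1 : ℝ) + v 1 • EuclideanSpace.single 1 (1 : ℝ) +
      v 2 • EuclideanSpace.single 2 (1 : ℝ) := by
    ext i; fin_cases i <;> simp
  conv_lhs => rw [e]
  simp [surfGrad]

theorem surfCurlGrad_apply_eq (f : S2 → ℂ) (x : S2) (j : Fin 3) :
    surfCurlGrad f x j = fderiv ℝ (radialExtension f) (x : E3) (rotField j x) := by
  rw [fderiv_radialExtension_eq_sum]
  fin_cases j <;> simp [surfCurlGrad, rotField, crossProduct, complexify] <;> ring

/-- The generators of rotations are tangent to the sphere, so the projection does nothing. Hence L*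
can be computed from any ambient extension that is differentiable at x, in particular from the
polynomial one of a spherical harmonic. -/
theorem surfCurlGrad_comp_coe {F : E3 → ℂ} (x : S2) (hF : DifferentiableAt ℝ F x) (j : Fin 3) :
    surfCurlGrad (fun z : S2 => F z) x j = fderiv ℝ F x (rotField j x) := by
  rw [surfCurlGrad_apply_eq, fderiv_radialExtension x hF, inner_rotField]
  simp

/-- `∇* = -x × L*`. -/
theorem surfGrad_eq_neg_cross {F : E3 → ℂ} (x : S2) (hF : DifferentiableAt ℝ F x) (j : Fin 3) :
    surfGrad (fun z : S2 => F z) x j =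
      -crossProduct (complexify (x : E3)).ofLp (surfCurlGrad (fun z : S2 => F z) x).ofLp j := by
  -- The extension is constant along rays, so the gradient G is orthogonal to x; with ‖x‖ = 1 this
  -- gives x × (x × G) = -G.
  have hr : fderiv ℝ (radialExtension (fun z : S2 => F z)) (x : E3) (x : E3) = 0 := by
    rw [fderiv_radialExtension x hF]; simp
  have h : ((x : E3) 0 : ℂ) * surfGrad (fun z : S2 => F z) x 0 +
      ((x : E3) 1 : ℂ) * surfGrad (fun z : S2 => F z) x 1 +
      ((x : E3) 2 : ℂ) * surfGrad (fun z : S2 => F z) x 2 = 0 := by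
    rw [← hr, fderiv_radialExtension_eq_sum]
  have hs := congrArg (fun t : ℝ => (t : ℂ)) (sphere_sq_add x)
  push_cast at hs
  set G := surfGrad (fun z : S2 => F z) x with hG
  fin_cases j <;> simp [surfCurlGrad, crossProduct, complexify, ← hG]
  · linear_combination ((x : E3) 0 : ℂ) * h - G 0 * hs
  · linear_combination ((x : E3) 1 : ℂ) * h - G 1 * hs
  · linear_combination ((x : E3) 2 : ℂ) * h - G 2 * hs

/-! ### Angular momentum of the spherical harmonics -/

/-- The polynomial extension of `Y_{n,k}`, `k ≥ 0`, to the whole space. -/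
def sphHarmExtNonneg (n k : ℕ) (x : E3) : ℂ :=
  ((shNorm n k * (legendreD n k).eval (x 2) : ℝ) : ℂ) * ePlus x ^ k

/-- A smooth extension of `Y_{n,k}` to the whole space. -/
def sphHarmExt (n : ℕ) (k : ℤ) (x : E3) : ℂ :=
  if k.natAbs ≤ n then
    if 0 ≤ k then sphHarmExtNonneg n k.natAbs x
    else (-1) ^ k.natAbs * conj (sphHarmExtNonneg n k.natAbs x)
  else 0

theorem sphHarm_eq_ext (n : ℕ) (k : ℤ) : sphHarm n k = fun x : S2 => sphHarmExt n k x := rfl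

theorem contDiff_sphHarmExtNonneg (n k : ℕ) : ContDiff ℝ ⊤ (sphHarmExtNonneg n k) := by
  have h : ∀ i : Fin 3, ContDiff ℝ ⊤ (fun x : E3 => x i) := fun i => by fun_prop
  have h2 : ContDiff ℝ ⊤ (fun x : E3 => (legendreD n k).eval (x 2)) := by
    have := ((legendreD n k).contDiff_aeval (𝕜 := ℝ) (n := ⊤)).comp (h 2)
    simpa [Function.comp_def] using this
  unfold sphHarmExtNonneg ePlus
  refine ContDiff.mul (Complex.ofRealCLM.contDiff.comp (contDiff_const.mul h2)) (ContDiff.pow ?_ k)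
  exact (Complex.ofRealCLM.contDiff.comp (h 0)).add
    ((Complex.ofRealCLM.contDiff.comp (h 1)).mul contDiff_const)

theorem contDiff_sphHarmExt (n : ℕ) (k : ℤ) : ContDiff ℝ ⊤ (sphHarmExt n k) := by
  unfold sphHarmExt
  split_ifs
  · exact contDiff_sphHarmExtNonneg _ _
  · exact contDiff_const.mul (Complex.conjCLE.contDiff.comp (contDiff_sphHarmExtNonneg _ _))
  · exact contDiff_const

theorem differentiable_sphHarmExt (n : ℕ) (k : ℤ) : Differentiable ℝ (sphHarmExt n k) :=
  (contDiff_sphHarmExt n k).differentiable (by simp)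

theorem continuous_sphHarm (n : ℕ) (k : ℤ) : Continuous (sphHarm n k) := by
  rw [sphHarm_eq_ext]
  exact (contDiff_sphHarmExt n k).continuous.comp continuous_subtype_val

theorem fderiv_sphHarmExtNonneg (n k : ℕ) (x v : E3) :
    fderiv ℝ (sphHarmExtNonneg n k) x v =
      shNorm n k * (((legendreD n (k + 1)).eval (x 2) : ℝ) * v 2 * ePlus x ^ k +
        ((legendreD n k).eval (x 2) : ℝ) * (k * ePlus x ^ (k - 1) * ePlus v)) := by
  have h1 : HasDerivAt (fun t : ℝ => x + t • v) v 0 := by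
    simpa using ((hasDerivAt_id (0 : ℝ)).smul_const v).const_add x
  have hd : DifferentiableAt ℝ (sphHarmExtNonneg n k) (x + (0 : ℝ) • v) :=
    ((contDiff_sphHarmExtNonneg n k).differentiable (by simp)).differentiableAt
  have h2 := hd.hasFDerivAt.comp_hasDerivAt (0 : ℝ) h1
  simp only [zero_smul, add_zero] at h2
  refine h2.unique ?_
  have hc : ∀ i : Fin 3, HasDerivAt (fun t : ℝ => x i + t * v i) (v i) 0 := fun i => by
    simpa using ((hasDerivAt_id (0 : ℝ)).mul_const (v i)).const_add (x i)
  have hp : HasDerivAt (fun t : ℝ => (legendreD n k).eval (x 2 + t * v 2))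
      ((legendreD n (k + 1)).eval (x 2) * v 2) 0 := by
    have := (legendreD n k).hasDerivAt (x 2 + 0 * v 2)
    have h3 := HasDerivAt.comp (0 : ℝ) this (hc 2)
    rw [derivative_legendreD] at h3
    simpa [Function.comp_def] using h3
  have he : HasDerivAt (fun t : ℝ => ((x 0 + t * v 0 : ℝ) : ℂ) +
      ((x 1 + t * v 1 : ℝ) : ℂ) * Complex.I) (ePlus v) 0 :=
    (hc 0).ofReal_comp.add ((hc 1).ofReal_comp.mul_const _)
  have h4 := ((hp.const_mul (shNorm n k)).ofReal_comp).mul (he.pow k)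
  have h5 : (sphHarmExtNonneg n k ∘ fun t : ℝ => x + t • v) = fun t : ℝ =>
      ((shNorm n k * (legendreD n k).eval (x 2 + t * v 2) : ℝ) : ℂ) *
        (((x 0 + t * v 0 : ℝ) : ℂ) + ((x 1 + t * v 1 : ℝ) : ℂ) * Complex.I) ^ k := rfl
  rw [h5]
  refine h4.congr_deriv ?_
  simp [ePlus]
  ring

theorem L2_sphHarm_natCast {n k : ℕ} (h : k ≤ n) (x : S2) :
    surfCurlGrad (sphHarm n (k : ℤ)) x 2 = Complex.I * k * sphHarm n k x := by
  rw [sphHarm_natCast h, sphHarm_eq_ext,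
    surfCurlGrad_comp_coe x (differentiable_sphHarmExt _ _).differentiableAt]
  have e : sphHarmExt n (k : ℤ) = sphHarmExtNonneg n k := by ext y; simp [sphHarmExt, h]
  rw [e, fderiv_sphHarmExtNonneg]
  have hv : ePlus (rotField 2 (x : E3)) = Complex.I * ePlus x := by
    simp [ePlus, rotField]; linear_combination -((x : E3) 1 : ℂ) * Complex.I_sq
  have hv2 : (rotField 2 (x : E3)) 2 = 0 := by simp [rotField]
  rw [hv, hv2]
  rcases k with _ | k
  · simp
  · push_cast
    ring

/-- The raising operator annihilates x₁ + i x₂ (`hv`), so it differentiates only the Legendre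
factor. At k = n both sides vanish. -/
theorem LPlus_sphHarm_natCast {n k : ℕ} (h : k ≤ n) (x : S2) :
    surfCurlGrad (sphHarm n (k : ℤ)) x 0 + Complex.I * surfCurlGrad (sphHarm n (k : ℤ)) x 1 =
      Complex.I * coeffL n k * sphHarm n (k + 1) x := by
  have hk : sphHarm n (k + 1) x = sphHarm n ((k + 1 : ℕ) : ℤ) x := by push_cast; rfl
  rw [hk, sphHarm_eq_ext n k, surfCurlGrad_comp_coe x (differentiable_sphHarmExt _ _).differentiableAt,
    surfCurlGrad_comp_coe x (differentiable_sphHarmExt _ _).differentiableAt]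
  have e : sphHarmExt n (k : ℤ) = sphHarmExtNonneg n k := by ext y; simp [sphHarmExt, h]
  rw [e, fderiv_sphHarmExtNonneg, fderiv_sphHarmExtNonneg]
  have hv : ePlus (rotField 0 (x : E3)) + Complex.I * ePlus (rotField 1 (x : E3)) = 0 := by
    simp [ePlus, rotField]; ring
  have hv2 : (((rotField 0 (x : E3)) 2 : ℝ) : ℂ) + Complex.I * ((rotField 1 (x : E3)) 2 : ℝ) =
      -Complex.I * ePlus x := by
    simp [rotField, ePlus]; linear_combination ((x : E3) 1 : ℂ) * Complex.I_sq
  have hY : (coeffL n k : ℂ) * sphHarm n ((k + 1 : ℕ) : ℤ) x =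
      -(shNorm n k * ((legendreD n (k + 1)).eval ((x : E3) 2) : ℝ) * ePlus x ^ (k + 1)) := by
    rcases h.eq_or_lt with rfl | h
    · rw [legendreD_eq_zero (by omega), coeffL_self]; simp
    · rw [sphHarm_natCast (by omega : k + 1 ≤ n), shNorm_eq_coeffL_mul h]
      push_cast; ring
  linear_combination shNorm n k * ((legendreD n (k + 1)).eval ((x : E3) 2) : ℝ) * ePlus x ^ k * hv2
    + shNorm n k * ((legendreD n k).eval ((x : E3) 2) : ℝ) * (k * ePlus x ^ (k - 1)) * hv
    - Complex.I * hY

/-- The lowering operator differentiates both factors; the resulting combination of two derivatives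
of the Legendre polynomial collapses by `eval_legendreD_ode`. -/
theorem LMinus_sphHarm_natCast {n k : ℕ} (h : k + 1 ≤ n) (x : S2) :
    surfCurlGrad (sphHarm n ((k + 1 : ℕ) : ℤ)) x 0 -
        Complex.I * surfCurlGrad (sphHarm n ((k + 1 : ℕ) : ℤ)) x 1 =
      Complex.I * coeffL n k * sphHarm n k x := by
  rw [sphHarm_eq_ext n ((k + 1 : ℕ) : ℤ), surfCurlGrad_comp_coe x (differentiable_sphHarmExt _ _).differentiableAt,
    surfCurlGrad_comp_coe x (differentiable_sphHarmExt _ _).differentiableAt]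
  have e : sphHarmExt n ((k + 1 : ℕ) : ℤ) = sphHarmExtNonneg n (k + 1) := by
    ext y
    rw [sphHarmExt, if_pos (by omega), if_pos (by positivity), Int.natAbs_natCast]
  rw [e, fderiv_sphHarmExtNonneg, fderiv_sphHarmExtNonneg]
  have hv : ePlus (rotField 0 (x : E3)) - Complex.I * ePlus (rotField 1 (x : E3)) =
      -(2 * Complex.I * ((x : E3) 2 : ℝ)) := by
    simp [ePlus, rotField]; ring
  have hv2 : (((rotField 0 (x : E3)) 2 : ℝ) : ℂ) - Complex.I * ((rotField 1 (x : E3)) 2 : ℝ) =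
      Complex.I * eMinus x := by
    simp [rotField, eMinus]; linear_combination ((x : E3) 1 : ℂ) * Complex.I_sq
  have h1 := congrArg (fun t : ℝ => (t : ℂ)) (eval_legendreD_ode n k ((x : E3) 2))
  have hpm := ePlus_mul_eMinus x
  have hn : (coeffL n k : ℂ) * shNorm n k = -((n + k + 1) * (n - k) * shNorm n (k + 1)) := by
    have h2 := shNorm_eq_coeffL_mul (n := n) (k := k) (by omega)
    have h3 := coeffL_sq (n := n) (k := k) (by omega)
    have h4 : coeffL n k * shNorm n k = -((n + k + 1) * (n - k) * shNorm n (k + 1)) := by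
      push_cast at h3
      linear_combination coeffL n k * h2 - shNorm n (k + 1) * h3
    exact_mod_cast h4
  rw [sphHarm_natCast (by omega : k ≤ n)]
  push_cast at h1 ⊢
  rw [pow_succ]
  linear_combination shNorm n (k + 1) * ((legendreD n (k + 2)).eval ((x : E3) 2) : ℝ) *
      ePlus x ^ k * ePlus x * hv2
    + shNorm n (k + 1) * ((legendreD n (k + 1)).eval ((x : E3) 2) : ℝ) *
      ((k + 1) * ePlus x ^ k) * hv
    + Complex.I * shNorm n (k + 1) * ((legendreD n (k + 2)).eval ((x : E3) 2) : ℝ) *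
      ePlus x ^ k * hpm
    + Complex.I * shNorm n (k + 1) * ePlus x ^ k * h1
    - Complex.I * ((legendreD n k).eval ((x : E3) 2) : ℝ) * ePlus x ^ k * hn

/-- L* is a real operator, so it commutes with conjugation; this carries the ladder formulas over to
negative orders. -/
theorem surfCurlGrad_sphHarm_neg (n : ℕ) (k : ℤ) (x : S2) (j : Fin 3) :
    surfCurlGrad (sphHarm n (-k)) x j = (-1) ^ k * conj (surfCurlGrad (sphHarm n k) x j) := by
  have e : radialExtension (sphHarm n (-k)) =
      fun y => ((-1 : ℂ) ^ k) • (Complex.conjCLE ∘ radialExtension (sphHarm n k)) y := by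
    ext y
    simp only [radialExtension, Function.comp_apply]
    split_ifs
    · rw [sphHarm_neg]; simp
    · simp
  rw [surfCurlGrad_apply_eq, surfCurlGrad_apply_eq, e]
  have hne : ((-1 : ℂ) ^ k) ≠ 0 := zpow_ne_zero _ (by simp)
  have h1 := fderiv_const_smul_field (R := ℂ) (𝕜 := ℝ) ((-1 : ℂ) ^ k)
    (f := Complex.conjCLE ∘ radialExtension (sphHarm n k))
  have h2 : (fun y => ((-1 : ℂ) ^ k) • (Complex.conjCLE ∘ radialExtension (sphHarm n k)) y) =
    ((-1 : ℂ) ^ k) • (Complex.conjCLE ∘ radialExtension (sphHarm n k)) := rfl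
  rw [h2, h1, Pi.smul_apply, ContinuousLinearEquiv.comp_fderiv]
  simp

theorem L2_sphHarm {n : ℕ} {k : ℤ} (h : k.natAbs ≤ n) (x : S2) :
    surfCurlGrad (sphHarm n k) x 2 = Complex.I * k * sphHarm n k x := by
  obtain ⟨j, rfl | rfl⟩ := Int.eq_nat_or_neg k
  · simpa using L2_sphHarm_natCast (by simpa using h) x
  · rw [surfCurlGrad_sphHarm_neg, L2_sphHarm_natCast (by simpa using h), sphHarm_neg]
    simp
    ring

theorem LPlus_sphHarm {n : ℕ} {k : ℤ} (h : k.natAbs ≤ n) (x : S2) :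
    surfCurlGrad (sphHarm n k) x 0 + Complex.I * surfCurlGrad (sphHarm n k) x 1 =
      Complex.I * coeffL n k * sphHarm n (k + 1) x := by
  rcases le_or_gt 0 k with h0 | h0
  · obtain ⟨j, rfl⟩ := Int.eq_ofNat_of_zero_le h0
    exact LPlus_sphHarm_natCast (by simpa using h) x
  · obtain ⟨j, rfl⟩ : ∃ j : ℕ, k = -((j + 1 : ℕ) : ℤ) := ⟨(-k - 1).toNat, by omega⟩
    have h1 := congrArg conj (LMinus_sphHarm_natCast (n := n) (k := j) (by omega) x)
    simp only [map_mul, map_sub, Complex.conj_ofReal, Complex.conj_I] at h1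
    rw [show -((j + 1 : ℕ) : ℤ) + 1 = -(j : ℤ) by push_cast; ring]
    simp only [sphHarm_neg, surfCurlGrad_sphHarm_neg]
    have h2 : (-1 : ℂ) ^ ((j + 1 : ℕ) : ℤ) = -(-1) ^ (j : ℤ) := by
      push_cast; exact neg_one_zpow_succ _
    have h3 : coeffL n (-((j + 1 : ℕ) : ℤ)) = coeffL n j := by
      unfold coeffL; congr 1; push_cast; ring
    rw [h2, h3]
    linear_combination -(-1) ^ (j : ℤ) * h1

theorem LMinus_sphHarm {n : ℕ} {k : ℤ} (h : k.natAbs ≤ n) (x : S2) :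
    surfCurlGrad (sphHarm n k) x 0 - Complex.I * surfCurlGrad (sphHarm n k) x 1 =
      Complex.I * coeffL n (-k) * sphHarm n (k - 1) x := by
  obtain ⟨j, rfl⟩ : ∃ j : ℤ, k = -j := ⟨-k, by simp⟩
  have h1 := congrArg conj (LPlus_sphHarm (n := n) (k := j) (by simpa using h) x)
  simp only [map_mul, map_add, Complex.conj_ofReal, Complex.conj_I] at h1
  rw [show -j - 1 = -(j + 1) by ring]
  simp only [sphHarm_neg, surfCurlGrad_sphHarm_neg, neg_neg]
  rw [neg_one_zpow_succ]
  linear_combination (-1) ^ j * h1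

/-! ### Rotation invariance of the surface measure -/

/-- The action of a linear isometry on the unit sphere. -/
def sphereMap (e : E3 ≃ₗᵢ[ℝ] E3) (x : S2) : S2 := ⟨e x, by simp⟩

theorem continuous_sphereMap (e : E3 ≃ₗᵢ[ℝ] E3) : Continuous (sphereMap e) :=
  (e.continuous.comp continuous_subtype_val).subtype_mk _

open scoped Pointwise in
-- The surface measure of a set is a multiple of the volume of the cone over it, and a linear
-- isometry maps cones to cones of equal volume.
theorem measurePreserving_sphereMap (e : E3 ≃ₗᵢ[ℝ] E3) :
    MeasurePreserving (sphereMap e) surfaceMeasure surfaceMeasure := by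
  refine ⟨(continuous_sphereMap e).measurable, ?_⟩
  ext s hs
  have hm := (continuous_sphereMap e).measurable
  rw [Measure.map_apply hm hs, Measure.toSphere_apply' _ hs, Measure.toSphere_apply' _ (hm hs)]
  congr 1
  have h : Set.Ioo (0 : ℝ) 1 • ((fun x : S2 => (x : E3)) '' (sphereMap e ⁻¹' s)) =
      e ⁻¹' (Set.Ioo (0 : ℝ) 1 • ((fun x : S2 => (x : E3)) '' s)) := by
    ext y
    simp only [Set.mem_smul, Set.mem_image, Set.mem_preimage]
    constructor
    · rintro ⟨r, hr, _, ⟨x, hx, rfl⟩, rfl⟩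
      exact ⟨r, hr, _, ⟨_, hx, rfl⟩, by simp [sphereMap]⟩
    · rintro ⟨r, hr, _, ⟨x, hx, rfl⟩, hy⟩
      refine ⟨r, hr, _, ⟨sphereMap e.symm x, ?_, rfl⟩, ?_⟩
      · have : sphereMap e (sphereMap e.symm x) = x := by ext1; simp [sphereMap]
        rwa [this]
      · apply e.injective
        rw [← hy]; simp [sphereMap]
  have h2 := e.measurePreserving.measure_preimage_emb
    e.toHomeomorph.toMeasurableEquiv.measurableEmbedding
    (Set.Ioo (0 : ℝ) 1 • ((fun x : S2 => (x : E3)) '' s))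
  rw [← h2, ← h]

/-- The rotation by the angle `t` about the `j`-th axis. -/
def rotMap (j : Fin 3) (t : ℝ) : E3 →ₗ[ℝ] E3 where
  toFun x := Real.cos t • x + Real.sin t • rotField j x +
    ((1 - Real.cos t) * x j) • EuclideanSpace.single j (1 : ℝ)
  map_add' x y := by
    ext i
    fin_cases j <;> fin_cases i <;> simp [rotField] <;> ring
  map_smul' c x := by
    ext i
    fin_cases j <;> fin_cases i <;> simp [rotField] <;> ring

theorem rotMap_apply (j : Fin 3) (t : ℝ) (x : E3) :
    rotMap j t x = Real.cos t • x + Real.sin t • rotField j x +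
      ((1 - Real.cos t) * x j) • EuclideanSpace.single j (1 : ℝ) := rfl

theorem norm_rotMap (j : Fin 3) (t : ℝ) (x : E3) : ‖rotMap j t x‖ = ‖x‖ := by
  have hs := Real.sin_sq t
  rw [← sq_eq_sq₀ (norm_nonneg _) (norm_nonneg _), EuclideanSpace.norm_sq_eq,
    EuclideanSpace.norm_sq_eq, Fin.sum_univ_three, Fin.sum_univ_three]
  simp only [Real.norm_eq_abs, sq_abs]
  fin_cases j <;> simp [rotMap_apply, rotField]
  · linear_combination (x 1 ^ 2 + x 2 ^ 2) * hs
  · linear_combination (x 0 ^ 2 + x 2 ^ 2) * hs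
  · linear_combination (x 0 ^ 2 + x 1 ^ 2) * hs

/-- The rotation by the angle `t` about the `j`-th axis, as a linear isometry. -/
def rotIso (j : Fin 3) (t : ℝ) : E3 ≃ₗᵢ[ℝ] E3 :=
  LinearIsometry.toLinearIsometryEquiv ⟨rotMap j t, norm_rotMap j t⟩ rfl

theorem rotIso_apply (j : Fin 3) (t : ℝ) (x : E3) : rotIso j t x = rotMap j t x := rfl

theorem hasDerivAt_rotMap (j : Fin 3) (t : ℝ) (x : E3) :
    HasDerivAt (fun s => rotMap j s x) (rotField j (rotMap j t x)) t := by
  simp only [rotMap_apply]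
  have h := (((Real.hasDerivAt_cos t).smul_const x).add
    ((Real.hasDerivAt_sin t).smul_const (rotField j x))).add
    ((((Real.hasDerivAt_cos t).const_sub 1).mul_const (x j)).smul_const
      (EuclideanSpace.single j (1 : ℝ)))
  refine h.congr_deriv ?_
  ext i
  fin_cases j <;> fin_cases i <;> simp [rotField] <;> ring

theorem continuous_rotField (j : Fin 3) : Continuous (rotField j) :=
  match j with
  | 0 => show Continuous fun x : E3 => !₂[0, -x 2, x 1] by fun_prop
  | 1 => show Continuous fun x : E3 => !₂[x 2, 0, -x 0] by fun_prop
  | 2 => show Continuous fun x : E3 => !₂[-x 1, x 0, 0] by fun_prop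

/-- By rotation invariance the integral of F composed with the rotation by t does not depend on t;
its derivative at t = 0 is the integral in question. -/
theorem integral_fderiv_rotField_eq_zero {F : E3 → ℂ} (hF : ContDiff ℝ ⊤ F) (j : Fin 3) :
    ∫ x : S2, fderiv ℝ F x (rotField j x) ∂surfaceMeasure = 0 := by
  have hcont : Continuous (fun x : S2 => fderiv ℝ F x (rotField j x)) := by
    have h1 : Continuous (fderiv ℝ F) := hF.continuous_fderiv (by simp)
    exact (h1.comp continuous_subtype_val).clm_apply
      ((continuous_rotField j).comp continuous_subtype_val)
  obtain ⟨C, hC⟩ := (isCompact_univ (X := S2)).exists_bound_of_continuousOn hcont.continuousOn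
  have hFc : Continuous (fun x : S2 => F x) := hF.continuous.comp continuous_subtype_val
  have hd := hasDerivAt_integral_of_dominated_loc_of_deriv_le (μ := (surfaceMeasure : Measure S2))
    (F := fun (t : ℝ) (x : S2) => F (sphereMap (rotIso j t) x))
    (F' := fun (t : ℝ) (x : S2) => fderiv ℝ F (sphereMap (rotIso j t) x)
      (rotField j (sphereMap (rotIso j t) x)))
    (x₀ := 0) (s := Set.univ) (bound := fun _ => C) Filter.univ_mem
    (Filter.Eventually.of_forall fun t =>
      (hFc.comp (continuous_sphereMap _)).aestronglyMeasurable)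
    ((hFc.comp (continuous_sphereMap _)).integrable_of_hasCompactSupport
      (HasCompactSupport.of_compactSpace _))
    (hcont.comp (continuous_sphereMap _)).aestronglyMeasurable
    (Filter.Eventually.of_forall fun x t _ => hC _ (Set.mem_univ _))
    (integrable_const _)
    (Filter.Eventually.of_forall fun x t _ => by
      have h1 : DifferentiableAt ℝ F (rotMap j t x) := hF.differentiable (by simp) _
      exact h1.hasFDerivAt.comp_hasDerivAt t (hasDerivAt_rotMap j t x))
  have h0 : ∀ x : S2, sphereMap (rotIso j 0) x = x := by
    intro x; ext1; simp [sphereMap, rotIso_apply, rotMap_apply]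
  have hinv : ∀ t : ℝ, ∫ x, F (sphereMap (rotIso j t) x) ∂surfaceMeasure =
      ∫ x : S2, F x ∂surfaceMeasure := fun t =>
    (measurePreserving_sphereMap (rotIso j t)).integral_comp'
      (f := (Homeomorph.mk ⟨sphereMap (rotIso j t), sphereMap (rotIso j t).symm,
        fun x => by ext1; simp [sphereMap], fun x => by ext1; simp [sphereMap]⟩
        (continuous_sphereMap _) (continuous_sphereMap _)).toMeasurableEquiv) (fun x : S2 => F x)
  have h2 := hd.2
  simp only [hinv, h0] at h2
  exact h2.unique (hasDerivAt_const _ _)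

/-! ### Orthonormality of the spherical harmonics -/

/-- The `L²` inner product on the sphere, linear in the first argument. -/
def sphInner (f g : S2 → ℂ) : ℂ := ∫ x, f x * conj (g x) ∂surfaceMeasure

theorem shCoeff_eq_sphInner (f : S2 → ℂ) (m : ℕ) (l : ℤ) :
    shCoeff f m l = sphInner f (sphHarm m l) := rfl

theorem integrable_of_continuous {f : S2 → ℂ} (hf : Continuous f) :
    Integrable f surfaceMeasure :=
  hf.integrable_of_hasCompactSupport (HasCompactSupport.of_compactSpace _)

theorem conj_sphInner (f g : S2 → ℂ) : conj (sphInner f g) = sphInner g f := by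
  unfold sphInner
  rw [← integral_conj]
  congr 1; ext x; simp [mul_comm]

theorem sphInner_const_mul_left (c : ℂ) (f g : S2 → ℂ) :
    sphInner (fun x => c * f x) g = c * sphInner f g := by
  unfold sphInner
  rw [← integral_const_mul]
  congr 1; ext x; ring

theorem sphInner_const_mul_right (c : ℂ) (f g : S2 → ℂ) :
    sphInner f (fun x => c * g x) = conj c * sphInner f g := by
  rw [← conj_sphInner, sphInner_const_mul_left, map_mul, conj_sphInner]

theorem sphInner_add_left {f₁ f₂ g : S2 → ℂ} (h₁ : Continuous f₁) (h₂ : Continuous f₂)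
    (hg : Continuous g) :
    sphInner (fun x => f₁ x + f₂ x) g = sphInner f₁ g + sphInner f₂ g := by
  have hg' := Complex.continuous_conj.comp hg
  have h := integral_add (integrable_of_continuous (h₁.mul hg'))
    (integrable_of_continuous (h₂.mul hg'))
  refine Eq.trans ?_ h
  unfold sphInner
  congr 1; ext x; simp [add_mul]

theorem sphInner_add_right {f g₁ g₂ : S2 → ℂ} (h₁ : Continuous g₁) (h₂ : Continuous g₂)
    (hf : Continuous f) :
    sphInner f (fun x => g₁ x + g₂ x) = sphInner f g₁ + sphInner f g₂ := by
  rw [← conj_sphInner, sphInner_add_left h₁ h₂ hf, map_add, conj_sphInner, conj_sphInner]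

theorem continuous_surfCurlGrad_sphHarm (n : ℕ) (k : ℤ) (j : Fin 3) :
    Continuous (fun x => surfCurlGrad (sphHarm n k) x j) := by
  have h : (fun x => surfCurlGrad (sphHarm n k) x j) =
      fun x : S2 => fderiv ℝ (sphHarmExt n k) x (rotField j x) := by
    ext x
    exact surfCurlGrad_comp_coe x (differentiable_sphHarmExt _ _).differentiableAt j
  rw [h]
  have h1 : Continuous (fderiv ℝ (sphHarmExt n k)) :=
    (contDiff_sphHarmExt n k).continuous_fderiv (by simp)
  exact (h1.comp continuous_subtype_val).clm_apply
    ((continuous_rotField j).comp continuous_subtype_val)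

/-- Integration by parts: the rotational derivative of one harmonic times the conjugate of the other
integrates to zero. -/
theorem sphInner_surfCurlGrad (n m : ℕ) (k l : ℤ) (j : Fin 3) :
    sphInner (fun x => surfCurlGrad (sphHarm n k) x j) (sphHarm m l) =
      -sphInner (sphHarm n k) (fun x => surfCurlGrad (sphHarm m l) x j) := by
  have hc : ContDiff ℝ ⊤ (fun y => Complex.conjCLE (sphHarmExt m l y)) :=
    Complex.conjCLE.contDiff.comp (contDiff_sphHarmExt m l)
  have h := integral_fderiv_rotField_eq_zero ((contDiff_sphHarmExt n k).mul hc) j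
  rw [eq_neg_iff_add_eq_zero, ← h, sphInner, sphInner, ← integral_add]
  · congr 1
    ext x
    have hd1 : DifferentiableAt ℝ (sphHarmExt n k) (x : E3) :=
      (differentiable_sphHarmExt _ _).differentiableAt
    have hd2 : DifferentiableAt ℝ (sphHarmExt m l) (x : E3) :=
      (differentiable_sphHarmExt _ _).differentiableAt
    have hd3 : DifferentiableAt ℝ (fun y => Complex.conjCLE (sphHarmExt m l y)) (x : E3) :=
      (hc.differentiable (by simp)).differentiableAt
    have e := fderiv_mul hd1 hd3
    have e2 : fderiv ℝ (fun y => Complex.conjCLE (sphHarmExt m l y)) (x : E3) (rotField j x) =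
        conj (fderiv ℝ (sphHarmExt m l) (x : E3) (rotField j x)) := by
      have := Complex.conjCLE.comp_fderiv (f := sphHarmExt m l) (x := (x : E3))
      rw [Function.comp_def] at this
      rw [this]; simp
    rw [show (sphHarmExt n k * fun y => Complex.conjCLE (sphHarmExt m l y)) =
      fun y => sphHarmExt n k y * Complex.conjCLE (sphHarmExt m l y) from rfl] at e
    rw [sphHarm_eq_ext n k, sphHarm_eq_ext m l, surfCurlGrad_comp_coe x hd1,
      surfCurlGrad_comp_coe x hd2, e]
    rw [add_apply, smul_apply, smul_apply, e2]
    simp only [smul_eq_mul, Complex.conjCLE_apply]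
    ring
  · exact integrable_of_continuous ((continuous_surfCurlGrad_sphHarm n k j).mul
      (Complex.continuous_conj.comp (continuous_sphHarm m l)))
  · exact integrable_of_continuous ((continuous_sphHarm n k).mul
      (Complex.continuous_conj.comp (continuous_surfCurlGrad_sphHarm m l j)))

/-- The two harmonics are eigenfunctions of the antisymmetric third component of L*, with the
distinct eigenvalues ik and il. -/
theorem sphInner_sphHarm_of_ord_ne {n m : ℕ} {k l : ℤ} (hk : k.natAbs ≤ n) (hl : l.natAbs ≤ m)
    (hkl : k ≠ l) : sphInner (sphHarm n k) (sphHarm m l) = 0 := by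
  have h := sphInner_surfCurlGrad n m k l 2
  simp only [L2_sphHarm hk, L2_sphHarm hl] at h
  rw [sphInner_const_mul_left, sphInner_const_mul_right] at h
  simp only [map_mul, Complex.conj_I, map_intCast] at h
  have h2 : Complex.I * ((k : ℂ) - l) * sphInner (sphHarm n k) (sphHarm m l) = 0 := by
    linear_combination h
  have h3 : (k : ℂ) - l ≠ 0 := sub_ne_zero.2 (by exact_mod_cast hkl)
  simpa [h3] using h2

/-- Moved to the other factor, the raising operator becomes minus the lowering operator. The degrees
may differ, so this serves both orthogonality and normalization. -/
theorem sphInner_ladder {n m : ℕ} {k : ℤ} (hk : k.natAbs ≤ n) (hk' : (k + 1).natAbs ≤ m) :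
    coeffL n k * sphInner (sphHarm n (k + 1)) (sphHarm m (k + 1)) =
      coeffL m k * sphInner (sphHarm n k) (sphHarm m k) := by
  have h0 := sphInner_surfCurlGrad n m k (k + 1) 0
  have h1 := sphInner_surfCurlGrad n m k (k + 1) 1
  have hl : (fun x => surfCurlGrad (sphHarm n k) x 0 + Complex.I * surfCurlGrad (sphHarm n k) x 1) =
      fun x => Complex.I * coeffL n k * sphHarm n (k + 1) x := funext (LPlus_sphHarm hk)
  have hr : (fun x => surfCurlGrad (sphHarm m (k + 1)) x 0 +
      (-Complex.I) * surfCurlGrad (sphHarm m (k + 1)) x 1) =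
      fun x => Complex.I * coeffL m (-(k + 1)) * sphHarm m (k + 1 - 1) x := by
    ext x
    rw [← LMinus_sphHarm hk']; ring
  have hl' := congrArg (fun f => sphInner f (sphHarm m (k + 1))) hl
  have hr' := congrArg (fun f => sphInner (sphHarm n k) f) hr
  have hc := fun (n : ℕ) (k : ℤ) (j : Fin 3) => continuous_surfCurlGrad_sphHarm n k j
  have hc' : ∀ (n : ℕ) (k : ℤ) (j : Fin 3) (c : ℂ),
      Continuous fun x => c * surfCurlGrad (sphHarm n k) x j :=
    fun n k j c => continuous_const.mul (hc n k j)
  simp only at hl' hr'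
  rw [sphInner_add_left (hc _ _ _) (hc' _ _ _ _) (continuous_sphHarm _ _),
    sphInner_const_mul_left, sphInner_const_mul_left] at hl'
  rw [sphInner_add_right (hc _ _ _) (hc' _ _ _ _) (continuous_sphHarm _ _),
    sphInner_const_mul_right, sphInner_const_mul_right] at hr'
  have e : coeffL m (-(k + 1)) = coeffL m k := by
    unfold coeffL; congr 1; push_cast; ring
  rw [add_sub_cancel_right, e] at hr'
  simp only [map_mul, map_neg, Complex.conj_I, Complex.conj_ofReal] at hr'
  apply mul_left_cancel₀ Complex.I_ne_zero
  linear_combination -hl' + h0 + Complex.I * h1 - hr'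

/-- Going up and down the ladder multiplies the inner product by (n-k)(n+k+1) on one side and
(m-k)(m+k+1) on the other. These differ by n(n+1) - m(m+1), the difference of two eigenvalues of the
Beltrami operator up to sign. -/
theorem sphInner_sphHarm_of_deg_lt {n m : ℕ} {k : ℤ} (hk : k.natAbs ≤ n) (hnm : n < m) :
    sphInner (sphHarm n k) (sphHarm m k) = 0 := by
  have h1 := sphInner_ladder (n := n) (m := m) hk (by omega)
  have hn2 : ((coeffL n k : ℝ) : ℂ) ^ 2 = (n - k) * (n + k + 1) := by
    exact_mod_cast coeffL_sq hk
  have hm2 : ((coeffL m k : ℝ) : ℂ) ^ 2 = (m - k) * (m + k + 1) := by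
    exact_mod_cast coeffL_sq (by omega)
  have hne : ((m : ℂ) - n) * (m + n + 1) ≠ 0 := by
    have : ((m : ℤ) - n) * (m + n + 1) ≠ 0 := mul_ne_zero (by omega) (by omega)
    exact_mod_cast this
  have h2 : (coeffL m k : ℂ) * sphInner (sphHarm n (k + 1)) (sphHarm m (k + 1)) =
      coeffL n k * sphInner (sphHarm n k) (sphHarm m k) := by
    -- At the top order k = n the raised harmonic is zero and so is `coeffL n n`; below it the
    -- ladder identity is used with the degrees exchanged and conjugated.
    rcases eq_or_lt_of_le (show k ≤ n by omega) with rfl | hlt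
    · have : sphHarm n ((n : ℤ) + 1) = fun _ => 0 := by
        ext x; exact sphHarm_eq_zero (by omega) x
      rw [this, coeffL_self]
      simp [sphInner]
    · have h3 := congrArg conj (sphInner_ladder (n := m) (m := n) (k := k) (by omega) (by omega))
      simpa [conj_sphInner] using h3
  have h4 : ((m : ℂ) - n) * (m + n + 1) * sphInner (sphHarm n k) (sphHarm m k) = 0 := by
    linear_combination sphInner (sphHarm n k) (sphHarm m k) * (hn2 - hm2)
      - coeffL m k * h1 + coeffL n k * h2
  exact (mul_eq_zero.1 h4).resolve_left hne

theorem sphInner_sphHarm_of_ne {n m : ℕ} {k l : ℤ} (hk : k.natAbs ≤ n) (hl : l.natAbs ≤ m)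
    (h : ¬(n = m ∧ k = l)) : sphInner (sphHarm n k) (sphHarm m l) = 0 := by
  by_cases hkl : k = l
  · subst hkl
    rcases lt_trichotomy n m with hlt | heq | hlt
    · exact sphInner_sphHarm_of_deg_lt hk hlt
    · exact absurd ⟨heq, rfl⟩ h
    · rw [← conj_sphInner, sphInner_sphHarm_of_deg_lt hl hlt, map_zero]
  · exact sphInner_sphHarm_of_ord_ne hk hl hkl

theorem sphInner_zero_zero : sphInner (sphHarm 0 0) (sphHarm 0 0) = 1 := by
  have h : ∀ x : S2, sphHarm 0 0 x = ((√(1 / (4 * Real.pi)) : ℝ) : ℂ) := by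
    intro x
    have := sphHarm_natCast (le_refl 0) x
    simpa [shNorm, legendreD, legendre_zero] using this
  have hv : (surfaceMeasure : Measure S2).real Set.univ = 4 * Real.pi := by
    rw [Measure.toSphere_real_apply_univ, Measure.real, EuclideanSpace.volume_ball_fin_three]
    simp
    rw [ENNReal.toReal_ofReal (by positivity)]
    ring
  unfold sphInner
  simp only [h, Complex.conj_ofReal, integral_const, hv]
  rw [← Complex.ofReal_mul, Real.mul_self_sqrt (by positivity)]
  have := Real.pi_pos
  simp
  field_simp

/-- Multiplication by x₃ is symmetric. Expanding it on either side of the pairing of degrees n and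
n+1 leaves the same positive factor `coeffA n k` before the two squared norms. -/
theorem sphInner_self_succ {n : ℕ} {k : ℤ} (hk : k.natAbs ≤ n) :
    sphInner (sphHarm (n + 1) k) (sphHarm (n + 1) k) = sphInner (sphHarm n k) (sphHarm n k) := by
  have hsym : sphInner (fun x : S2 => (((x : E3) 2 : ℝ) : ℂ) * sphHarm n k x) (sphHarm (n + 1) k) =
      sphInner (sphHarm n k) (fun x : S2 => (((x : E3) 2 : ℝ) : ℂ) * sphHarm (n + 1) k x) := by
    unfold sphInner
    congr 1; ext x; simp; ring
  have e1 : (fun x : S2 => (((x : E3) 2 : ℝ) : ℂ) * sphHarm n k x) = fun x =>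
      coeffA n k * sphHarm (n + 1) k x + coeffA' n k * sphHarm (n - 1) k x :=
    funext fun x => x2_mul_sphHarm hk x
  have e2 : (fun x : S2 => (((x : E3) 2 : ℝ) : ℂ) * sphHarm (n + 1) k x) = fun x =>
      coeffA (n + 1) k * sphHarm (n + 1 + 1) k x + coeffA' (n + 1) k * sphHarm n k x :=
    funext fun x => x2_mul_sphHarm (by omega) x
  have hc : ∀ (n : ℕ) (k : ℤ) (c : ℂ), Continuous fun x => c * sphHarm n k x :=
    fun n k c => continuous_const.mul (continuous_sphHarm n k)
  have z1 : sphInner (sphHarm (n - 1) k) (sphHarm (n + 1) k) = 0 := by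
    by_cases h : k.natAbs ≤ n - 1
    · exact sphInner_sphHarm_of_ne h (by omega) (by omega)
    · have : sphHarm (n - 1) k = fun _ => 0 := by
        ext x; exact sphHarm_eq_zero (by omega) x
      rw [this]; simp [sphInner]
  have z2 : sphInner (sphHarm n k) (sphHarm (n + 1 + 1) k) = 0 :=
    sphInner_sphHarm_of_ne hk (by omega) (by omega)
  rw [e1, e2, sphInner_add_left (hc _ _ _) (hc _ _ _) (continuous_sphHarm _ _),
    sphInner_add_right (hc _ _ _) (hc _ _ _) (continuous_sphHarm _ _), sphInner_const_mul_left,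
    sphInner_const_mul_left, sphInner_const_mul_right, sphInner_const_mul_right, z1, z2,
    coeffA'_succ] at hsym
  simp only [mul_zero, add_zero, zero_add, Complex.conj_ofReal] at hsym
  have hA : (coeffA n k : ℂ) ≠ 0 := by
    have h1 : (k : ℝ) ≤ n := by exact_mod_cast (by omega : k ≤ n)
    have h2 : -(n : ℝ) ≤ k := by exact_mod_cast (by omega : -(n : ℤ) ≤ k)
    have h3 : 0 < (n : ℝ) + 1 - k := by linarith
    have h4 : 0 < (n : ℝ) + 1 + k := by linarith
    have : 0 < coeffA n k := Real.sqrt_pos.2 (by positivity)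
    exact_mod_cast this.ne'
  exact mul_left_cancel₀ hA hsym

theorem sphInner_self_ord_succ {n : ℕ} {k : ℤ} (hk : k.natAbs ≤ n) (hk' : (k + 1).natAbs ≤ n) :
    sphInner (sphHarm n (k + 1)) (sphHarm n (k + 1)) = sphInner (sphHarm n k) (sphHarm n k) := by
  refine mul_left_cancel₀ ?_ (sphInner_ladder hk hk')
  have h1 : (k : ℝ) + 1 ≤ n := by exact_mod_cast (by omega : k + 1 ≤ n)
  have h2 : -(n : ℝ) ≤ k := by exact_mod_cast (by omega : -(n : ℤ) ≤ k)
  have h3 : 0 < (n : ℝ) - k := by linarith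
  have h4 : 0 < (n : ℝ) + k + 1 := by linarith
  have : 0 < coeffL n k := Real.sqrt_pos.2 (by positivity)
  exact_mod_cast this.ne'

/-- The norm is transported from the constant Y_{0,0} through the degrees at order 0, and then along
the ladder to both signs of the order. -/
theorem sphInner_self {n : ℕ} {k : ℤ} (hk : k.natAbs ≤ n) :
    sphInner (sphHarm n k) (sphHarm n k) = 1 := by
  have h0 : ∀ n : ℕ, sphInner (sphHarm n 0) (sphHarm n 0) = 1 := by
    intro n
    induction n with
    | zero => exact sphInner_zero_zero
    | succ n ih => rw [sphInner_self_succ (by simp), ih]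
  have hp : ∀ j : ℕ, j ≤ n → sphInner (sphHarm n j) (sphHarm n j) = 1 := by
    intro j
    induction j with
    | zero => exact fun _ => h0 n
    | succ j ih =>
      intro hj
      push_cast
      rw [sphInner_self_ord_succ (by omega) (by omega), ih (by omega)]
  have hm : ∀ j : ℕ, j ≤ n → sphInner (sphHarm n (-j)) (sphHarm n (-j)) = 1 := by
    intro j
    induction j with
    | zero => intro _; simpa using h0 n
    | succ j ih =>
      intro hj
      rw [← sphInner_self_ord_succ (by omega) (by omega)]
      have e : -((j + 1 : ℕ) : ℤ) + 1 = -(j : ℤ) := by push_cast; ring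
      rw [e, ih (by omega)]
  obtain ⟨j, rfl | rfl⟩ := Int.eq_nat_or_neg k
  · exact hp j (by omega)
  · exact hm j (by omega)

theorem sphInner_sphHarm {n m : ℕ} {k l : ℤ} (hk : k.natAbs ≤ n) (hl : l.natAbs ≤ m) :
    sphInner (sphHarm n k) (sphHarm m l) = if n = m ∧ k = l then 1 else 0 := by
  split_ifs with h
  · obtain ⟨rfl, rfl⟩ := h
    exact sphInner_self hk
  · exact sphInner_sphHarm_of_ne hk hl h

/-- `D Y_{n,k} = (n + 1/2) Y_{n,k}`. -/
theorem opD_sphHarm {n : ℕ} {k : ℤ} (hk : k.natAbs ≤ n) (x : S2) :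
    opD (sphHarm n k) x = (n + 1 / 2) * sphHarm n k x := by
  unfold opD
  have hmem : k ∈ Finset.Icc (-(n : ℤ)) n := Finset.mem_Icc.2 (by omega)
  rw [tsum_eq_single (⟨n, ⟨k, hmem⟩⟩ : SHIndex)]
  · rw [shCoeff_eq_sphInner]
    have e : √((n : ℝ) * (n + 1) + 1 / 4) = n + 1 / 2 := by
      rw [show (n : ℝ) * (n + 1) + 1 / 4 = (n + 1 / 2) ^ 2 by ring]
      exact Real.sqrt_sq (by positivity)
    simp only [SHIndex.deg, SHIndex.ord]
    rw [sphInner_self hk, e]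
    push_cast; ring
  · rintro ⟨m, l, hl⟩ hne
    rw [Finset.mem_Icc] at hl
    rw [shCoeff_eq_sphInner]
    simp only [SHIndex.deg, SHIndex.ord]
    rw [sphInner_sphHarm_of_ne hk (by omega)]
    · simp
    · rintro ⟨rfl, rfl⟩
      exact hne rfl

/-! ### Components of the Hardy–Hodge harmonics -/

/-- The component `v₁ + i v₂` of a vector. -/
def cPlus (v : C3) : ℂ := v 0 + Complex.I * v 1

/-- The component `v₁ - i v₂` of a vector. -/
def cMinus (v : C3) : ℂ := v 0 - Complex.I * v 1

/-- Reduces products of two coupling coefficients to an identity of radicands. The signs of v and z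
do not matter, which covers extreme orders without a case distinction. -/
theorem sqrt_mul_sqrt_eq {u v w z : ℝ} (hu : 0 ≤ u) (hw : 0 ≤ w) (h : u * v = w ^ 2 * z) :
    √u * √v = w * √z := by
  rw [← Real.sqrt_mul hu, h, Real.sqrt_mul (sq_nonneg w), Real.sqrt_sq hw]

theorem coeffL_neg (n : ℕ) (k : ℤ) : coeffL n (-k) = √((n + k) * (n - k + 1)) := by
  unfold coeffL; congr 1; push_cast; ring

theorem ord_cast_le {n : ℕ} {k : ℤ} (hk : k.natAbs ≤ n) : (k : ℝ) ≤ n ∧ -(n : ℝ) ≤ k :=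
  ⟨by exact_mod_cast (by omega : k ≤ n), by exact_mod_cast (by omega : -(n : ℤ) ≤ k)⟩

section products

variable {n : ℕ} {k : ℤ}

theorem coeffL_radicand_nonneg (hk : k.natAbs ≤ n) : 0 ≤ ((n : ℝ) - k) * (n + k + 1) := by
  obtain ⟨h1, h2⟩ := ord_cast_le hk
  exact mul_nonneg (by linarith) (by linarith)

theorem coeffL_mul_coeffA (hk : k.natAbs ≤ n) :
    coeffL n k * coeffA n (k + 1) = (n - k) * coeffB n k := by
  obtain ⟨h1, h2⟩ := ord_cast_le hk
  refine sqrt_mul_sqrt_eq (coeffL_radicand_nonneg hk) (by linarith) ?_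
  push_cast; ring

theorem coeffL_mul_coeffA' (hk : k.natAbs ≤ n) :
    coeffL n k * coeffA' n (k + 1) = (n + k + 1) * coeffB' n (-k) := by
  obtain ⟨h1, h2⟩ := ord_cast_le hk
  refine sqrt_mul_sqrt_eq (coeffL_radicand_nonneg hk) (by linarith) ?_
  push_cast; ring

theorem coeffL_mul_coeffB (hk : k.natAbs ≤ n) :
    coeffL n k * coeffB n (-(k + 1)) = (n - k) * coeffA n k := by
  obtain ⟨h1, h2⟩ := ord_cast_le hk
  refine sqrt_mul_sqrt_eq (coeffL_radicand_nonneg hk) (by linarith) ?_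
  push_cast; ring

theorem coeffL_mul_coeffB' (hk : k.natAbs ≤ n) :
    coeffL n k * coeffB' n (k + 1) = (n + k + 1) * coeffA' n k := by
  obtain ⟨h1, h2⟩ := ord_cast_le hk
  refine sqrt_mul_sqrt_eq (coeffL_radicand_nonneg hk) (by linarith) ?_
  push_cast; ring

end products

theorem coeffL_eq_zero {n : ℕ} {k : ℤ} (hk : k.natAbs ≤ n) (h : ¬(k + 1).natAbs ≤ n) :
    coeffL n k = 0 := by
  obtain rfl : k = n := by omega
  exact coeffL_self n

/-- The components of x × L*Y are ladder steps followed by multiplication with a coordinate. Keeping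
the factor `coeffL n k` makes the formula hold also when k + 1 exceeds n, since the factor is then
zero. -/
theorem coeffL_mul_x2 {n : ℕ} {k : ℤ} (hk : k.natAbs ≤ n) (x : S2) :
    coeffL n k * ((((x : E3) 2 : ℝ) : ℂ) * sphHarm n (k + 1) x) =
      (n - k) * coeffB n k * sphHarm (n + 1) (k + 1) x +
        (n + k + 1) * coeffB' n (-k) * sphHarm (n - 1) (k + 1) x := by
  have h1 := congrArg (fun t : ℝ => (t : ℂ)) (coeffL_mul_coeffA hk)
  have h2 := congrArg (fun t : ℝ => (t : ℂ)) (coeffL_mul_coeffA' hk)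
  push_cast at h1 h2
  rw [← h1, ← h2]
  by_cases h : (k + 1).natAbs ≤ n
  · rw [x2_mul_sphHarm h]; ring
  · rw [coeffL_eq_zero hk h]; simp

theorem coeffL_mul_eMinus {n : ℕ} {k : ℤ} (hk : k.natAbs ≤ n) (x : S2) :
    coeffL n k * (eMinus x * sphHarm n (k + 1) x) =
      (n - k) * coeffA n k * sphHarm (n + 1) k x -
        (n + k + 1) * coeffA' n k * sphHarm (n - 1) k x := by
  have h1 := congrArg (fun t : ℝ => (t : ℂ)) (coeffL_mul_coeffB hk)
  have h2 := congrArg (fun t : ℝ => (t : ℂ)) (coeffL_mul_coeffB' hk)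
  push_cast at h1 h2
  rw [← h1, ← h2]
  by_cases h : (k + 1).natAbs ≤ n
  · rw [eMinus_mul_sphHarm h, add_sub_cancel_right]; ring
  · rw [coeffL_eq_zero hk h]; simp

theorem coeffL_mul_ePlus {n : ℕ} {k : ℤ} (hk : k.natAbs ≤ n) (x : S2) :
    coeffL n (-k) * (ePlus x * sphHarm n (k - 1) x) =
      -((n + k) * coeffA n k * sphHarm (n + 1) k x) +
        (n - k + 1) * coeffA' n k * sphHarm (n - 1) k x := by
  have h := congrArg conj (coeffL_mul_eMinus (n := n) (k := -k) (by simpa using hk) x)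
  simp only [map_mul, map_sub, map_add, Complex.conj_ofReal, conj_eMinus, map_natCast, map_intCast,
    map_one, conj_sphHarm, neg_neg, coeffA_neg, coeffA'_neg] at h
  rw [show -(-k + 1) = k - 1 by ring, neg_one_zpow_succ] at h
  push_cast at h
  have hz : ((-1 : ℂ) ^ (-k)) ≠ 0 := zpow_ne_zero _ (by simp)
  apply mul_left_cancel₀ hz
  linear_combination -h

theorem surfGrad_sphHarm_apply (n : ℕ) (k : ℤ) (x : S2) (j : Fin 3) :
    surfGrad (sphHarm n k) x j =
      -crossProduct (complexify (x : E3)).ofLp (surfCurlGrad (sphHarm n k) x).ofLp j := by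
  rw [sphHarm_eq_ext]
  exact surfGrad_eq_neg_cross x (differentiable_sphHarmExt _ _).differentiableAt j

/-- The third component of -x × L*Y involves only the raised and the lowered harmonic;
multiplication by x₁ ∓ i x₂ brings both back to order k, in the degrees n ± 1. -/
theorem surfGrad_sphHarm_two {n : ℕ} {k : ℤ} (hk : k.natAbs ≤ n) (x : S2) :
    surfGrad (sphHarm n k) x 2 =
      -(n * coeffA n k * sphHarm (n + 1) k x) + (n + 1) * coeffA' n k * sphHarm (n - 1) k x := by
  have h1 := LPlus_sphHarm hk x
  have h2 := LMinus_sphHarm hk x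
  have h3 := coeffL_mul_eMinus hk x
  have h4 := coeffL_mul_ePlus hk x
  rw [surfGrad_sphHarm_apply]
  simp [crossProduct, complexify]
  unfold ePlus at h4
  unfold eMinus at h3
  linear_combination (Complex.I / 2) * ((x : E3) 0 - (x : E3) 1 * Complex.I) * h1
    - (Complex.I / 2) * ((x : E3) 0 + (x : E3) 1 * Complex.I) * h2
    + (1 / 2) * (-h3 + h4)
    + ((x : E3) 1 * (surfCurlGrad (sphHarm n k) x).ofLp 0
      - (x : E3) 0 * (surfCurlGrad (sphHarm n k) x).ofLp 1
      + (coeffL n k * ((x : E3) 0 - (x : E3) 1 * Complex.I) * sphHarm n (k + 1) x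
        - coeffL n (-k) * ((x : E3) 0 + (x : E3) 1 * Complex.I) * sphHarm n (k - 1) x) / 2)
      * Complex.I_sq

theorem cPlus_surfGrad_sphHarm {n : ℕ} {k : ℤ} (hk : k.natAbs ≤ n) (x : S2) :
    cPlus (surfGrad (sphHarm n k) x) =
      n * coeffB n k * sphHarm (n + 1) (k + 1) x +
        (n + 1) * coeffB' n (-k) * sphHarm (n - 1) (k + 1) x := by
  have h1 := LPlus_sphHarm hk x
  have h2 := L2_sphHarm hk x
  have h3 := coeffL_mul_x2 hk x
  have h4 := ePlus_mul_sphHarm hk x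
  unfold cPlus
  rw [surfGrad_sphHarm_apply, surfGrad_sphHarm_apply]
  simp [crossProduct, complexify]
  unfold ePlus at h4
  linear_combination (-Complex.I * (x : E3) 2) * h1
    + Complex.I * ((x : E3) 0 + (x : E3) 1 * Complex.I) * h2 + h3 - k * h4
    + ((x : E3) 2 * (surfCurlGrad (sphHarm n k) x).ofLp 1
      - (x : E3) 1 * (surfCurlGrad (sphHarm n k) x).ofLp 2
      - (x : E3) 2 * coeffL n k * sphHarm n (k + 1) x
      + k * ((x : E3) 0 + (x : E3) 1 * Complex.I) * sphHarm n k x) * Complex.I_sq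

theorem cMinus_surfGrad_sphHarm {n : ℕ} {k : ℤ} (hk : k.natAbs ≤ n) (x : S2) :
    cMinus (surfGrad (sphHarm n k) x) =
      -(n * coeffB n (-k) * sphHarm (n + 1) (k - 1) x) -
        (n + 1) * coeffB' n k * sphHarm (n - 1) (k - 1) x := by
  have h0 : ∀ j, surfGrad (sphHarm n k) x j = (-1) ^ k * conj (surfGrad (sphHarm n (-k)) x j) := by
    intro j
    rw [surfGrad_sphHarm_apply, surfGrad_sphHarm_apply]
    have h : ∀ j, surfCurlGrad (sphHarm n k) x j =
        (-1) ^ k * conj (surfCurlGrad (sphHarm n (-k)) x j) := by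
      intro j
      have := surfCurlGrad_sphHarm_neg n (-k) x j
      rw [neg_neg] at this
      rw [this, zpow_neg, ← inv_zpow, inv_neg_one]
    fin_cases j <;> simp [crossProduct, complexify, h] <;> ring
  have h := congrArg conj (cPlus_surfGrad_sphHarm (n := n) (k := -k) (by simpa using hk) x)
  unfold cPlus at h
  unfold cMinus
  rw [h0, h0]
  simp only [map_mul, map_sub, map_add, Complex.conj_ofReal, conj_eMinus, map_natCast, map_intCast,
    map_one, conj_sphHarm, neg_neg, Complex.conj_I] at h
  rw [show -(-k + 1) = k - 1 by ring, neg_one_zpow_succ, zpow_neg, ← inv_zpow, inv_neg_one] at h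
  have hz : ((-1 : ℂ) ^ k) * (-1) ^ k = 1 := by rw [← mul_zpow]; simp
  linear_combination (-1) ^ k * h + (-(n * coeffB n (-k) * sphHarm (n + 1) (k - 1) x) -
        (n + 1) * coeffB' n k * sphHarm (n - 1) (k - 1) x) * hz

/-- The common degree of the components of `ỹ⁽ⁱ⁾_{n,k}`. -/
def hhDeg : Fin 3 → ℕ → ℕ
  | 0, n => n + 1
  | 1, n => n - 1
  | 2, n => n

/-- The normalization factor of `ỹ⁽ⁱ⁾_{n,k}`. -/
def hhScale (i : Fin 3) (n : ℕ) : ℂ := (((√(hardyHodgeNorm i n))⁻¹ : ℝ) : ℂ)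

/-- The third component of `ỹ⁽ⁱ⁾_{n,k}` is `hhTwo i n k • Y_{hhDeg i n, k}`. -/
def hhTwo (i : Fin 3) (n : ℕ) (k : ℤ) : ℂ :=
  hhScale i n *
    match i with
    | 0 => (2 * n + 1) * coeffA n k
    | 1 => (2 * n + 1) * coeffA' n k
    | 2 => Complex.I * k

/-- The `cPlus` component of `ỹ⁽ⁱ⁾_{n,k}` is `hhPlus i n k • Y_{hhDeg i n, k + 1}`. -/
def hhPlus (i : Fin 3) (n : ℕ) (k : ℤ) : ℂ :=
  hhScale i n *
    match i with
    | 0 => -((2 * n + 1) * coeffB n k)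
    | 1 => (2 * n + 1) * coeffB' n (-k)
    | 2 => Complex.I * coeffL n k

/-- The `cMinus` component of `ỹ⁽ⁱ⁾_{n,k}` is `hhMinus i n k • Y_{hhDeg i n, k - 1}`. -/
def hhMinus (i : Fin 3) (n : ℕ) (k : ℤ) : ℂ :=
  hhScale i n *
    match i with
    | 0 => (2 * n + 1) * coeffB n (-k)
    | 1 => -((2 * n + 1) * coeffB' n k)
    | 2 => Complex.I * coeffL n (-k)

/-- Both xY and ∇*Y have parts of degrees n+1 and n-1. The factors n+1 and n, the eigenvalues of D ±
1/2, are those for which one part cancels: type (1) keeps degree n+1, type (2) keeps n-1. The same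
happens in the components `cPlus` and `cMinus`. -/
theorem hardyHodgeHarm_two (i : Fin 3) {n : ℕ} {k : ℤ} (hk : k.natAbs ≤ n) (x : S2) :
    hardyHodgeHarm i n k x 2 = hhTwo i n k * sphHarm (hhDeg i n) k x := by
  have h1 := surfGrad_sphHarm_two hk x
  have h2 := x2_mul_sphHarm hk x
  match i with
  | 0 =>
    simp only [hardyHodgeHarm, hardyHodgeOp, hhTwo, hhScale, hhDeg, opD_sphHarm hk, complexify,
      PiLp.smul_apply, PiLp.sub_apply, smul_eq_mul]
    linear_combination (((√(hardyHodgeNorm 0 n))⁻¹ : ℝ) : ℂ) * ((n + 1) * h2 - h1)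
  | 1 =>
    simp only [hardyHodgeHarm, hardyHodgeOp, hhTwo, hhScale, hhDeg, opD_sphHarm hk, complexify,
      PiLp.smul_apply, PiLp.add_apply, smul_eq_mul]
    linear_combination (((√(hardyHodgeNorm 1 n))⁻¹ : ℝ) : ℂ) * (n * h2 + h1)
  | 2 =>
    simp only [hardyHodgeHarm, hardyHodgeOp, hhTwo, hhScale, hhDeg, PiLp.smul_apply, smul_eq_mul,
      L2_sphHarm hk]
    ring

theorem cPlus_hardyHodgeHarm (i : Fin 3) {n : ℕ} {k : ℤ} (hk : k.natAbs ≤ n) (x : S2) :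
    cPlus (hardyHodgeHarm i n k x) = hhPlus i n k * sphHarm (hhDeg i n) (k + 1) x := by
  have h1 := cPlus_surfGrad_sphHarm hk x
  have h2 := ePlus_mul_sphHarm hk x
  have h3 := LPlus_sphHarm hk x
  unfold cPlus at h1 ⊢
  unfold ePlus at h2
  match i with
  | 0 =>
    simp only [hardyHodgeHarm, hardyHodgeOp, hhPlus, hhScale, hhDeg, opD_sphHarm hk, complexify,
      PiLp.smul_apply, PiLp.sub_apply, smul_eq_mul]
    linear_combination (((√(hardyHodgeNorm 0 n))⁻¹ : ℝ) : ℂ) * ((n + 1) * h2 - h1)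
  | 1 =>
    simp only [hardyHodgeHarm, hardyHodgeOp, hhPlus, hhScale, hhDeg, opD_sphHarm hk, complexify,
      PiLp.smul_apply, PiLp.add_apply, smul_eq_mul]
    linear_combination (((√(hardyHodgeNorm 1 n))⁻¹ : ℝ) : ℂ) * (n * h2 + h1)
  | 2 =>
    simp only [hardyHodgeHarm, hardyHodgeOp, hhPlus, hhScale, hhDeg, PiLp.smul_apply, smul_eq_mul]
    linear_combination (((√(hardyHodgeNorm 2 n))⁻¹ : ℝ) : ℂ) * h3

theorem cMinus_hardyHodgeHarm (i : Fin 3) {n : ℕ} {k : ℤ} (hk : k.natAbs ≤ n) (x : S2) :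
    cMinus (hardyHodgeHarm i n k x) = hhMinus i n k * sphHarm (hhDeg i n) (k - 1) x := by
  have h1 := cMinus_surfGrad_sphHarm hk x
  have h2 := eMinus_mul_sphHarm hk x
  have h3 := LMinus_sphHarm hk x
  unfold cMinus at h1 ⊢
  unfold eMinus at h2
  match i with
  | 0 =>
    simp only [hardyHodgeHarm, hardyHodgeOp, hhMinus, hhScale, hhDeg, opD_sphHarm hk, complexify,
      PiLp.smul_apply, PiLp.sub_apply, smul_eq_mul]
    linear_combination (((√(hardyHodgeNorm 0 n))⁻¹ : ℝ) : ℂ) * ((n + 1) * h2 - h1)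
  | 1 =>
    simp only [hardyHodgeHarm, hardyHodgeOp, hhMinus, hhScale, hhDeg, opD_sphHarm hk, complexify,
      PiLp.smul_apply, PiLp.add_apply, smul_eq_mul]
    linear_combination (((√(hardyHodgeNorm 1 n))⁻¹ : ℝ) : ℂ) * (n * h2 + h1)
  | 2 =>
    simp only [hardyHodgeHarm, hardyHodgeOp, hhMinus, hhScale, hhDeg, PiLp.smul_apply, smul_eq_mul]
    linear_combination (((√(hardyHodgeNorm 2 n))⁻¹ : ℝ) : ℂ) * h3

theorem inner_eq_components (u v : C3) :
    inner ℂ u v = v 2 * conj (u 2) +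
      (1 / 2) * (cPlus v * conj (cPlus u)) + (1 / 2) * (cMinus v * conj (cMinus u)) := by
  simp [PiLp.inner_apply, Fin.sum_univ_three, cPlus, cMinus]
  linear_combination (v 1 * conj (u 1)) * Complex.I_sq

theorem continuous_hardyHodgeHarm (i : Fin 3) {n : ℕ} {k : ℤ} (hk : k.natAbs ≤ n) :
    Continuous (hardyHodgeHarm i n k) := by
  have h2 : Continuous fun x => hardyHodgeHarm i n k x 2 := by
    simp only [hardyHodgeHarm_two i hk]
    exact continuous_const.mul (continuous_sphHarm _ _)
  have hp : Continuous fun x => cPlus (hardyHodgeHarm i n k x) := by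
    simp only [cPlus_hardyHodgeHarm i hk]
    exact continuous_const.mul (continuous_sphHarm _ _)
  have hm : Continuous fun x => cMinus (hardyHodgeHarm i n k x) := by
    simp only [cMinus_hardyHodgeHarm i hk]
    exact continuous_const.mul (continuous_sphHarm _ _)
  have h0 : (fun x => hardyHodgeHarm i n k x 0) = fun x =>
      (1 / 2) * (cPlus (hardyHodgeHarm i n k x) + cMinus (hardyHodgeHarm i n k x)) := by
    ext x; simp only [cPlus, cMinus]; ring
  have h1 : (fun x => hardyHodgeHarm i n k x 1) = fun x =>
      (-Complex.I / 2) * (cPlus (hardyHodgeHarm i n k x) - cMinus (hardyHodgeHarm i n k x)) := by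
    ext x; simp only [cPlus, cMinus]
    linear_combination (hardyHodgeHarm i n k x 1) * Complex.I_sq
  have hc : Continuous fun x => (hardyHodgeHarm i n k x).ofLp := by
    refine continuous_pi fun j => ?_
    fin_cases j
    · exact h0 ▸ continuous_const.mul (hp.add hm)
    · exact h1 ▸ continuous_const.mul (hp.sub hm)
    · exact h2
  exact (PiLp.continuous_toLp 2 (fun _ : Fin 3 => ℂ)).comp hc

/-! ### Orthonormality of the Hardy–Hodge harmonics -/

section gram

variable {n : ℕ} {k : ℤ}

theorem coeffA_sq' (hk : k.natAbs ≤ n) :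
    (coeffA n k : ℂ) ^ 2 = (n + 1 - k) * (n + 1 + k) / ((2 * n + 1) * (2 * n + 3)) := by
  exact_mod_cast coeffA_sq hk

theorem coeffB_sq' (h : -(n : ℤ) - 2 ≤ k) :
    (coeffB n k : ℂ) ^ 2 = (n + k + 1) * (n + k + 2) / ((2 * n + 1) * (2 * n + 3)) := by
  exact_mod_cast coeffB_sq h

theorem coeffL_sq' (hk : k.natAbs ≤ n) : (coeffL n k : ℂ) ^ 2 = (n - k) * (n + k + 1) := by
  exact_mod_cast coeffL_sq hk

theorem coeffB_mul_coeffB_succ (hk : k.natAbs ≤ n) :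
    coeffB n k * coeffB (n + 1) (-k - 1) = coeffA n k * coeffA (n + 1) k := by
  obtain ⟨h1, h2⟩ := ord_cast_le hk
  have h3 : 0 ≤ (n : ℝ) + k + 1 := by linarith
  have h4 : 0 ≤ (n : ℝ) + k + 2 := by linarith
  have h5 : 0 ≤ (n : ℝ) + 1 - k := by linarith
  have h6 : 0 ≤ (n : ℝ) + 1 + k := by linarith
  unfold coeffB coeffA
  rw [← Real.sqrt_mul (by positivity), ← Real.sqrt_mul (by positivity)]
  congr 1
  push_cast
  ring

theorem coeffB_mul_coeffL_succ (hk : k.natAbs ≤ n) :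
    coeffL (n + 1) k * coeffB n k = (n + k + 2) * coeffA n k := by
  obtain ⟨h1, h2⟩ := ord_cast_le hk
  refine sqrt_mul_sqrt_eq (coeffL_radicand_nonneg (by omega)) (by linarith) ?_
  push_cast; ring

theorem coeffB_mul_coeffL (hk : k.natAbs ≤ n) :
    coeffL n k * coeffB n (-k - 1) = (n - k) * coeffA n k := by
  obtain ⟨h1, h2⟩ := ord_cast_le hk
  refine sqrt_mul_sqrt_eq (coeffL_radicand_nonneg hk) (by linarith) ?_
  push_cast; ring

end gram

theorem hardyHodgeNorm_pos {i : Fin 3} {n : ℕ} (h : i = 0 ∨ 1 ≤ n) : 0 < hardyHodgeNorm i n := by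
  match i, h with
  | 0, _ => simp only [hardyHodgeNorm]; positivity
  | 1, Or.inr h =>
    have : (0 : ℝ) < n := by exact_mod_cast h
    simp only [hardyHodgeNorm]; positivity
  | 2, Or.inr h =>
    have : (0 : ℝ) < n := by exact_mod_cast h
    simp only [hardyHodgeNorm]; positivity

theorem hhScale_sq_mul {i : Fin 3} {n : ℕ} (h : i = 0 ∨ 1 ≤ n) :
    hhScale i n ^ 2 * (hardyHodgeNorm i n : ℂ) = 1 := by
  have h1 : ((√(hardyHodgeNorm i n))⁻¹) ^ 2 * hardyHodgeNorm i n = 1 := by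
    rw [inv_pow, Real.sq_sqrt (hardyHodgeNorm_pos h).le,
      inv_mul_cancel₀ (hardyHodgeNorm_pos h).ne']
  unfold hhScale
  exact_mod_cast h1

theorem conj_hhScale (i : Fin 3) (n : ℕ) : conj (hhScale i n) = hhScale i n :=
  Complex.conj_ofReal _

/-- The Gram matrix of the component coefficients. -/
def hhGram (i : Fin 3) (n : ℕ) (j : Fin 3) (m : ℕ) (k : ℤ) : ℂ :=
  hhTwo j m k * conj (hhTwo i n k) + (1 / 2) * (hhPlus j m k * conj (hhPlus i n k)) +
    (1 / 2) * (hhMinus j m k * conj (hhMinus i n k))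

theorem conj_hhGram (i : Fin 3) (n : ℕ) (j : Fin 3) (m : ℕ) (k : ℤ) :
    conj (hhGram i n j m k) = hhGram j m i n k := by
  simp only [hhGram, map_add, map_mul, map_div₀, map_one, map_ofNat, Complex.conj_conj]; ring

theorem hhGram_self {i : Fin 3} {n : ℕ} {k : ℤ} (h : i = 0 ∨ 1 ≤ n) (hk : k.natAbs ≤ n) :
    hhGram i n i n k = 1 := by
  have hN := hhScale_sq_mul h
  match i, h with
  | 0, _ =>
    have hA := coeffA_sq' hk
    have hB := coeffB_sq' (n := n) (k := k) (by omega)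
    have hB' := coeffB_sq' (n := n) (k := -k) (by omega)
    simp only [hhGram, hhTwo, hhPlus, hhMinus, map_mul, map_neg, map_add, Complex.conj_ofReal, conj_hhScale,
      map_natCast, map_ofNat, map_one]
    refine Eq.trans ?_ hN
    have h1 : (2 * (n : ℂ) + 1) ≠ 0 := by exact_mod_cast (by positivity : (2 * (n : ℝ) + 1) ≠ 0)
    have h3 : (2 * (n : ℂ) + 3) ≠ 0 := by exact_mod_cast (by positivity : (2 * (n : ℝ) + 3) ≠ 0)
    have key : (2 * (n : ℂ) + 1) ^ 2 * ((coeffA n k : ℂ) ^ 2 + (1 / 2) * (coeffB n k : ℂ) ^ 2 +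
        (1 / 2) * (coeffB n (-k) : ℂ) ^ 2) = (hardyHodgeNorm 0 n : ℂ) := by
      rw [hA, hB, hB']
      simp only [hardyHodgeNorm]
      push_cast
      field_simp
      ring
    linear_combination hhScale 0 n ^ 2 * key
  | 1, Or.inr h =>
    obtain ⟨m, rfl⟩ : ∃ m, n = m + 1 := ⟨n - 1, by omega⟩
    -- Here |k| may equal m + 1, beyond the range of `coeffA_sq'`; the radicand is still
    -- nonnegative.
    have hA : ((coeffA m k : ℝ) : ℂ) ^ 2 =
        (m + 1 - k) * (m + 1 + k) / ((2 * m + 1) * (2 * m + 3)) := by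
      have h0 : 0 ≤ ((m : ℝ) + 1 - k) * (m + 1 + k) := by
        obtain ⟨h1, h2⟩ := ord_cast_le hk
        push_cast at h1 h2
        exact mul_nonneg (by linarith) (by linarith)
      have : (coeffA m k) ^ 2 = (m + 1 - k) * (m + 1 + k) / ((2 * m + 1) * (2 * m + 3)) :=
        Real.sq_sqrt (by positivity)
      exact_mod_cast this
    have hB := coeffB_sq' (n := m) (k := k - 1) (by omega)
    have hB' := coeffB_sq' (n := m) (k := -k - 1) (by omega)
    simp only [hhGram, hhTwo, hhPlus, hhMinus, map_mul, map_neg, map_add, Complex.conj_ofReal, conj_hhScale,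
      map_natCast, map_ofNat, map_one, coeffA'_succ, coeffB'_succ]
    refine Eq.trans ?_ hN
    have h1 : (2 * (m : ℂ) + 1) ≠ 0 := by exact_mod_cast (by positivity : (2 * (m : ℝ) + 1) ≠ 0)
    have h3 : (2 * (m : ℂ) + 3) ≠ 0 := by exact_mod_cast (by positivity : (2 * (m : ℝ) + 3) ≠ 0)
    have key : (2 * (m : ℂ) + 3) ^ 2 * ((coeffA m k : ℂ) ^ 2 +
        (1 / 2) * (coeffB m (-k - 1) : ℂ) ^ 2 +
        (1 / 2) * (coeffB m (k - 1) : ℂ) ^ 2) = (hardyHodgeNorm 1 (m + 1) : ℂ) := by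
      rw [hA, hB, hB']
      simp only [hardyHodgeNorm]
      push_cast
      field_simp
      ring
    push_cast
    linear_combination hhScale 1 (m + 1) ^ 2 * key
  | 2, Or.inr h =>
    have hL := coeffL_sq' hk
    have hL' := coeffL_sq' (n := n) (k := -k) (by omega)
    simp only [hhGram, hhTwo, hhPlus, hhMinus, map_mul, map_neg, map_add, Complex.conj_ofReal, conj_hhScale,
      map_natCast, map_ofNat, map_one, map_intCast, Complex.conj_I]
    refine Eq.trans ?_ hN
    simp only [hardyHodgeNorm]
    push_cast at hL' ⊢
    linear_combination hhScale 2 n ^ 2 * (1 / 2 * (hL + hL')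
      - (k ^ 2 + 1 / 2 * (coeffL n k : ℂ) ^ 2 + 1 / 2 * (coeffL n (-k) : ℂ) ^ 2) * Complex.I_sq)

theorem hhGram_zero_one {n : ℕ} {k : ℤ} (hk : k.natAbs ≤ n) : hhGram 0 n 1 (n + 2) k = 0 := by
  have h1 := congrArg (fun t : ℝ => (t : ℂ)) (coeffB_mul_coeffB_succ hk)
  have h2 := congrArg (fun t : ℝ => (t : ℂ))
    (coeffB_mul_coeffB_succ (n := n) (k := -k) (by simpa using hk))
  push_cast at h1 h2
  simp only [neg_neg, coeffA_neg] at h2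
  simp only [hhGram, hhTwo, hhPlus, hhMinus, map_mul, map_neg, map_add, Complex.conj_ofReal, conj_hhScale,
    map_natCast, map_ofNat, map_one, coeffA'_succ (n + 1), coeffB'_succ (n + 1)]
  push_cast
  linear_combination (-(1 / 2) * hhScale 0 n *
    hhScale 1 (n + 2) * (2 * (n + 2) + 1) * (2 * n + 1)) * (h1 + h2)

theorem hhGram_zero_two {n : ℕ} {k : ℤ} (hk : k.natAbs ≤ n) : hhGram 0 n 2 (n + 1) k = 0 := by
  have h1 := congrArg (fun t : ℝ => (t : ℂ)) (coeffB_mul_coeffL_succ hk)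
  have h2 := congrArg (fun t : ℝ => (t : ℂ))
    (coeffB_mul_coeffL_succ (n := n) (k := -k) (by simpa using hk))
  push_cast at h1 h2
  simp only [neg_neg, coeffA_neg] at h2
  simp only [hhGram, hhTwo, hhPlus, hhMinus, map_mul, map_neg, map_add, Complex.conj_ofReal, conj_hhScale,
    map_natCast, map_ofNat, map_one]
  linear_combination (-(1 / 2) * hhScale 0 n *
    hhScale 2 (n + 1) * Complex.I * (2 * n + 1)) * (h1 - h2)

theorem hhGram_one_two {n : ℕ} {k : ℤ} (hk : k.natAbs ≤ n) : hhGram 1 (n + 1) 2 n k = 0 := by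
  have h1 := congrArg (fun t : ℝ => (t : ℂ)) (coeffB_mul_coeffL hk)
  have h2 := congrArg (fun t : ℝ => (t : ℂ))
    (coeffB_mul_coeffL (n := n) (k := -k) (by simpa using hk))
  push_cast at h1 h2
  simp only [neg_neg, coeffA_neg] at h2
  simp only [hhGram, hhTwo, hhPlus, hhMinus, map_mul, map_neg, map_add, Complex.conj_ofReal, conj_hhScale,
    map_natCast, map_ofNat, map_one, coeffA'_succ, coeffB'_succ]
  push_cast
  linear_combination ((1 / 2) * hhScale 1 (n + 1) *
    hhScale 2 n * Complex.I * (2 * (n + 1) + 1)) * (h1 - h2)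

/-- Equal component degrees fix the shift between n and m: type (1) at n meets type (3) at n+1 and
type (2) at n+2. So only three off-diagonal identities are needed, the others being their
conjugates. -/
theorem hhGram_eq {i j : Fin 3} {n m : ℕ} {k : ℤ} (hi : i = 0 ∨ 1 ≤ n) (hj : j = 0 ∨ 1 ≤ m)
    (hk : k.natAbs ≤ n) (hk' : k.natAbs ≤ m) (hd : hhDeg i n = hhDeg j m) :
    hhGram i n j m k = if i = j then 1 else 0 := by
  have hs : ∀ {a b : Fin 3} {p q : ℕ}, hhGram a p b q k = 0 → hhGram b q a p k = 0 := by
    intro a b p q h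
    rw [← conj_hhGram, h, map_zero]
  match i, j, hi, hj with
  | 0, 0, hi, _ =>
    simp only [hhDeg] at hd
    obtain rfl : n = m := by omega
    simpa using hhGram_self hi hk
  | 1, 1, hi, hj =>
    simp only [hhDeg] at hd
    have : 1 ≤ n := by simpa using hi
    have : 1 ≤ m := by simpa using hj
    obtain rfl : n = m := by omega
    simpa using hhGram_self hi hk
  | 2, 2, hi, _ =>
    simp only [hhDeg] at hd
    obtain rfl : n = m := by omega
    simpa using hhGram_self hi hk
  | 0, 1, _, hj =>
    simp only [hhDeg] at hd
    obtain rfl : m = n + 2 := by omega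
    simpa using hhGram_zero_one hk
  | 1, 0, hi, _ =>
    simp only [hhDeg] at hd
    obtain rfl : n = m + 2 := by omega
    simpa using hs (hhGram_zero_one hk')
  | 0, 2, _, _ =>
    simp only [hhDeg] at hd
    obtain rfl : m = n + 1 := by omega
    simpa using hhGram_zero_two hk
  | 2, 0, _, _ =>
    simp only [hhDeg] at hd
    obtain rfl : n = m + 1 := by omega
    simpa using hs (hhGram_zero_two hk')
  | 1, 2, hi, _ =>
    simp only [hhDeg] at hd
    have : 1 ≤ n := by simpa using hi
    obtain rfl : n = m + 1 := by omega
    simpa using hhGram_one_two hk'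
  | 2, 1, _, hj =>
    simp only [hhDeg] at hd
    have : 1 ≤ m := by simpa using hj
    obtain rfl : m = n + 1 := by omega
    simpa using hs (hhGram_one_two hk)

theorem coeffA'_eq_zero {n : ℕ} {k : ℤ} (hk : k.natAbs ≤ n) (h : n - 1 < k.natAbs) :
    coeffA' n k = 0 := by
  unfold coeffA'
  rcases Int.natAbs_eq k with h1 | h1
  · obtain rfl : k = n := by omega
    simp
  · obtain rfl : k = -n := by omega
    simp

theorem coeffB'_eq_zero {n : ℕ} {k : ℤ} (hk : k.natAbs ≤ n) (h : n - 1 < (k - 1).natAbs) :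
    coeffB' n k = 0 := by
  unfold coeffB'
  obtain h1 | h1 : k = -n ∨ k = 1 - n := by omega
  · rw [h1]; simp
  · rw [h1]; simp

theorem hhTwo_eq_zero {i : Fin 3} {n : ℕ} {k : ℤ} (hk : k.natAbs ≤ n)
    (h : hhDeg i n < k.natAbs) : hhTwo i n k = 0 := by
  match i with
  | 0 => simp only [hhDeg] at h; omega
  | 1 => simp [hhTwo, coeffA'_eq_zero hk h]
  | 2 => simp only [hhDeg] at h; omega

theorem hhPlus_eq_zero {i : Fin 3} {n : ℕ} {k : ℤ} (hk : k.natAbs ≤ n)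
    (h : hhDeg i n < (k + 1).natAbs) : hhPlus i n k = 0 := by
  match i with
  | 0 => simp only [hhDeg] at h; omega
  | 1 =>
    simp only [hhDeg] at h
    simp [hhPlus, coeffB'_eq_zero (n := n) (k := -k) (by omega) (by omega)]
  | 2 =>
    simp only [hhDeg] at h
    simp [hhPlus, coeffL_eq_zero hk (by omega)]

theorem hhMinus_eq_zero {i : Fin 3} {n : ℕ} {k : ℤ} (hk : k.natAbs ≤ n)
    (h : hhDeg i n < (k - 1).natAbs) : hhMinus i n k = 0 := by
  match i with
  | 0 => simp only [hhDeg] at h; omega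
  | 1 => simp [hhMinus, coeffB'_eq_zero hk h]
  | 2 =>
    simp only [hhDeg] at h
    simp [hhMinus, coeffL_eq_zero (n := n) (k := -k) (by omega) (by omega)]

/-- Shifted orders k ± 1 may leave the range of the degree. The component coefficients vanish
exactly there, so orthonormality of scalar harmonics can be applied to every component. -/
theorem mul_sphInner_sphHarm {d e : ℕ} {k l : ℤ} {c c' : ℂ} (hc : d < k.natAbs → c = 0)
    (hc' : e < l.natAbs → c' = 0) :
    c * conj c' * sphInner (sphHarm d k) (sphHarm e l) =
      if d = e ∧ k = l then c * conj c' else 0 := by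
  rcases Nat.lt_or_ge d k.natAbs with h | h
  · simp [hc h]
  rcases Nat.lt_or_ge e l.natAbs with h' | h'
  · simp [hc' h']
  rw [sphInner_sphHarm h h']
  split_ifs <;> simp

theorem integral_add_add {f g h : S2 → ℂ} (hf : Integrable f surfaceMeasure)
    (hg : Integrable g surfaceMeasure) (hh : Integrable h surfaceMeasure) :
    ∫ x, f x + g x + h x ∂surfaceMeasure =
      ∫ x, f x ∂surfaceMeasure + ∫ x, g x ∂surfaceMeasure + ∫ x, h x ∂surfaceMeasure := by
  have hfg : Integrable (fun x => f x + g x) surfaceMeasure := hf.add hg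
  rw [integral_add hfg hh, integral_add hf hg]

theorem integral_inner_hardyHodgeHarm {i j : Fin 3} {n m : ℕ} {k l : ℤ} (hi : i = 0 ∨ 1 ≤ n)
    (hj : j = 0 ∨ 1 ≤ m) (hk : k.natAbs ≤ n) (hl : l.natAbs ≤ m) :
    ∫ x, inner ℂ (hardyHodgeHarm i n k x) (hardyHodgeHarm j m l x) ∂surfaceMeasure =
      if hhDeg i n = hhDeg j m ∧ k = l then (if i = j then 1 else 0) else 0 := by
  have hcont : ∀ {d e : ℕ} {a b : ℤ} (c : ℂ), Integrable
      (fun x => c * (sphHarm d a x * conj (sphHarm e b x))) surfaceMeasure := fun c =>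
    integrable_of_continuous (continuous_const.mul ((continuous_sphHarm _ _).mul
      (Complex.continuous_conj.comp (continuous_sphHarm _ _))))
  have e : ∀ x, inner ℂ (hardyHodgeHarm i n k x) (hardyHodgeHarm j m l x) =
      (hhTwo j m l * conj (hhTwo i n k)) *
        (sphHarm (hhDeg j m) l x * conj (sphHarm (hhDeg i n) k x)) +
      (1 / 2 * (hhPlus j m l * conj (hhPlus i n k))) *
        (sphHarm (hhDeg j m) (l + 1) x * conj (sphHarm (hhDeg i n) (k + 1) x)) +
      (1 / 2 * (hhMinus j m l * conj (hhMinus i n k))) *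
        (sphHarm (hhDeg j m) (l - 1) x * conj (sphHarm (hhDeg i n) (k - 1) x)) := by
    intro x
    rw [inner_eq_components, hardyHodgeHarm_two i hk, hardyHodgeHarm_two j hl,
      cPlus_hardyHodgeHarm i hk, cPlus_hardyHodgeHarm j hl, cMinus_hardyHodgeHarm i hk,
      cMinus_hardyHodgeHarm j hl]
    simp only [map_mul]
    ring
  simp only [e]
  rw [integral_add_add (hcont _) (hcont _) (hcont _), integral_const_mul, integral_const_mul, integral_const_mul]
  change _ * sphInner (sphHarm _ _) (sphHarm _ _) + _ * sphInner (sphHarm _ _) (sphHarm _ _) +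
    _ * sphInner (sphHarm _ _) (sphHarm _ _) = _
  rw [mul_assoc (1 / 2 : ℂ), mul_assoc (1 / 2 : ℂ),
    mul_sphInner_sphHarm (fun h => hhTwo_eq_zero hl h) (fun h => hhTwo_eq_zero hk h),
    mul_sphInner_sphHarm (fun h => hhPlus_eq_zero hl h) (fun h => hhPlus_eq_zero hk h),
    mul_sphInner_sphHarm (fun h => hhMinus_eq_zero hl h) (fun h => hhMinus_eq_zero hk h)]
  by_cases h : hhDeg i n = hhDeg j m ∧ k = l
  · obtain ⟨hd, rfl⟩ := h
    simp only [hd, and_self, if_true]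
    rw [← hhGram_eq hi hj hk hl hd, hhGram]
  · have h' : ¬(hhDeg j m = hhDeg i n ∧ l = k) := fun h2 => h ⟨h2.1.symm, h2.2.symm⟩
    simp only [add_left_inj, sub_left_inj, if_neg h, if_neg h']
    simp

theorem index_eq_of_hhDeg_eq {i : Fin 3} {n m : ℕ} (hi : i = 0 ∨ 1 ≤ n) (hj : i = 0 ∨ 1 ≤ m)
    (h : hhDeg i n = hhDeg i m) : n = m := by
  match i, hi, hj with
  | 0, _, _ => simpa [hhDeg] using h
  | 1, Or.inr _, Or.inr _ => simp only [hhDeg] at h; omega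
  | 2, _, _ => simpa [hhDeg] using h

theorem HHIndex.natAbs_ord_le (j : HHIndex) : j.1.2.ord.natAbs ≤ j.1.2.deg := by
  have := Finset.mem_Icc.1 j.1.2.2.2
  unfold SHIndex.ord SHIndex.deg
  omega

theorem HHIndex.ext {a b : HHIndex} (h1 : a.1.1 = b.1.1) (h2 : a.1.2.deg = b.1.2.deg)
    (h3 : a.1.2.ord = b.1.2.ord) : a = b := by
  obtain ⟨⟨i, n, k, hk⟩, hi⟩ := a
  obtain ⟨⟨j, m, l, hl⟩, hj⟩ := b
  change i = j at h1
  change n = m at h2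
  change k = l at h3
  subst h1 h2 h3
  rfl

theorem memLp_of_continuous {E : Type*} [NormedAddCommGroup E] {f : S2 → E} (hf : Continuous f) :
    MemLp f 2 surfaceMeasure :=
  hf.memLp_of_hasCompactSupport (HasCompactSupport.of_compactSpace _)

theorem memLp_hardyHodgeHarm (j : HHIndex) :
    MemLp (hardyHodgeHarm j.1.1 j.1.2.deg j.1.2.ord) 2 surfaceMeasure :=
  memLp_of_continuous (continuous_hardyHodgeHarm _ j.natAbs_ord_le)

/-- The Hardy–Hodge harmonics as elements of `L²`. -/
def hhLp (j : HHIndex) : Lp C3 2 surfaceMeasure := (memLp_hardyHodgeHarm j).toLp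

theorem inner_toLp {f g : S2 → C3} (hf : MemLp f 2 surfaceMeasure)
    (hg : MemLp g 2 surfaceMeasure) :
    inner ℂ hf.toLp hg.toLp = ∫ x, inner ℂ (f x) (g x) ∂surfaceMeasure := by
  rw [L2.inner_def]
  refine integral_congr_ae ?_
  filter_upwards [hf.coeFn_toLp, hg.coeFn_toLp] with x h1 h2
  rw [h1, h2]

theorem orthonormal_hhLp : Orthonormal ℂ hhLp := by
  classical
  rw [orthonormal_iff_ite]
  intro a b
  unfold hhLp
  rw [inner_toLp, integral_inner_hardyHodgeHarm a.2 b.2 a.natAbs_ord_le b.natAbs_ord_le]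
  by_cases hab : a = b
  · subst hab; simp
  · rw [if_neg hab]
    split_ifs with h1 h2
    · refine absurd (HHIndex.ext h2 ?_ h1.2) hab
      have hb := b.2
      rw [← h2] at h1 hb
      exact index_eq_of_hhDeg_eq a.2 hb h1.1
    · rfl
    · rfl

/-! ### Density of the spherical harmonics -/

/-- `Y_{n,k}` as a continuous map. -/
def harmC (n : ℕ) (k : ℤ) : C(S2, ℂ) := ⟨sphHarm n k, continuous_sphHarm n k⟩

theorem harmC_eq_zero {n : ℕ} {k : ℤ} (h : n < k.natAbs) : harmC n k = 0 := by
  ext x; exact sphHarm_eq_zero h x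

/-- The span of the spherical harmonics in the continuous functions. -/
def harmSpan : Submodule ℂ C(S2, ℂ) :=
  Submodule.span ℂ (Set.range fun p : ℕ × ℤ => harmC p.1 p.2)

theorem harmC_mem (n : ℕ) (k : ℤ) : harmC n k ∈ harmSpan :=
  Submodule.subset_span ⟨(n, k), rfl⟩

/-- The coordinate functions on the sphere. -/
def coordC (j : Fin 3) : C(S2, ℂ) :=
  ⟨fun x => (((x : E3) j : ℝ) : ℂ), by fun_prop⟩

theorem coordC_mul_harmC_mem (j : Fin 3) (n : ℕ) (k : ℤ) : coordC j * harmC n k ∈ harmSpan := by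
  rcases Nat.lt_or_ge n k.natAbs with h | h
  · rw [harmC_eq_zero h, mul_zero]; exact harmSpan.zero_mem
  have hp : (coordC 0 + Complex.I • coordC 1) * harmC n k =
      (-coeffB n k : ℂ) • harmC (n + 1) (k + 1) + (coeffB' n (-k) : ℂ) • harmC (n - 1) (k + 1) := by
    ext x
    have := ePlus_mul_sphHarm h x
    unfold ePlus at this
    simp only [coordC, harmC, ContinuousMap.mul_apply, ContinuousMap.add_apply,
      ContinuousMap.smul_apply, ContinuousMap.coe_mk, smul_eq_mul]
    linear_combination this
  have hm : (coordC 0 - Complex.I • coordC 1) * harmC n k =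
      (coeffB n (-k) : ℂ) • harmC (n + 1) (k - 1) - (coeffB' n k : ℂ) • harmC (n - 1) (k - 1) := by
    ext x
    have := eMinus_mul_sphHarm h x
    unfold eMinus at this
    simp only [coordC, harmC, ContinuousMap.mul_apply, ContinuousMap.sub_apply,
      ContinuousMap.smul_apply, ContinuousMap.coe_mk, smul_eq_mul]
    linear_combination this
  have hp' : (coordC 0 + Complex.I • coordC 1) * harmC n k ∈ harmSpan := by
    rw [hp]
    exact harmSpan.add_mem (harmSpan.smul_mem _ (harmC_mem _ _))
      (harmSpan.smul_mem _ (harmC_mem _ _))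
  have hm' : (coordC 0 - Complex.I • coordC 1) * harmC n k ∈ harmSpan := by
    rw [hm]
    exact harmSpan.sub_mem (harmSpan.smul_mem _ (harmC_mem _ _))
      (harmSpan.smul_mem _ (harmC_mem _ _))
  fin_cases j
  · have e : coordC 0 * harmC n k = (1 / 2 : ℂ) • ((coordC 0 + Complex.I • coordC 1) * harmC n k) +
        (1 / 2 : ℂ) • ((coordC 0 - Complex.I • coordC 1) * harmC n k) := by
      ext x
      simp only [ContinuousMap.mul_apply, ContinuousMap.add_apply, ContinuousMap.sub_apply,
        ContinuousMap.smul_apply, smul_eq_mul]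
      ring
    exact e ▸ harmSpan.add_mem (harmSpan.smul_mem _ hp') (harmSpan.smul_mem _ hm')
  · have e : coordC 1 * harmC n k =
        (-Complex.I / 2 : ℂ) • ((coordC 0 + Complex.I • coordC 1) * harmC n k) +
        (Complex.I / 2 : ℂ) • ((coordC 0 - Complex.I • coordC 1) * harmC n k) := by
      ext x
      simp only [ContinuousMap.mul_apply, ContinuousMap.add_apply, ContinuousMap.sub_apply,
        ContinuousMap.smul_apply, smul_eq_mul]
      linear_combination (coordC 1 x * harmC n k x) * Complex.I_sq
    exact e ▸ harmSpan.add_mem (harmSpan.smul_mem _ hp') (harmSpan.smul_mem _ hm')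
  · have e : coordC 2 * harmC n k =
        (coeffA n k : ℂ) • harmC (n + 1) k + (coeffA' n k : ℂ) • harmC (n - 1) k := by
      ext x
      exact x2_mul_sphHarm h x
    exact e ▸ harmSpan.add_mem (harmSpan.smul_mem _ (harmC_mem _ _))
      (harmSpan.smul_mem _ (harmC_mem _ _))

theorem coordC_mul_mem (j : Fin 3) {f : C(S2, ℂ)} (hf : f ∈ harmSpan) :
    coordC j * f ∈ harmSpan := by
  induction hf using Submodule.span_induction with
  | mem f hf => obtain ⟨p, rfl⟩ := hf; exact coordC_mul_harmC_mem j p.1 p.2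
  | zero => rw [mul_zero]; exact harmSpan.zero_mem
  | add f g _ _ h1 h2 => rw [mul_add]; exact harmSpan.add_mem h1 h2
  | smul c f _ h => rw [mul_smul_comm]; exact harmSpan.smul_mem _ h

theorem star_mem_harmSpan {f : C(S2, ℂ)} (hf : f ∈ harmSpan) : star f ∈ harmSpan := by
  induction hf using Submodule.span_induction with
  | mem f hf =>
    obtain ⟨p, rfl⟩ := hf
    have e : star (harmC p.1 p.2) = ((-1 : ℂ) ^ p.2) • harmC p.1 (-p.2) := by
      ext x; exact conj_sphHarm p.1 p.2 x
    simp only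
    rw [e]
    exact harmSpan.smul_mem _ (harmC_mem _ _)
  | zero => rw [star_zero]; exact harmSpan.zero_mem
  | add f g _ _ h1 h2 => rw [star_add]; exact harmSpan.add_mem h1 h2
  | smul c f _ h => rw [star_smul]; exact harmSpan.smul_mem _ h

theorem one_mem_harmSpan : (1 : C(S2, ℂ)) ∈ harmSpan := by
  have hc : ((shNorm 0 0 : ℝ) : ℂ) ≠ 0 := by
    have h : shNorm 0 0 = √(1 / (4 * Real.pi)) := by simp [shNorm]
    have h2 : 0 < √(1 / (4 * Real.pi)) := Real.sqrt_pos.2 (by positivity)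
    rw [h]
    exact_mod_cast h2.ne'
  have e : (1 : C(S2, ℂ)) = ((shNorm 0 0 : ℝ) : ℂ)⁻¹ • harmC 0 0 := by
    ext x
    have h := sphHarm_natCast (le_refl 0) x
    simp only [legendreD, Function.iterate_zero, id_eq, legendre_zero, Polynomial.eval_one, mul_one,
      pow_zero, Nat.cast_zero] at h
    simp only [ContinuousMap.one_apply, ContinuousMap.smul_apply, smul_eq_mul, harmC,
      ContinuousMap.coe_mk, h]
    exact (inv_mul_cancel₀ hc).symm
  rw [e]
  exact harmSpan.smul_mem _ (harmC_mem _ _)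

/-- Stone–Weierstrass for the star algebra generated by the coordinates, which separates points. The
span of the harmonics is stable under multiplication by this algebra and contains 1, hence contains
the algebra. -/
theorem topologicalClosure_harmSpan : harmSpan.topologicalClosure = ⊤ := by
  set A := StarAlgebra.adjoin ℂ (Set.range coordC) with hA
  have hsep : A.SeparatesPoints := by
    intro x y hxy
    obtain ⟨j, hj⟩ : ∃ j, (x : E3) j ≠ (y : E3) j := by
      by_contra! h
      exact hxy (Subtype.ext (by ext j; exact h j))
    refine ⟨coordC j, ⟨coordC j, StarAlgebra.subset_adjoin ℂ _ ⟨j, rfl⟩, rfl⟩, ?_⟩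
    simpa [coordC] using hj
  have hmul : ∀ a ∈ A, ∀ f ∈ harmSpan, a * f ∈ harmSpan := by
    intro a ha
    induction ha using StarAlgebra.adjoin_induction with
    | mem a ha => obtain ⟨j, rfl⟩ := ha; exact fun f hf => coordC_mul_mem j hf
    | algebraMap r =>
      intro f hf
      rw [← Algebra.smul_def]; exact harmSpan.smul_mem _ hf
    | add a b _ _ h1 h2 => intro f hf; rw [add_mul]; exact harmSpan.add_mem (h1 f hf) (h2 f hf)
    | mul a b _ _ h1 h2 => intro f hf; rw [mul_assoc]; exact h1 _ (h2 f hf)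
    | star a _ h =>
      intro f hf
      have := star_mem_harmSpan (h _ (star_mem_harmSpan hf))
      rwa [star_mul', star_star] at this
  have hle : (A : Set C(S2, ℂ)) ⊆ harmSpan := fun a ha => by
    simpa using hmul a ha 1 one_mem_harmSpan
  have htop := ContinuousMap.starSubalgebra_topologicalClosure_eq_top_of_separatesPoints A hsep
  rw [eq_top_iff]
  intro f _
  have hf : f ∈ A.topologicalClosure := by rw [htop]; trivial
  exact closure_mono hle hf

/-! ### Completeness of the Hardy–Hodge harmonics -/

/-- The field with only one non-zero Cartesian component `f`, as an element of `L²`. -/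
def embedLp (j : Fin 3) : C(S2, ℂ) →L[ℂ] Lp C3 2 surfaceMeasure :=
  (ContinuousMap.toLp 2 surfaceMeasure ℂ).comp
    (((ContinuousLinearMap.id ℂ ℂ).smulRight
      (EuclideanSpace.single j (1 : ℂ) : C3)).compLeftContinuous ℂ S2)

/-- The `j`-th component of a continuous field. -/
def compC (g : C(S2, C3)) (j : Fin 3) : C(S2, ℂ) := ⟨fun x => g x j, by fun_prop⟩

theorem toLp_eq_sum_embedLp (g : C(S2, C3)) :
    (ContinuousMap.toLp 2 surfaceMeasure ℂ g : Lp C3 2 surfaceMeasure) =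
      embedLp 0 (compC g 0) + embedLp 1 (compC g 1) + embedLp 2 (compC g 2) := by
  simp only [embedLp, ContinuousLinearMap.comp_apply, ← map_add]
  congr 1
  ext x i
  fin_cases i <;> simp [compC]

/-- The span of the fields with components in the harmonics of degree `d`. -/
def harmFields (d : ℕ) : Submodule ℂ (Lp C3 2 surfaceMeasure) :=
  Submodule.span ℂ (Set.range fun p : Fin 3 × Finset.Icc (-(d : ℤ)) d =>
    embedLp p.1 (harmC d p.2))

theorem embedLp_harmC_mem (j : Fin 3) (d : ℕ) (k : ℤ) : embedLp j (harmC d k) ∈ harmFields d := by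
  rcases Nat.lt_or_ge d k.natAbs with h | h
  · rw [harmC_eq_zero h, map_zero]; exact Submodule.zero_mem _
  · exact Submodule.subset_span ⟨(j, ⟨k, Finset.mem_Icc.2 (by omega)⟩), rfl⟩

theorem finrank_harmFields_le (d : ℕ) : Module.finrank ℂ (harmFields d) ≤ 3 * (2 * d + 1) := by
  refine (finrank_range_le_card _).trans ?_
  rw [Fintype.card_prod, Fintype.card_coe, Int.card_Icc, Fintype.card_fin]
  omega

instance (d : ℕ) : FiniteDimensional ℂ (harmFields d) :=
  FiniteDimensional.span_of_finite ℂ (Set.finite_range _)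

theorem hhLp_mem_harmFields (j : HHIndex) : hhLp j ∈ harmFields (hhDeg j.1.1 j.1.2.deg) := by
  have hk := j.natAbs_ord_le
  set i := j.1.1
  set n := j.1.2.deg
  set k := j.1.2.ord
  let g : C(S2, C3) := ⟨hardyHodgeHarm i n k, continuous_hardyHodgeHarm i hk⟩
  have e : hhLp j = ContinuousMap.toLp 2 surfaceMeasure ℂ g := by
    refine Lp.ext ?_
    filter_upwards [(memLp_hardyHodgeHarm j).coeFn_toLp,
      ContinuousMap.coeFn_toLp (p := 2) surfaceMeasure (𝕜 := ℂ) g] with x h1 h2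
    rw [h2]
    exact h1
  have h0 : compC g 0 = (1 / 2 * hhPlus i n k) • harmC (hhDeg i n) (k + 1) +
      (1 / 2 * hhMinus i n k) • harmC (hhDeg i n) (k - 1) := by
    ext x
    have hp := cPlus_hardyHodgeHarm i hk x
    have hm := cMinus_hardyHodgeHarm i hk x
    unfold cPlus at hp
    unfold cMinus at hm
    simp only [compC, g, harmC, ContinuousMap.coe_mk, ContinuousMap.add_apply,
      ContinuousMap.smul_apply, smul_eq_mul]
    linear_combination (1 / 2) * hp + (1 / 2) * hm
  have h1 : compC g 1 = (-Complex.I / 2 * hhPlus i n k) • harmC (hhDeg i n) (k + 1) +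
      (Complex.I / 2 * hhMinus i n k) • harmC (hhDeg i n) (k - 1) := by
    ext x
    have hp := cPlus_hardyHodgeHarm i hk x
    have hm := cMinus_hardyHodgeHarm i hk x
    unfold cPlus at hp
    unfold cMinus at hm
    simp only [compC, g, harmC, ContinuousMap.coe_mk, ContinuousMap.add_apply,
      ContinuousMap.smul_apply, smul_eq_mul]
    linear_combination (-Complex.I / 2) * hp + (Complex.I / 2) * hm
      + (hardyHodgeHarm i n k x 1) * Complex.I_sq
  have h2 : compC g 2 = hhTwo i n k • harmC (hhDeg i n) k := by
    ext x
    exact hardyHodgeHarm_two i hk x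
  rw [e, toLp_eq_sum_embedLp, h0, h1, h2]
  simp only [map_add, map_smul]
  have hmem := fun j k => embedLp_harmC_mem j (hhDeg i n) k
  refine Submodule.add_mem _ (Submodule.add_mem _ ?_ ?_) ?_
  · exact Submodule.add_mem _ (Submodule.smul_mem _ _ (hmem _ _))
      (Submodule.smul_mem _ _ (hmem _ _))
  · exact Submodule.add_mem _ (Submodule.smul_mem _ _ (hmem _ _))
      (Submodule.smul_mem _ _ (hmem _ _))
  · exact Submodule.smul_mem _ _ (hmem _ _)

/-- An orthonormal family of 3(2d+1) vectors in a space of dimension at most 3(2d+1) spans it. No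
inversion formula from Hardy–Hodge harmonics to Cartesian components is needed. -/
theorem harmFields_le_of_card {d : ℕ} {ι : Type} [Fintype ι] (f : ι → HHIndex)
    (hf : Function.Injective f) (hd : ∀ a, hhDeg (f a).1.1 (f a).1.2.deg = d)
    (hcard : Fintype.card ι = 3 * (2 * d + 1)) :
    harmFields d ≤ Submodule.span ℂ (Set.range hhLp) := by
  have hli : LinearIndependent ℂ (hhLp ∘ f) := (orthonormal_hhLp.comp f hf).linearIndependent
  have hle : Submodule.span ℂ (Set.range (hhLp ∘ f)) ≤ harmFields d := by
    rw [Submodule.span_le]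
    rintro _ ⟨a, rfl⟩
    have := hhLp_mem_harmFields (f a)
    rwa [hd] at this
  have heq : Submodule.span ℂ (Set.range (hhLp ∘ f)) = harmFields d := by
    refine Submodule.eq_of_le_of_finrank_le hle ?_
    rw [finrank_span_eq_card hli, hcard]
    exact finrank_harmFields_le d
  rw [← heq]
  exact Submodule.span_mono (Set.range_comp_subset_range f hhLp)

/-- The index `(i, n, k)` of a Hardy–Hodge harmonic. -/
def mkIndex (i : Fin 3) (n : ℕ) (h : i = 0 ∨ 1 ≤ n) (k : Finset.Icc (-(n : ℤ)) n) : HHIndex :=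
  ⟨(i, ⟨n, k⟩), h⟩

theorem mkIndex_injective (i : Fin 3) (n : ℕ) (h : i = 0 ∨ 1 ≤ n) :
    Function.Injective (mkIndex i n h) := by
  intro a b hab
  have := congrArg (fun j : HHIndex => j.1.2.ord) hab
  exact Subtype.ext this

/-- In component degree d ≥ 1 there are type (1) of degree d-1, type (3) of degree d and type (2) of
degree d+1: (2d-1) + (2d+1) + (2d+3) = 3(2d+1). For d = 0 the three harmonics of type (2) and degree
1 suffice. -/
theorem harmFields_le_span (d : ℕ) : harmFields d ≤ Submodule.span ℂ (Set.range hhLp) := by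
  rcases d with _ | d
  · refine harmFields_le_of_card (mkIndex 1 1 (Or.inr le_rfl)) (mkIndex_injective _ _ _)
      (fun a => rfl) ?_
    rw [Fintype.card_coe, Int.card_Icc]
    rfl
  · refine harmFields_le_of_card (Sum.elim (mkIndex 0 d (Or.inl rfl))
      (Sum.elim (mkIndex 2 (d + 1) (Or.inr (by omega)))
        (mkIndex 1 (d + 2) (Or.inr (by omega))))) ?_ ?_ ?_
    · refine Function.Injective.sumElim (mkIndex_injective _ _ _)
        (Function.Injective.sumElim (mkIndex_injective _ _ _) (mkIndex_injective _ _ _) ?_) ?_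
      · intro a b h
        have := congrArg (fun j : HHIndex => j.1.1) h
        exact absurd (show (2 : Fin 3) = 1 from this) (by decide)
      · rintro a (b | b) h
        · have := congrArg (fun j : HHIndex => j.1.1) h
          exact absurd (show (0 : Fin 3) = 2 from this) (by decide)
        · have := congrArg (fun j : HHIndex => j.1.1) h
          exact absurd (show (0 : Fin 3) = 1 from this) (by decide)
    · rintro (a | a | a) <;> rfl
    · simp only [Fintype.card_sum, Fintype.card_coe, Int.card_Icc]
      omega

/-- Continuous fields are dense in L², their components are uniform limits of combinations of
harmonics, and a field with one harmonic component lies in the span by `harmFields_le_span`. -/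
theorem topologicalClosure_span_hhLp :
    (Submodule.span ℂ (Set.range hhLp)).topologicalClosure = ⊤ := by
  set S := (Submodule.span ℂ (Set.range hhLp)).topologicalClosure with hS
  have hclosed : IsClosed (S : Set (Lp C3 2 surfaceMeasure)) :=
    Submodule.isClosed_topologicalClosure _
  have hembed : ∀ (j : Fin 3) (f : C(S2, ℂ)), embedLp j f ∈ S := by
    intro j f
    have hle : harmSpan.topologicalClosure ≤ S.comap (embedLp j : C(S2, ℂ) →ₗ[ℂ] _) := by
      refine Submodule.topologicalClosure_minimal _ ?_ (hclosed.preimage (embedLp j).continuous)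
      refine Submodule.span_le.2 ?_
      rintro _ ⟨p, rfl⟩
      exact Submodule.le_topologicalClosure _ (harmFields_le_span p.1 (embedLp_harmC_mem j p.1 p.2))
    rw [topologicalClosure_harmSpan] at hle
    exact hle (Submodule.mem_top (x := f))
  rw [eq_top_iff]
  intro f _
  have hdense := ContinuousMap.toLp_denseRange C3 (surfaceMeasure : Measure S2) ℂ
    (p := 2) (by norm_num)
  refine hclosed.closure_subset_iff.2 ?_ (hdense f)
  rintro _ ⟨g, rfl⟩
  rw [toLp_eq_sum_embedLp]
  exact S.add_mem (S.add_mem (hembed _ _) (hembed _ _)) (hembed _ _)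

/-- The Hilbert basis of Hardy–Hodge harmonics. -/
def hhBasis : HilbertBasis HHIndex ℂ (Lp C3 2 surfaceMeasure) :=
  HilbertBasis.mk orthonormal_hhLp topologicalClosure_span_hhLp.ge

theorem hasSum_hhLp (f : Lp C3 2 surfaceMeasure) :
    HasSum (fun j => inner ℂ (hhLp j) f • hhLp j) f := by
  have h := hhBasis.hasSum_repr f
  simp only [HilbertBasis.repr_apply_apply] at h
  simpa only [hhBasis, HilbertBasis.coe_mk] using h

/-! ### Racah sums -/

theorem invFact_of_neg {z : ℤ} (h : z < 0) : invFact z = 0 := by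
  simp [invFact, h.not_ge]

theorem invFact_of_nonneg {z : ℤ} (h : 0 ≤ z) : invFact z = (z.toNat.factorial : ℝ)⁻¹ := by
  simp [invFact, h]

theorem invFact_natCast (n : ℕ) : invFact n = (n.factorial : ℝ)⁻¹ := by
  simp [invFact]

theorem invFact_zero : invFact 0 = 1 := by simp [invFact]

theorem invFact_one : invFact 1 = 1 := by simp [invFact]

theorem invFact_two : invFact 2 = 1 / 2 := by simp [invFact, Nat.factorial]

theorem toNat_factorial_succ {z : ℤ} (h : 0 ≤ z) :
    ((z + 1).toNat.factorial : ℝ) = (z + 1) * z.toNat.factorial := by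
  lift z to ℕ using h
  have : ((z : ℤ) + 1).toNat = z + 1 := by omega
  rw [this, Nat.factorial_succ]; push_cast; simp

theorem neg_one_zpow_congr {a b : ℤ} (h : Even (a - b)) : (-1 : ℝ) ^ a = (-1) ^ b := by
  have : (-1 : ℝ) ^ a = (-1) ^ (a - b) * (-1) ^ b := by
    rw [← zpow_add₀ (by norm_num)]; congr 1; ring
  rw [this, h.neg_one_zpow, one_mul]

theorem sqrt_mul_mul_inv {a b : ℝ} (ha : 0 < a) (hb : 0 ≤ b) : √(a * b) * a⁻¹ = √(b / a) := by
  rw [Real.sqrt_mul ha.le, Real.sqrt_div hb]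
  have := Real.sqrt_pos.2 ha
  nth_rewrite 2 [← Real.mul_self_sqrt ha.le]
  field_simp

/-! ### 3j symbols with first entry 1 -/

theorem triangleCoeff_one_up (p : ℕ) :
    triangleCoeff 1 p (p + 1) = 2 / ((2 * p + 1) * (2 * p + 2) * (2 * p + 3)) := by
  unfold triangleCoeff
  rw [show 1 + p - (p + 1) = 0 by omega, show 1 + (p + 1) - p = 2 by omega,
    show p + (p + 1) - 1 = 2 * p by omega, show 1 + p + (p + 1) + 1 = 2 * p + 1 + 1 + 1 by omega]
  have := Nat.factorial_pos (2 * p)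
  simp only [Nat.factorial_succ (2 * p + 1 + 1), Nat.factorial_succ (2 * p + 1),
    Nat.factorial_succ (2 * p), Nat.factorial_zero, Nat.factorial_two]
  push_cast
  field_simp
  ring

theorem triangleCoeff_one_down (p : ℕ) :
    triangleCoeff 1 (p + 1) p = 2 / ((2 * p + 1) * (2 * p + 2) * (2 * p + 3)) := by
  rw [← triangleCoeff_one_up]
  unfold triangleCoeff
  rw [show 1 + p - (p + 1) = 0 by omega, show 1 + (p + 1) - p = 2 by omega,
    show p + (p + 1) - 1 = 2 * p by omega, show p + 1 + p - 1 = 2 * p by omega,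
    show 1 + p + (p + 1) + 1 = 1 + (p + 1) + p + 1 by omega]
  ring

/-- The stretched case j₃ = j₁ + j₂: the factor 1/(j₁ + j₂ - j₃ - t)! leaves only t = 0 in Racah's
sum. -/
theorem wigner3j_one_up {p : ℕ} {a b c : ℤ} (h : a + b + c = 0) (ha : |a| ≤ 1) (hb : |b| ≤ p)
    (hc : |c| ≤ p + 1) :
    wigner3j 1 p (p + 1) a b c = (-1) ^ ((p : ℤ) + 1 + c) *
      √(2 / ((2 * p + 1) * (2 * p + 2) * (2 * p + 3))) *
      √((((p + 1 + c : ℤ).toNat.factorial : ℝ) * (p + 1 - c : ℤ).toNat.factorial) /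
        (((1 + a : ℤ).toNat.factorial : ℝ) * (1 - a : ℤ).toNat.factorial *
          (p + b : ℤ).toNat.factorial * (p - b : ℤ).toNat.factorial)) := by
  unfold wigner3j
  rw [if_pos ⟨h, by exact_mod_cast ha, hb, by push_cast; exact hc, by unfold Triangle; omega⟩,
    triangleCoeff_one_up]
  rw [abs_le] at ha hb hc
  rw [Finset.sum_eq_single 0]
  · rw [neg_one_zpow_congr (b := (p : ℤ) + 1 + c) (by rw [Int.even_iff]; push_cast; omega)]
    have e1 : ((p + 1 : ℕ) : ℤ) - p + (0 : ℕ) + a = 1 + a := by push_cast; ring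
    have e2 : ((p + 1 : ℕ) : ℤ) - (1 : ℕ) + (0 : ℕ) - b = p - b := by push_cast; ring
    have e3 : ((1 : ℕ) : ℤ) + p - (p + 1 : ℕ) - (0 : ℕ) = 0 := by push_cast; ring
    have e4 : ((1 : ℕ) : ℤ) - (0 : ℕ) - a = 1 - a := by push_cast; ring
    have e5 : (p : ℤ) - (0 : ℕ) + b = p + b := by push_cast; ring
    rw [e1, e2, e3, e4, e5, invFact_zero, invFact_of_nonneg (z := 1 + a) (by omega),
      invFact_of_nonneg (z := p - b) (by omega), invFact_of_nonneg (z := 1 - a) (by omega),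
      invFact_of_nonneg (z := p + b) (by omega),
      ← sqrt_mul_mul_inv
        (a := ((1 + a : ℤ).toNat.factorial : ℝ) * (1 - a : ℤ).toNat.factorial *
          (p + b : ℤ).toNat.factorial * (p - b : ℤ).toNat.factorial) (by positivity) (by positivity)]
    simp only [Nat.cast_zero, invFact_zero, Nat.cast_one, Nat.cast_add, pow_zero]
    simp only [mul_inv]
    ring_nf
  · intro t _ ht
    rw [invFact_of_neg (z := ((1 : ℕ) : ℤ) + p - (p + 1 : ℕ) - t) (by push_cast; omega)]
    ring
  · simp

/-- Stretched with j₂ = j₁ + j₃: the factors 1/(t + a - 1)! and 1/(1 - t - a)! leave only t = 1 - a.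
-/
theorem wigner3j_one_down {p : ℕ} {a b c : ℤ} (h : a + b + c = 0) (ha : |a| ≤ 1)
    (hb : |b| ≤ p + 1) (hc : |c| ≤ p) :
    wigner3j 1 (p + 1) p a b c = (-1) ^ ((p : ℤ) + 1 + b) *
      √(2 / ((2 * p + 1) * (2 * p + 2) * (2 * p + 3))) *
      √((((p + 1 + b : ℤ).toNat.factorial : ℝ) * (p + 1 - b : ℤ).toNat.factorial) /
        (((1 + a : ℤ).toNat.factorial : ℝ) * (1 - a : ℤ).toNat.factorial *
          (p + c : ℤ).toNat.factorial * (p - c : ℤ).toNat.factorial)) := by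
  unfold wigner3j
  rw [if_pos ⟨h, by exact_mod_cast ha, by push_cast; exact hb, hc, by unfold Triangle; omega⟩,
    triangleCoeff_one_down]
  rw [abs_le] at ha hb hc
  obtain ⟨s, hs⟩ : ∃ s : ℕ, (s : ℤ) = 1 - a := ⟨(1 - a).toNat, by omega⟩
  rw [Finset.sum_eq_single s]
  · have hsign : (-1 : ℝ) ^ (((1 : ℕ) : ℤ) - (p + 1 : ℕ) - c) * (-1) ^ s =
        (-1) ^ ((p : ℤ) + 1 + b) := by
      rw [← zpow_natCast, ← zpow_add₀ (by norm_num)]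
      exact neg_one_zpow_congr (by rw [Int.even_iff]; push_cast; omega)
    rw [← hsign]
    have e1 : (p : ℤ) - (p + 1 : ℕ) + s + a = 0 := by push_cast; omega
    have e2 : (p : ℤ) - (1 : ℕ) + s - b = p + c := by push_cast; omega
    have e3 : ((1 : ℕ) : ℤ) + (p + 1 : ℕ) - p - s = 1 + a := by push_cast; omega
    have e4 : ((1 : ℕ) : ℤ) - s - a = 0 := by push_cast; omega
    have e5 : ((p + 1 : ℕ) : ℤ) - s + b = p - c := by push_cast; omega
    rw [e1, e2, e3, e4, e5, invFact_zero, hs, invFact_of_nonneg (z := 1 + a) (by omega),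
      invFact_of_nonneg (z := p + c) (by omega), invFact_of_nonneg (z := 1 - a) (by omega),
      invFact_of_nonneg (z := p - c) (by omega),
      ← sqrt_mul_mul_inv
        (a := ((1 + a : ℤ).toNat.factorial : ℝ) * (1 - a : ℤ).toNat.factorial *
          (p + c : ℤ).toNat.factorial * (p - c : ℤ).toNat.factorial) (by positivity) (by positivity)]
    simp only [Nat.cast_one, Nat.cast_add]
    simp only [mul_inv]
    ring_nf
  · intro t _ ht
    rcases lt_or_gt_of_ne (show (t : ℤ) ≠ s by exact_mod_cast ht) with h1 | h1
    · rw [invFact_of_neg (z := (p : ℤ) - (p + 1 : ℕ) + t + a) (by push_cast; omega)]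
      ring
    · rw [invFact_of_neg (z := ((1 : ℕ) : ℤ) - t - a) (by push_cast; omega)]
      ring
  · intro hn
    exact absurd (Finset.mem_range.2 (by omega)) hn

/-- The parity rule for the odd sum 1 + p + p: only t = 0 and t = 1 survive, with opposite values.
-/
theorem wigner3j_one_self_zero (p : ℕ) : wigner3j 1 p p 0 0 0 = 0 := by
  unfold wigner3j
  split_ifs with h
  · obtain ⟨-, -, -, -, h⟩ := h
    have hp : 1 ≤ p := by unfold Triangle at h; omega
    obtain ⟨r, rfl⟩ : ∃ r, p = r + 1 := ⟨p - 1, by omega⟩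
    refine mul_eq_zero_of_right _ ?_
    rw [← Finset.sum_subset (s₁ := {0, 1}), Finset.sum_pair (by norm_num)]
    · simp only [Nat.cast_zero, Nat.cast_one, Nat.cast_add, pow_zero, pow_one, add_zero, sub_zero,
        add_sub_cancel_right, sub_self, zero_add, invFact_zero, invFact_one, zero_sub]
      ring
    · intro t ht
      simp only [Finset.mem_insert, Finset.mem_singleton] at ht
      exact Finset.mem_range.2 (by omega)
    · intro t _ ht
      simp only [Finset.mem_insert, Finset.mem_singleton] at ht
      rw [invFact_of_neg (z := ((1 : ℕ) : ℤ) - t - 0) (by push_cast; omega)]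
      ring
  · rfl

/-! ### Closed forms of α⁽¹⁾ -/

theorem alpha1_self (p : ℕ) (q l : ℤ) : alpha1 p q p l = 0 := by
  simp [alpha1, wigner3j_one_self_zero]

theorem sqrt_factorial_ratio (p : ℕ) :
    √((((p + 1 : ℤ).toNat.factorial : ℝ) * (p + 1 : ℤ).toNat.factorial) /
      ((p : ℤ).toNat.factorial * (p : ℤ).toNat.factorial)) = p + 1 := by
  rw [toNat_factorial_succ (by omega)]
  simp only [Int.toNat_natCast, Int.cast_natCast]
  have := Nat.factorial_pos p
  rw [show ((p : ℝ) + 1) * p.factorial * ((p + 1) * p.factorial) / (p.factorial * p.factorial) =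
    (p + 1) ^ 2 by field_simp, Real.sqrt_sq (by positivity)]

/-- Collects the radicals of `alpha1`: both 3j symbols share the square root of the triangle
coefficient, and p + 1 is the factorial part of the symbol with zero orders
(`sqrt_factorial_ratio`). -/
theorem alpha_product (p : ℕ) {F : ℝ} (hF : 0 ≤ F) :
    √(3 * (2 * p + 3) * (2 * p + 1) / (4 * Real.pi)) *
      (√(2 / ((2 * p + 1) * (2 * p + 2) * (2 * p + 3))) * (p + 1)) *
        (√(2 / ((2 * p + 1) * (2 * p + 2) * (2 * p + 3))) * √F) =
      √(3 / (4 * Real.pi)) * √(F / ((2 * p + 1) * (2 * p + 3))) := by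
  have hS : (0 : ℝ) < (2 * p + 1) * (2 * p + 3) := by positivity
  have h1 : √(3 * (2 * p + 3) * (2 * p + 1) / (4 * Real.pi)) =
      √(3 / (4 * Real.pi)) * √((2 * p + 1) * (2 * p + 3) : ℝ) := by
    rw [← Real.sqrt_mul (by positivity)]; congr 1; ring
  have h2 : √(2 / ((2 * p + 1) * (2 * p + 2) * (2 * p + 3)) : ℝ) *
      √(2 / ((2 * p + 1) * (2 * p + 2) * (2 * p + 3)) : ℝ) =
      2 / ((2 * p + 1) * (2 * p + 2) * (2 * p + 3)) := Real.mul_self_sqrt (by positivity)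
  have h3 : √((2 * p + 1) * (2 * p + 3) : ℝ) ^ 2 = (2 * p + 1) * (2 * p + 3) :=
    Real.sq_sqrt hS.le
  have h4 := Real.sqrt_pos.2 hS
  rw [h1, Real.sqrt_div hF]
  calc _ = √(3 / (4 * Real.pi)) * √((2 * p + 1) * (2 * p + 3) : ℝ) * (p + 1) *
        (√(2 / ((2 * p + 1) * (2 * p + 2) * (2 * p + 3)) : ℝ) *
          √(2 / ((2 * p + 1) * (2 * p + 2) * (2 * p + 3)) : ℝ)) * √F := by ring
    _ = _ := by
      rw [h2]
      field_simp
      rw [h3]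

theorem alpha1_up_eq {p : ℕ} {q l : ℤ} (hq : |q| ≤ p) (hk : |q - l| ≤ 1) :
    alpha1 p q (p + 1) l = (-1) ^ (q - l) * (√(3 / (4 * Real.pi)) *
      √((((p + 1 + l : ℤ).toNat.factorial : ℝ) * (p + 1 - l : ℤ).toNat.factorial) /
        (((1 + (q - l) : ℤ).toNat.factorial : ℝ) * (1 - (q - l) : ℤ).toNat.factorial *
          (p - q : ℤ).toNat.factorial * (p + q : ℤ).toNat.factorial) /
            ((2 * p + 1) * (2 * p + 3)))) := by
  have hl : |l| ≤ p + 1 := by rw [abs_le] at *; omega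
  unfold alpha1 kIndex
  rw [wigner3j_one_up (by ring) hk (by rwa [abs_neg]) hl,
    wigner3j_one_up (by norm_num) (by norm_num) (by simp) (by simp; omega),
    ← alpha_product p (by positivity)]
  have hs : (-1 : ℝ) ^ (q - l) = (-1) ^ q * (-1) ^ ((p : ℤ) + 1 + 0) * (-1) ^ ((p : ℤ) + 1 + l) := by
    rw [← zpow_add₀ (by norm_num), ← zpow_add₀ (by norm_num)]
    exact neg_one_zpow_congr (by rw [Int.even_iff]; omega)
  rw [hs]
  simp only [add_zero, sub_zero, Int.toNat_one, Nat.factorial_one, Nat.cast_one, one_mul,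
    sub_neg_eq_add, ← sub_eq_add_neg]
  rw [sqrt_factorial_ratio]
  push_cast
  rw [show (3 : ℝ) * (2 * (p + 1) + 1) = 3 * (2 * p + 3) by ring]
  ring

theorem alpha1_down_eq {p : ℕ} {q l : ℤ} (hq : |q| ≤ p + 1) (hk : |q - l| ≤ 1) (hl : |l| ≤ p) :
    alpha1 (p + 1) q p l = √(3 / (4 * Real.pi)) *
      √((((p + 1 - q : ℤ).toNat.factorial : ℝ) * (p + 1 + q : ℤ).toNat.factorial) /
        (((1 + (q - l) : ℤ).toNat.factorial : ℝ) * (1 - (q - l) : ℤ).toNat.factorial *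
          (p + l : ℤ).toNat.factorial * (p - l : ℤ).toNat.factorial) /
            ((2 * p + 1) * (2 * p + 3))) := by
  unfold alpha1 kIndex
  rw [wigner3j_one_down (by ring) hk (by rwa [abs_neg]) hl,
    wigner3j_one_down (by norm_num) (by norm_num) (by simp; omega) (by simp),
    ← alpha_product p (by positivity)]
  have hs : (1 : ℝ) = (-1) ^ q * (-1) ^ ((p : ℤ) + 1 + 0) * (-1) ^ ((p : ℤ) + 1 + -q) := by
    rw [← zpow_add₀ (by norm_num), ← zpow_add₀ (by norm_num), ← zpow_zero (-1 : ℝ)]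
    exact neg_one_zpow_congr (by rw [Int.even_iff]; omega)
  simp only [add_zero, sub_zero, Int.toNat_one, Nat.factorial_one, Nat.cast_one, one_mul,
    sub_neg_eq_add, ← sub_eq_add_neg] at hs ⊢
  rw [sqrt_factorial_ratio]
  push_cast
  rw [show (3 : ℝ) * (2 * p + 1) * (2 * (p + 1) + 1) = 3 * (2 * p + 3) * (2 * p + 1) by ring]
  linear_combination (-(√(3 * (2 * p + 3) * (2 * p + 1) / (4 * Real.pi)) *
      (√(2 / ((2 * p + 1) * (2 * p + 2) * (2 * p + 3))) * (p + 1)) *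
        (√(2 / ((2 * p + 1) * (2 * p + 2) * (2 * p + 3))) *
      √((((p + 1 - q : ℤ).toNat.factorial : ℝ) * (p + 1 + q : ℤ).toNat.factorial) /
        (((1 + (q - l) : ℤ).toNat.factorial : ℝ) * (1 - (q - l) : ℤ).toNat.factorial *
          (p + l : ℤ).toNat.factorial * (p - l : ℤ).toNat.factorial))))) * hs

theorem alpha1_up_zero {p : ℕ} {q : ℤ} (hq : |q| ≤ p) :
    alpha1 p q (p + 1) q = √(3 / (4 * Real.pi)) * coeffA p q := by
  rw [alpha1_up_eq hq (by simp)]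
  rw [abs_le] at hq
  rw [show (p + 1 + q : ℤ) = (p + q) + 1 by ring, show (p + 1 - q : ℤ) = (p - q) + 1 by ring,
    toNat_factorial_succ (by omega), toNat_factorial_succ (by omega)]
  have h1 := Nat.factorial_pos (p + q : ℤ).toNat
  have h2 := Nat.factorial_pos (p - q : ℤ).toNat
  simp only [sub_self, zpow_zero, one_mul, coeffA, add_zero, sub_zero, Int.toNat_one,
    Nat.factorial_one, Nat.cast_one]
  congr 2
  field_simp
  push_cast; ring

/-- For l = q ± 1 a factorial 2! appears in the denominator; it turns the constant of Y_{1,0} into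
that of Y_{1,±1}. -/
theorem sqrt_three_div_mul (x : ℝ) :
    √(3 / (8 * Real.pi)) * √x = √(3 / (4 * Real.pi)) * √(x / 2) := by
  rw [← Real.sqrt_mul (by positivity), ← Real.sqrt_mul (by positivity)]; congr 1; ring

theorem alpha1_up_succ {p : ℕ} {q : ℤ} (hq : |q| ≤ p) :
    alpha1 p q (p + 1) (q + 1) = -(√(3 / (8 * Real.pi)) * coeffB p q) := by
  rw [alpha1_up_eq hq (by simp)]
  rw [abs_le] at hq
  rw [show (p + 1 + (q + 1) : ℤ) = (p + q) + 1 + 1 by ring,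
    show (p + 1 - (q + 1) : ℤ) = p - q by ring,
    toNat_factorial_succ (by omega), toNat_factorial_succ (by omega)]
  have h1 := Nat.factorial_pos (p + q : ℤ).toNat
  have h2 := Nat.factorial_pos (p - q : ℤ).toNat
  rw [show q - (q + 1) = -1 by ring, coeffB, sqrt_three_div_mul]
  simp only [show (1 + (-1) : ℤ).toNat = 0 from rfl, show (1 - (-1) : ℤ).toNat = 2 from rfl, Nat.factorial_zero,
    Nat.factorial_two, Nat.cast_one, Nat.cast_two, Int.reduceNeg, zpow_neg, zpow_one, inv_neg,
    inv_one, neg_mul, one_mul]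
  congr 2
  field_simp
  push_cast
  ring_nf

theorem alpha1_up_pred {p : ℕ} {q : ℤ} (hq : |q| ≤ p) :
    alpha1 p q (p + 1) (q - 1) = -(√(3 / (8 * Real.pi)) * coeffB p (-q)) := by
  rw [alpha1_up_eq hq (by simp)]
  rw [abs_le] at hq
  rw [show (p + 1 - (q - 1) : ℤ) = (p - q) + 1 + 1 by ring,
    show (p + 1 + (q - 1) : ℤ) = p + q by ring,
    toNat_factorial_succ (by omega), toNat_factorial_succ (by omega)]
  have h1 := Nat.factorial_pos (p + q : ℤ).toNat
  have h2 := Nat.factorial_pos (p - q : ℤ).toNat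
  rw [show q - (q - 1) = 1 by ring, coeffB, sqrt_three_div_mul]
  simp only [show (1 + 1 : ℤ).toNat = 2 from rfl, show (1 - 1 : ℤ).toNat = 0 from rfl, Nat.factorial_zero,
    Nat.factorial_two, Nat.cast_one, Nat.cast_two, Int.reduceNeg, zpow_neg, zpow_one, inv_neg,
    inv_one, neg_mul, one_mul]
  congr 2
  field_simp
  push_cast
  ring_nf

theorem alpha1_down_zero {p : ℕ} {q : ℤ} (hq : |q| ≤ p) :
    alpha1 (p + 1) q p q = √(3 / (4 * Real.pi)) * coeffA' (p + 1) q := by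
  rw [alpha1_down_eq (hq.trans (by omega)) (by simp) hq, coeffA'_succ]
  rw [abs_le] at hq
  rw [show (p + 1 + q : ℤ) = (p + q) + 1 by ring, show (p + 1 - q : ℤ) = (p - q) + 1 by ring,
    toNat_factorial_succ (by omega), toNat_factorial_succ (by omega)]
  have h1 := Nat.factorial_pos (p + q : ℤ).toNat
  have h2 := Nat.factorial_pos (p - q : ℤ).toNat
  simp only [sub_self, zpow_zero, one_mul, coeffA, add_zero, sub_zero, Int.toNat_one,
    Nat.factorial_one, Nat.cast_one]
  congr 2
  field_simp
  push_cast; ring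

theorem alpha1_down_succ {p : ℕ} {q : ℤ} (hl : |q + 1| ≤ p) :
    alpha1 (p + 1) q p (q + 1) = √(3 / (8 * Real.pi)) * coeffB' (p + 1) (-q) := by
  rw [alpha1_down_eq (by rw [abs_le] at *; omega) (by simp) hl, coeffB'_succ]
  rw [abs_le] at hl
  rw [show (p + 1 - q : ℤ) = (p - (q + 1)) + 1 + 1 by ring,
    show (p + 1 + q : ℤ) = p + (q + 1) by ring,
    toNat_factorial_succ (by omega), toNat_factorial_succ (by omega)]
  have h1 := Nat.factorial_pos (p + (q + 1) : ℤ).toNat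
  have h2 := Nat.factorial_pos (p - (q + 1) : ℤ).toNat
  rw [show q - (q + 1) = -1 by ring, coeffB, sqrt_three_div_mul]
  simp only [show (1 + (-1) : ℤ).toNat = 0 from rfl, show (1 - (-1) : ℤ).toNat = 2 from rfl, Nat.factorial_zero,
    Nat.factorial_two, Nat.cast_one, Nat.cast_two, Int.reduceNeg, zpow_neg, zpow_one, inv_neg,
    inv_one, neg_mul, one_mul]
  congr 2
  field_simp
  push_cast
  ring_nf

theorem alpha1_down_pred {p : ℕ} {q : ℤ} (hl : |q - 1| ≤ p) :
    alpha1 (p + 1) q p (q - 1) = √(3 / (8 * Real.pi)) * coeffB' (p + 1) q := by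
  rw [alpha1_down_eq (by rw [abs_le] at *; omega) (by simp) hl, coeffB'_succ]
  rw [abs_le] at hl
  rw [show (p + 1 + q : ℤ) = (p + (q - 1)) + 1 + 1 by ring,
    show (p + 1 - q : ℤ) = p - (q - 1) by ring,
    toNat_factorial_succ (by omega), toNat_factorial_succ (by omega)]
  have h1 := Nat.factorial_pos (p + (q - 1) : ℤ).toNat
  have h2 := Nat.factorial_pos (p - (q - 1) : ℤ).toNat
  rw [show q - (q - 1) = 1 by ring, coeffB, sqrt_three_div_mul]
  simp only [show (1 + 1 : ℤ).toNat = 2 from rfl, show (1 - 1 : ℤ).toNat = 0 from rfl, Nat.factorial_zero,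
    Nat.factorial_two, Nat.cast_one, Nat.cast_two, Int.reduceNeg, zpow_neg, zpow_one, inv_neg,
    inv_one, neg_mul, one_mul]
  congr 2
  field_simp
  push_cast
  ring_nf

/-! ### 3j and 6j symbols that enter α⁽³⁾ -/

theorem neg_one_zpow_eq_neg {a b : ℤ} (h : Odd (a - b)) : (-1 : ℝ) ^ a = -(-1) ^ b := by
  have : (-1 : ℝ) ^ a = (-1) ^ (a - b) * (-1) ^ b := by
    rw [← zpow_add₀ (by norm_num)]; congr 1; ring
  rw [this, h.neg_one_zpow, neg_one_mul]

/-- With 1/z! = 0 for negative z this needs no positivity, so neighbouring terms of a Racah sum can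
be brought to a common factor even at its ends. -/
theorem invFact_sub_one (z : ℤ) : invFact (z - 1) = z * invFact z := by
  rcases lt_trichotomy z 0 with h | rfl | h
  · rw [invFact_of_neg h, invFact_of_neg (by omega), mul_zero]
  · simp [invFact_of_neg]
  · have := toNat_factorial_succ (z := z - 1) (by omega)
    rw [sub_add_cancel] at this
    rw [invFact_of_nonneg h.le, invFact_of_nonneg (by omega), this]
    have h1 : (z : ℝ) ≠ 0 := by exact_mod_cast h.ne'
    push_cast
    rw [show (z : ℝ) - 1 + 1 = z by ring]
    field_simp

theorem triangleCoeff_self_one (r : ℕ) :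
    triangleCoeff (r + 1) (r + 1) 1 = 1 / ((2 * r + 2) * (2 * r + 3) * (2 * r + 4)) := by
  unfold triangleCoeff
  rw [show r + 1 + (r + 1) - 1 = 2 * r + 1 by omega, show r + 1 + 1 - (r + 1) = 1 by omega,
    show r + 1 + (r + 1) + 1 + 1 = 2 * r + 1 + 1 + 1 + 1 by omega]
  have := Nat.factorial_pos (2 * r + 1)
  simp only [Nat.factorial_succ (2 * r + 1 + 1 + 1), Nat.factorial_succ (2 * r + 1 + 1),
    Nat.factorial_succ (2 * r + 1), Nat.factorial_one]
  push_cast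
  field_simp
  ring

theorem triangleCoeff_one_self (r : ℕ) :
    triangleCoeff (r + 1) 1 (r + 1) = 1 / ((2 * r + 2) * (2 * r + 3) * (2 * r + 4)) := by
  rw [← triangleCoeff_self_one]
  unfold triangleCoeff
  rw [show r + 1 + (r + 1) + 1 + 1 = r + 1 + 1 + (r + 1) + 1 by omega,
    show 1 + (r + 1) - (r + 1) = r + 1 + 1 - (r + 1) by omega]
  ring

theorem triangleCoeff_self_zero (p : ℕ) : triangleCoeff p p 0 = 1 / (2 * p + 1) := by
  unfold triangleCoeff
  rw [show p + p - 0 = 2 * p by omega, show p + 0 - p = 0 by omega,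
    show p + p + 0 + 1 = 2 * p + 1 by omega]
  have := Nat.factorial_pos (2 * p)
  simp only [Nat.factorial_succ (2 * p), Nat.factorial_zero]
  push_cast
  field_simp

theorem triangleCoeff_zero_self (p : ℕ) : triangleCoeff 0 p p = 1 / (2 * p + 1) := by
  rw [← triangleCoeff_self_zero]
  unfold triangleCoeff
  rw [show 0 + p + p + 1 = p + p + 0 + 1 by omega, show 0 + p - p = p + 0 - p by omega,
    show p + p - 0 = p + p by omega]
  ring

theorem triangleCoeff_self_two (r : ℕ) :
    triangleCoeff (r + 1) (r + 1) 2 = 4 * (2 * r).factorial / (2 * r + 5).factorial := by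
  unfold triangleCoeff
  rw [show r + 1 + (r + 1) - 2 = 2 * r by omega, show r + 1 + 2 - (r + 1) = 2 by omega,
    show r + 1 + (r + 1) + 2 + 1 = 2 * r + 5 by omega, Nat.factorial_two]
  push_cast; ring

theorem triangleCoeff_two_self (r : ℕ) :
    triangleCoeff 2 (r + 1) (r + 1) = 4 * (2 * r).factorial / (2 * r + 5).factorial := by
  unfold triangleCoeff
  rw [show r + 1 + (r + 1) - 2 = 2 * r by omega, show 2 + (r + 1) - (r + 1) = 2 by omega,
    show 2 + (r + 1) + (r + 1) + 1 = 2 * r + 5 by omega, Nat.factorial_two]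
  push_cast; ring

theorem wigner3j_self_zero (p : ℕ) : wigner3j p p 0 0 0 0 = (-1) ^ p * √(1 / (2 * p + 1)) := by
  unfold wigner3j
  rw [if_pos ⟨by norm_num, by simp, by simp, by simp, by unfold Triangle; omega⟩,
    triangleCoeff_self_zero, Finset.sum_eq_single p]
  · simp only [Nat.cast_zero, sub_self, add_zero, sub_zero, zero_sub, zero_add, neg_add_cancel,
      add_sub_cancel_right, invFact_zero, Int.toNat_natCast, Int.toNat_zero, Nat.factorial_zero,
      invFact_natCast, zpow_zero, Nat.cast_one, mul_one, one_mul]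
    have h := Nat.factorial_pos p
    rw [show ((p.factorial : ℝ) * p.factorial * p.factorial * p.factorial) =
      (p.factorial * p.factorial) ^ 2 by ring, Real.sqrt_sq (by positivity)]
    field_simp
  · intro t _ ht
    rcases lt_or_gt_of_ne ht with h | h
    · rw [invFact_of_neg (z := ((0 : ℕ) : ℤ) - p + t + 0) (by push_cast; omega)]; ring
    · rw [invFact_of_neg (z := (p : ℤ) - t - 0) (by omega)]; ring
  · intro h
    exact absurd (Finset.mem_range.2 (by omega)) h

/-- Only t = r-1, r, r+1 contribute. The first of them does not exist for r = 0, which is computed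
directly; otherwise r = s + 1 and `invFact_sub_one` gives the common factor. -/
theorem racah_sum_self_two (r : ℕ) :
    ∑ t ∈ Finset.range (r + 1 + (r + 1) + 1),
      (-1 : ℝ) ^ t * invFact t * invFact ((2 : ℕ) - (r + 1 : ℕ) + t + 0) *
        invFact ((2 : ℕ) - (r + 1 : ℕ) + t - 0) *
        invFact ((r + 1 : ℕ) + (r + 1 : ℕ) - (2 : ℕ) - t) * invFact ((r + 1 : ℕ) - t - 0) *
        invFact ((r + 1 : ℕ) - t + 0) =
      (-1) ^ r * ((r + 1) * (r + 2) / 2) * (invFact (r + 1 : ℕ)) ^ 2 := by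
  rcases r with _ | s
  · norm_num [Finset.sum_range_succ, invFact]
  rw [← Finset.sum_subset (s₁ := {s, s + 1, s + 2}), Finset.sum_insert (by simp),
    Finset.sum_pair (by omega)]
  · have d1 := invFact_sub_one (s + 2)
    have d2 := invFact_sub_one (s + 1)
    rw [show (s : ℤ) + 2 - 1 = s + 1 by ring] at d1
    rw [show (s : ℤ) + 1 - 1 = s by ring] at d2
    push_cast at d1 d2 ⊢
    rw [show (2 : ℤ) - (s + 1 + 1) + s + 0 = 0 by ring, show (2 : ℤ) - (s + 1 + 1) + s - 0 = 0 by ring,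
      show (s : ℤ) + 1 + 1 + (s + 1 + 1) - 2 - s = s + 2 by ring,
      show (s : ℤ) + 1 + 1 - s - 0 = 2 by ring, show (s : ℤ) + 1 + 1 - s + 0 = 2 by ring,
      show (2 : ℤ) - (s + 1 + 1) + (s + 1) + 0 = 1 by ring,
      show (2 : ℤ) - (s + 1 + 1) + (s + 1) - 0 = 1 by ring,
      show (s : ℤ) + 1 + 1 + (s + 1 + 1) - 2 - (s + 1) = s + 1 by ring,
      show (s : ℤ) + 1 + 1 - (s + 1) - 0 = 1 by ring, show (s : ℤ) + 1 + 1 - (s + 1) + 0 = 1 by ring,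
      show (2 : ℤ) - (s + 1 + 1) + (s + 2) + 0 = 2 by ring,
      show (2 : ℤ) - (s + 1 + 1) + (s + 2) - 0 = 2 by ring,
      show (s : ℤ) + 1 + 1 + (s + 1 + 1) - 2 - (s + 2) = s by ring,
      show (s : ℤ) + 1 + 1 - (s + 2) - 0 = 0 by ring, show (s : ℤ) + 1 + 1 - (s + 2) + 0 = 0 by ring,
      show (s : ℤ) + 1 + 1 = s + 2 by ring, d2, d1, invFact_zero, invFact_one, invFact_two]
    ring
  · intro t ht
    simp only [Finset.mem_insert, Finset.mem_singleton] at ht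
    exact Finset.mem_range.2 (by omega)
  · intro t _ ht
    simp only [Finset.mem_insert, Finset.mem_singleton] at ht
    rcases lt_or_ge t s with h1 | h1
    · rw [invFact_of_neg (z := ((2 : ℕ) : ℤ) - (s + 1 + 1 : ℕ) + t + 0) (by push_cast; omega)]
      ring
    · rw [invFact_of_neg (z := ((s + 1 + 1 : ℕ) : ℤ) - t + 0) (by push_cast; omega)]
      ring

theorem wigner3j_self_two (r : ℕ) : wigner3j (r + 1) (r + 1) 2 0 0 0 =
    (-1) ^ r * ((r + 1) * (r + 2)) * √(4 * (2 * r).factorial / (2 * r + 5).factorial) := by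
  unfold wigner3j
  rw [if_pos ⟨by norm_num, by simp; positivity, by simp; positivity, by simp,
    by unfold Triangle; omega⟩, triangleCoeff_self_two, racah_sum_self_two, invFact_natCast]
  have h := Nat.factorial_pos (r + 1)
  simp only [add_zero, sub_zero, sub_self, zpow_zero, Int.toNat_natCast, one_mul,
    Nat.cast_ofNat, show Int.toNat 2 = 2 from rfl, Nat.factorial_two]
  rw [show ((r + 1).factorial : ℝ) * (r + 1).factorial * (r + 1).factorial * (r + 1).factorial *
    2 * 2 = (2 * ((r + 1).factorial * (r + 1).factorial)) ^ 2 by ring, Real.sqrt_sq (by positivity)]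
  field_simp

/-- Again the parity rule: the sum of the degrees is odd, and the two surviving terms cancel. With
its mirror image below, this confines α⁽³⁾ to m = p. -/
theorem wigner3j_up_two (p : ℕ) : wigner3j p (p + 1) 2 0 0 0 = 0 := by
  unfold wigner3j
  split_ifs with h
  · obtain ⟨-, -, -, -, h⟩ := h
    have hp : 1 ≤ p := by unfold Triangle at h; omega
    obtain ⟨r, rfl⟩ : ∃ r, p = r + 1 := ⟨p - 1, by omega⟩
    refine mul_eq_zero_of_right _ ?_
    rw [← Finset.sum_subset (s₁ := {r, r + 1}), Finset.sum_pair (by omega)]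
    · have e1 : ((2 : ℕ) : ℤ) - (r + 1 + 1 : ℕ) + r + 0 = 0 := by push_cast; ring
      have e2 : ((2 : ℕ) : ℤ) - (r + 1 + 1 : ℕ) + (r + 1 : ℕ) + 0 = 1 := by push_cast; ring
      have e3 : ((2 : ℕ) : ℤ) - (r + 1 : ℕ) + r - 0 = 1 := by push_cast; ring
      have e4 : ((2 : ℕ) : ℤ) - (r + 1 : ℕ) + (r + 1 : ℕ) - 0 = 2 := by push_cast; ring
      have e5 : ((r + 1 : ℕ) : ℤ) + (r + 1 + 1 : ℕ) - (2 : ℕ) - r = r + 1 := by push_cast; ring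
      have e6 : ((r + 1 : ℕ) : ℤ) + (r + 1 + 1 : ℕ) - (2 : ℕ) - (r + 1 : ℕ) = r := by
        push_cast; ring
      have e7 : ((r + 1 : ℕ) : ℤ) - r - 0 = 1 := by push_cast; ring
      have e8 : ((r + 1 : ℕ) : ℤ) - (r + 1 : ℕ) - 0 = 0 := by push_cast; ring
      have e9 : ((r + 1 + 1 : ℕ) : ℤ) - r + 0 = 2 := by push_cast; ring
      have e10 : ((r + 1 + 1 : ℕ) : ℤ) - (r + 1 : ℕ) + 0 = 1 := by push_cast; ring
      rw [e1, e2, e3, e4, e5, e6, e7, e8, e9, e10, invFact_zero, invFact_one]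
      push_cast
      ring
    · intro t ht
      simp only [Finset.mem_insert, Finset.mem_singleton] at ht
      exact Finset.mem_range.2 (by omega)
    · intro t _ ht
      simp only [Finset.mem_insert, Finset.mem_singleton] at ht
      rcases lt_or_ge t r with h1 | h1
      · rw [invFact_of_neg (z := ((2 : ℕ) : ℤ) - (r + 1 + 1 : ℕ) + t + 0) (by push_cast; omega)]
        ring
      · rw [invFact_of_neg (z := ((r + 1 : ℕ) : ℤ) - t - 0) (by push_cast; omega)]
        ring
  · rfl

theorem wigner3j_down_two (p : ℕ) : wigner3j (p + 1) p 2 0 0 0 = 0 := by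
  unfold wigner3j
  split_ifs with h
  · obtain ⟨-, -, -, -, h⟩ := h
    have hp : 1 ≤ p := by unfold Triangle at h; omega
    obtain ⟨r, rfl⟩ : ∃ r, p = r + 1 := ⟨p - 1, by omega⟩
    refine mul_eq_zero_of_right _ ?_
    rw [← Finset.sum_subset (s₁ := {r, r + 1}), Finset.sum_pair (by omega)]
    · have e1 : ((2 : ℕ) : ℤ) - (r + 1 + 1 : ℕ) + r - 0 = 0 := by push_cast; ring
      have e2 : ((2 : ℕ) : ℤ) - (r + 1 + 1 : ℕ) + (r + 1 : ℕ) - 0 = 1 := by push_cast; ring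
      have e3 : ((2 : ℕ) : ℤ) - (r + 1 : ℕ) + r + 0 = 1 := by push_cast; ring
      have e4 : ((2 : ℕ) : ℤ) - (r + 1 : ℕ) + (r + 1 : ℕ) + 0 = 2 := by push_cast; ring
      have e5 : ((r + 1 + 1 : ℕ) : ℤ) + (r + 1 : ℕ) - (2 : ℕ) - r = r + 1 := by push_cast; ring
      have e6 : ((r + 1 + 1 : ℕ) : ℤ) + (r + 1 : ℕ) - (2 : ℕ) - (r + 1 : ℕ) = r := by
        push_cast; ring
      have e7 : ((r + 1 : ℕ) : ℤ) - r + 0 = 1 := by push_cast; ring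
      have e8 : ((r + 1 : ℕ) : ℤ) - (r + 1 : ℕ) + 0 = 0 := by push_cast; ring
      have e9 : ((r + 1 + 1 : ℕ) : ℤ) - r - 0 = 2 := by push_cast; ring
      have e10 : ((r + 1 + 1 : ℕ) : ℤ) - (r + 1 : ℕ) - 0 = 1 := by push_cast; ring
      rw [e1, e2, e3, e4, e5, e6, e7, e8, e9, e10, invFact_zero, invFact_one]
      push_cast
      ring
    · intro t ht
      simp only [Finset.mem_insert, Finset.mem_singleton] at ht
      exact Finset.mem_range.2 (by omega)
    · intro t _ ht
      simp only [Finset.mem_insert, Finset.mem_singleton] at ht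
      rcases lt_or_ge t r with h1 | h1
      · rw [invFact_of_neg (z := ((2 : ℕ) : ℤ) - (r + 1 + 1 : ℕ) + t - 0) (by push_cast; omega)]
        ring
      · rw [invFact_of_neg (z := ((r + 1 : ℕ) : ℤ) - t + 0) (by push_cast; omega)]
        ring
  · rfl

/-- The lower bound j₁ + j₂ + j₃ and the upper bound j₁ + j₂ + j₄ + j₅ for t coincide at 2r + 3, so
Racah's sum is one term. -/
theorem wigner6j_zero (r : ℕ) :
    wigner6j (r + 1) (r + 1) 1 0 1 (r + 1) = -√(1 / (3 * (2 * r + 3))) := by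
  unfold wigner6j
  rw [if_pos (by unfold Triangle; omega), triangleCoeff_self_one, triangleCoeff_one_self,
    triangleCoeff_zero_self, Finset.sum_eq_single (2 * r + 3)]
  · have e1 : ((2 * r + 3 : ℕ) : ℤ) - (r + 1 : ℕ) - (r + 1 : ℕ) - (1 : ℕ) = 0 := by push_cast; ring
    have e2 : ((2 * r + 3 : ℕ) : ℤ) - (r + 1 : ℕ) - (1 : ℕ) - (r + 1 : ℕ) = 0 := by push_cast; ring
    have e3 : ((2 * r + 3 : ℕ) : ℤ) - (0 : ℕ) - (r + 1 : ℕ) - (r + 1 : ℕ) = 1 := by push_cast; ring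
    have e4 : ((2 * r + 3 : ℕ) : ℤ) - (0 : ℕ) - (1 : ℕ) - (1 : ℕ) = (2 * r + 1 : ℕ) := by
      push_cast; ring
    have e5 : ((r + 1 : ℕ) : ℤ) + (r + 1 : ℕ) + (0 : ℕ) + (1 : ℕ) - (2 * r + 3 : ℕ) = 0 := by
      push_cast; ring
    have e6 : ((r + 1 : ℕ) : ℤ) + (1 : ℕ) + (1 : ℕ) + (r + 1 : ℕ) - (2 * r + 3 : ℕ) = 1 := by
      push_cast; ring
    have e7 : ((1 : ℕ) : ℤ) + (r + 1 : ℕ) + (r + 1 : ℕ) + (0 : ℕ) - (2 * r + 3 : ℕ) = 0 := by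
      push_cast; ring
    rw [e1, e2, e3, e4, e5, e6, e7, invFact_zero, invFact_one, invFact_natCast,
      show triangleCoeff 0 1 1 = 1 / 3 by norm_num [triangleCoeff, Nat.factorial],
      show 2 * r + 3 + 1 = 2 * r + 1 + 1 + 1 + 1 by omega]
    have := Nat.factorial_pos (2 * r + 1)
    simp only [Nat.factorial_succ (2 * r + 1 + 1 + 1), Nat.factorial_succ (2 * r + 1 + 1),
      Nat.factorial_succ (2 * r + 1)]
    rw [show ∀ x y z : ℝ, x * x * y * z = x ^ 2 * (y * z) by intros; ring,
      Real.sqrt_mul (by positivity), Real.sqrt_sq (by positivity), Odd.neg_one_pow ⟨r + 1, by ring⟩]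
    push_cast
    rw [show (1 / (2 * ((r : ℝ) + 1) + 1) * (1 / 3)) = 1 / (3 * (2 * r + 3)) by
      rw [← one_div_mul_one_div]; ring]
    field_simp
    ring
  · intro t ht ht'
    rcases lt_or_gt_of_ne ht' with h | h
    · rw [invFact_of_neg (z := (t : ℤ) - (r + 1 : ℕ) - (r + 1 : ℕ) - (1 : ℕ)) (by push_cast; omega)]
      ring
    · rw [Finset.mem_range] at ht; omega
  · intro h
    exact absurd (Finset.mem_range.2 (by omega)) h

/-- Here the bounds j₄ + j₂ + j₆ ≤ t ≤ j₂ + j₃ + j₅ + j₆ coincide at 2r + 4. -/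
theorem wigner6j_two (r : ℕ) :
    wigner6j (r + 1) (r + 1) 1 2 1 (r + 1) =
      1 / ((2 * r + 2) * (2 * r + 3) * (2 * r + 4)) *
        √(4 * (2 * r).factorial / (2 * r + 5).factorial / 30) *
          ((2 * r + 5).factorial / (2 * r).factorial) := by
  unfold wigner6j
  rw [if_pos (by unfold Triangle; omega), triangleCoeff_self_one, triangleCoeff_one_self,
    triangleCoeff_two_self, Finset.sum_eq_single (2 * r + 4)]
  · have e1 : ((2 * r + 4 : ℕ) : ℤ) - (r + 1 : ℕ) - (r + 1 : ℕ) - (1 : ℕ) = 1 := by push_cast; ring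
    have e2 : ((2 * r + 4 : ℕ) : ℤ) - (r + 1 : ℕ) - (1 : ℕ) - (r + 1 : ℕ) = 1 := by push_cast; ring
    have e3 : ((2 * r + 4 : ℕ) : ℤ) - (2 : ℕ) - (r + 1 : ℕ) - (r + 1 : ℕ) = 0 := by push_cast; ring
    have e4 : ((2 * r + 4 : ℕ) : ℤ) - (2 : ℕ) - (1 : ℕ) - (1 : ℕ) = (2 * r : ℕ) := by
      push_cast; ring
    have e5 : ((r + 1 : ℕ) : ℤ) + (r + 1 : ℕ) + (2 : ℕ) + (1 : ℕ) - (2 * r + 4 : ℕ) = 1 := by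
      push_cast; ring
    have e6 : ((r + 1 : ℕ) : ℤ) + (1 : ℕ) + (1 : ℕ) + (r + 1 : ℕ) - (2 * r + 4 : ℕ) = 0 := by
      push_cast; ring
    have e7 : ((1 : ℕ) : ℤ) + (r + 1 : ℕ) + (r + 1 : ℕ) + (2 : ℕ) - (2 * r + 4 : ℕ) = 1 := by
      push_cast; ring
    rw [e1, e2, e3, e4, e5, e6, e7, invFact_zero, invFact_one, invFact_natCast,
      show triangleCoeff 2 1 1 = 1 / 30 by norm_num [triangleCoeff, Nat.factorial],
      show ∀ x y z : ℝ, x * x * y * z = x ^ 2 * (y * z) by intros; ring,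
      Real.sqrt_mul (by positivity), Real.sqrt_sq (by positivity), Even.neg_one_pow ⟨r + 2, by ring⟩,
      mul_one_div]
    ring
  · intro t ht ht'
    rcases lt_or_gt_of_ne ht' with h | h
    · rw [invFact_of_neg (z := (t : ℤ) - (2 : ℕ) - (r + 1 : ℕ) - (r + 1 : ℕ)) (by push_cast; omega)]
      ring
    · rw [invFact_of_neg (z := ((r + 1 : ℕ) : ℤ) + (1 : ℕ) + (1 : ℕ) + (r + 1 : ℕ) - t)
        (by push_cast; omega)]
      ring
  · intro h
    exact absurd (Finset.mem_range.2 (by omega)) h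


/-- The first product is (-1)^r / (√3 (2r+3)). In the second one the factorials cancel and half of
the first remains. -/
theorem wigner_bracket (r : ℕ) :
    wigner6j (r + 1) (r + 1) 1 0 1 (r + 1) * wigner3j (r + 1) (r + 1) 0 0 0 0 +
      √(5 / 2) * wigner6j (r + 1) (r + 1) 1 2 1 (r + 1) * wigner3j (r + 1) (r + 1) 2 0 0 0 =
    (-1) ^ r * √3 / (2 * (2 * r + 3)) := by
  rw [wigner6j_zero, wigner3j_self_zero, wigner6j_two, wigner3j_self_two]
  have hx : (0 : ℝ) < 4 * (2 * r).factorial / (2 * r + 5).factorial := by positivity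
  have h0 := Nat.factorial_pos (2 * r)
  have h5 := Nat.factorial_pos (2 * r + 5)
  have hs : √3 ^ 2 = (3 : ℝ) := Real.sq_sqrt (by norm_num)
  have h1 : √(1 / (3 * (2 * r + 3)) : ℝ) * √(1 / (2 * (r + 1 : ℕ) + 1)) =
      1 / (√3 * (2 * r + 3)) := by
    rw [← Real.sqrt_mul (by positivity), show (1 / (3 * (2 * r + 3)) : ℝ) *
      (1 / (2 * (r + 1 : ℕ) + 1)) = (1 / (2 * r + 3)) ^ 2 / 3 by push_cast; field_simp; ring,
      Real.sqrt_div (by positivity), Real.sqrt_sq (by positivity)]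
    field_simp
  have h2 : √(5 / 2) * √(4 * (2 * r).factorial / (2 * r + 5).factorial / 30 : ℝ) *
      √(4 * (2 * r).factorial / (2 * r + 5).factorial) =
      4 * (2 * r).factorial / (2 * r + 5).factorial / (2 * √3) := by
    rw [← Real.sqrt_mul (by positivity), ← Real.sqrt_mul (by positivity),
      show (5 / 2 * (4 * (2 * r).factorial / (2 * r + 5).factorial / 30) *
        (4 * (2 * r).factorial / (2 * r + 5).factorial) : ℝ) =
        (4 * (2 * r).factorial / (2 * r + 5).factorial / 2) ^ 2 / 3 by ring,
      Real.sqrt_div (by positivity), Real.sqrt_sq (by positivity)]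
    field_simp
  calc _ = (-1) ^ r * (√(1 / (3 * (2 * r + 3)) : ℝ) * √(1 / (2 * (r + 1 : ℕ) + 1))) +
      (√(5 / 2) * √(4 * (2 * r).factorial / (2 * r + 5).factorial / 30 : ℝ) *
      √(4 * (2 * r).factorial / (2 * r + 5).factorial)) * ((-1) ^ r *
        (1 / ((2 * r + 2) * (2 * r + 3) * (2 * r + 4)) * ((2 * r + 5).factorial / (2 * r).factorial)
          * ((r + 1) * (r + 2)))) := by push_cast; ring
    _ = _ := by
      rw [h1, h2]
      have : (0 : ℝ) < √3 := by positivity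
      field_simp
      rw [hs]
      ring

/-- With a = r+1+q and b = r+1-q, the terms t = a and t = a-1 carry the weights b and -a relative to
a common factor, whence b - a = -2q. -/
theorem wigner3j_self_one_zero {r : ℕ} {q : ℤ} (hq : |q| ≤ r + 1) :
    wigner3j (r + 1) (r + 1) 1 (-q) q 0 =
      (-1) ^ (r + q) * (2 * q) * √(1 / ((2 * r + 2) * (2 * r + 3) * (2 * r + 4))) := by
  unfold wigner3j
  rw [if_pos ⟨by ring, by rw [abs_neg]; exact_mod_cast hq, by exact_mod_cast hq, by simp,
    by unfold Triangle; omega⟩, triangleCoeff_self_one]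
  rw [abs_le] at hq
  obtain ⟨a, ha⟩ : ∃ a : ℕ, (a : ℤ) = r + 1 + q := ⟨(r + 1 + q).toNat, by omega⟩
  obtain ⟨b, hb⟩ : ∃ b : ℕ, (b : ℤ) = r + 1 - q := ⟨(r + 1 - q).toNat, by omega⟩
  have hsum : ∑ t ∈ Finset.range (r + 1 + (r + 1) + 1),
      (-1 : ℝ) ^ t * invFact t * invFact ((1 : ℕ) - (r + 1 : ℕ) + t + -q) *
        invFact ((1 : ℕ) - (r + 1 : ℕ) + t - q) *
        invFact ((r + 1 : ℕ) + (r + 1 : ℕ) - (1 : ℕ) - t) * invFact ((r + 1 : ℕ) - t - -q) *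
        invFact ((r + 1 : ℕ) - t + q) = (-1) ^ a * (b - a) * (invFact a * invFact b) := by
    have hoff : ∀ t : ℕ, t ≠ a → t + 1 ≠ a →
      (-1 : ℝ) ^ t * invFact t * invFact ((1 : ℕ) - (r + 1 : ℕ) + t + -q) *
        invFact ((1 : ℕ) - (r + 1 : ℕ) + t - q) *
        invFact ((r + 1 : ℕ) + (r + 1 : ℕ) - (1 : ℕ) - t) * invFact ((r + 1 : ℕ) - t - -q) *
        invFact ((r + 1 : ℕ) - t + q) = 0 := by
      intro t h1 h2
      rcases lt_or_ge t a with h | h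
      · rw [invFact_of_neg (z := ((1 : ℕ) : ℤ) - (r + 1 : ℕ) + t - q) (by push_cast; omega)]
        ring
      · rw [invFact_of_neg (z := ((r + 1 : ℕ) : ℤ) - t + q) (by push_cast; omega)]
        ring
    have hb1 := invFact_sub_one b
    have ht1 : (-1 : ℝ) ^ a * invFact a * invFact ((1 : ℕ) - (r + 1 : ℕ) + a + -q) *
        invFact ((1 : ℕ) - (r + 1 : ℕ) + a - q) *
        invFact ((r + 1 : ℕ) + (r + 1 : ℕ) - (1 : ℕ) - a) * invFact ((r + 1 : ℕ) - a - -q) *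
        invFact ((r + 1 : ℕ) - a + q) = (-1) ^ a * b * (invFact a * invFact b) := by
      rw [show ((1 : ℕ) : ℤ) - (r + 1 : ℕ) + a + -q = 1 by push_cast; omega,
        show ((1 : ℕ) : ℤ) - (r + 1 : ℕ) + a - q = 1 by push_cast; omega,
        show ((r + 1 : ℕ) : ℤ) + (r + 1 : ℕ) - (1 : ℕ) - a = b - 1 by push_cast; omega,
        show ((r + 1 : ℕ) : ℤ) - a - -q = 0 by push_cast; omega,
        show ((r + 1 : ℕ) : ℤ) - a + q = 0 by push_cast; omega, hb1, invFact_zero, invFact_one]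
      push_cast
      ring
    -- For a = 0 the term t = a - 1 is absent, in agreement with its weight -a.
    rcases a with _ | c
    · rw [Finset.sum_eq_single 0 (fun t _ h => hoff t h (by omega))
        (fun h => absurd (Finset.mem_range.2 (by omega)) h), ht1]
      push_cast; ring
    · rw [← Finset.sum_subset (s₁ := {c, c + 1}), Finset.sum_pair (by omega), ht1]
      · have ha1 := invFact_sub_one (c + 1 : ℕ)
        rw [show ((c + 1 : ℕ) : ℤ) - 1 = c by push_cast; ring] at ha1
        push_cast at ha hb
        rw [show ((1 : ℕ) : ℤ) - (r + 1 : ℕ) + c + -q = 0 by push_cast; omega,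
          show ((1 : ℕ) : ℤ) - (r + 1 : ℕ) + c - q = 0 by push_cast; omega,
          show ((r + 1 : ℕ) : ℤ) + (r + 1 : ℕ) - (1 : ℕ) - c = b by push_cast; omega,
          show ((r + 1 : ℕ) : ℤ) - c - -q = 1 by push_cast; omega,
          show ((r + 1 : ℕ) : ℤ) - c + q = 1 by push_cast; omega, ha1, invFact_zero, invFact_one]
        push_cast
        ring
      · intro t ht
        simp only [Finset.mem_insert, Finset.mem_singleton] at ht
        exact Finset.mem_range.2 (by push_cast at ha; omega)
      · intro t _ ht
        simp only [Finset.mem_insert, Finset.mem_singleton] at ht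
        exact hoff t (by omega) (by omega)
  rw [hsum, invFact_natCast, invFact_natCast,
    show (((r + 1 : ℕ) : ℤ) + -q).toNat = b by push_cast; omega,
    show (((r + 1 : ℕ) : ℤ) - -q).toNat = a by push_cast; omega,
    show (((r + 1 : ℕ) : ℤ) + q).toNat = a by push_cast; omega,
    show (((r + 1 : ℕ) : ℤ) - q).toNat = b by push_cast; omega]
  have h1 := Nat.factorial_pos a
  have h2 := Nat.factorial_pos b
  have hs : (-1 : ℝ) ^ (r + q) = -(-1) ^ a := by
    rw [← zpow_natCast]
    exact neg_one_zpow_eq_neg (by rw [Int.odd_iff]; omega)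
  have hq2 : (2 * q : ℝ) = a - b := by
    exact_mod_cast (show 2 * q = (a : ℤ) - b by omega)
  rw [hs, hq2]
  simp only [sub_self, zpow_zero, add_zero, sub_zero, Int.toNat_natCast, Nat.cast_one, Int.toNat_one,
    Nat.factorial_one, mul_one, one_mul]
  rw [show (b.factorial : ℝ) * a.factorial * a.factorial * b.factorial =
    (a.factorial * b.factorial) ^ 2 by ring, Real.sqrt_sq (by positivity)]
  field_simp
  ring

/-- The third order is extreme, so a single term of Racah's sum survives; the leftover factorial
quotient is the radicand of the ladder coefficient. -/
theorem wigner3j_self_one_succ {r : ℕ} {q : ℤ} (hq : |q| ≤ r + 1) (hl : |q + 1| ≤ r + 1) :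
    wigner3j (r + 1) (r + 1) 1 (-q) (q + 1) (-1) =
      (-1) ^ (r + q) * (√2 * coeffL (r + 1) q) *
        √(1 / ((2 * r + 2) * (2 * r + 3) * (2 * r + 4))) := by
  unfold wigner3j
  rw [if_pos ⟨by ring, by rw [abs_neg]; exact_mod_cast hq, by exact_mod_cast hl, by simp,
    by unfold Triangle; omega⟩, triangleCoeff_self_one]
  rw [abs_le] at hq hl
  obtain ⟨a, ha⟩ : ∃ a : ℕ, (a : ℤ) = r + 1 + q := ⟨(r + 1 + q).toNat, by omega⟩
  obtain ⟨b, hb⟩ : ∃ b : ℕ, (b : ℤ) = r - q := ⟨(r - q).toNat, by omega⟩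
  rw [Finset.sum_eq_single a]
  · rw [show ((1 : ℕ) : ℤ) - (r + 1 : ℕ) + a + -q = 1 by push_cast; omega,
      show ((1 : ℕ) : ℤ) - (r + 1 : ℕ) + a - (q + 1) = 0 by push_cast; omega,
      show ((r + 1 : ℕ) : ℤ) + (r + 1 : ℕ) - (1 : ℕ) - a = b by push_cast; omega,
      show ((r + 1 : ℕ) : ℤ) - a - -q = 0 by push_cast; omega,
      show ((r + 1 : ℕ) : ℤ) - a + (q + 1) = 1 by push_cast; omega,
      show (((r + 1 : ℕ) : ℤ) + -q).toNat = b + 1 by push_cast; omega,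
      show (((r + 1 : ℕ) : ℤ) - -q).toNat = a by push_cast; omega,
      show (((r + 1 : ℕ) : ℤ) + (q + 1)).toNat = a + 1 by push_cast; omega,
      show (((r + 1 : ℕ) : ℤ) - (q + 1)).toNat = b by push_cast; omega,
      show (((1 : ℕ) : ℤ) + -1).toNat = 0 by rfl, show (((1 : ℕ) : ℤ) - -1).toNat = 2 by rfl,
      invFact_natCast, invFact_natCast, invFact_one, invFact_zero, Nat.factorial_succ,
      Nat.factorial_succ a]
    have h1 := Nat.factorial_pos a
    have h2 := Nat.factorial_pos b
    have hs : (-1 : ℝ) ^ (r + q) =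
        (-1) ^ (((r + 1 : ℕ) : ℤ) - ((r + 1 : ℕ) : ℤ) - -1) * (-1) ^ a := by
      rw [← zpow_natCast, ← zpow_add₀ (by norm_num)]
      exact neg_one_zpow_congr (by rw [Int.even_iff]; omega)
    have ha' : (a : ℝ) = r + 1 + q := by exact_mod_cast ha
    have hb' : (b : ℝ) = r - q := by exact_mod_cast hb
    rw [hs, coeffL, ← Real.sqrt_mul (by norm_num),
      show (2 : ℝ) * ((((r + 1 : ℕ) : ℝ) - q) * ((r + 1 : ℕ) + q + 1)) = 2 * ((b + 1) * (a + 1)) by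
        rw [ha', hb']; push_cast; ring]
    simp only [Nat.factorial_zero, Nat.factorial_two, Nat.cast_mul, Nat.cast_add, Nat.cast_one,
      Nat.cast_two]
    rw [show ((b : ℝ) + 1) * b.factorial * a.factorial * ((a + 1) * a.factorial) * b.factorial *
      1 * 2 = (a.factorial * b.factorial) ^ 2 * (2 * ((b + 1) * (a + 1))) by ring,
      Real.sqrt_mul (by positivity), Real.sqrt_sq (by positivity)]
    field_simp
  · intro t _ ht
    rcases lt_or_gt_of_ne ht with h | h
    · rw [invFact_of_neg (z := ((1 : ℕ) : ℤ) - (r + 1 : ℕ) + t - (q + 1)) (by push_cast; omega)]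
      ring
    · rw [invFact_of_neg (z := ((r + 1 : ℕ) : ℤ) - t - -q) (by push_cast; omega)]
      ring
  · intro h
    exact absurd (Finset.mem_range.2 (by omega)) h

theorem wigner3j_self_one_pred {r : ℕ} {q : ℤ} (hq : |q| ≤ r + 1) (hl : |q - 1| ≤ r + 1) :
    wigner3j (r + 1) (r + 1) 1 (-q) (q - 1) 1 =
      (-1) ^ (r + q) * (-(√2 * coeffL (r + 1) (-q))) *
        √(1 / ((2 * r + 2) * (2 * r + 3) * (2 * r + 4))) := by
  unfold wigner3j
  rw [if_pos ⟨by ring, by rw [abs_neg]; exact_mod_cast hq, by exact_mod_cast hl, by simp,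
    by unfold Triangle; omega⟩, triangleCoeff_self_one]
  rw [abs_le] at hq hl
  obtain ⟨a, ha⟩ : ∃ a : ℕ, (a : ℤ) = r + q := ⟨(r + q).toNat, by omega⟩
  obtain ⟨b, hb⟩ : ∃ b : ℕ, (b : ℤ) = r + 1 - q := ⟨(r + 1 - q).toNat, by omega⟩
  rw [Finset.sum_eq_single a]
  · rw [show ((1 : ℕ) : ℤ) - (r + 1 : ℕ) + a + -q = 0 by push_cast; omega,
      show ((1 : ℕ) : ℤ) - (r + 1 : ℕ) + a - (q - 1) = 1 by push_cast; omega,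
      show ((r + 1 : ℕ) : ℤ) + (r + 1 : ℕ) - (1 : ℕ) - a = b by push_cast; omega,
      show ((r + 1 : ℕ) : ℤ) - a - -q = 1 by push_cast; omega,
      show ((r + 1 : ℕ) : ℤ) - a + (q - 1) = 0 by push_cast; omega,
      show (((r + 1 : ℕ) : ℤ) + -q).toNat = b by push_cast; omega,
      show (((r + 1 : ℕ) : ℤ) - -q).toNat = a + 1 by push_cast; omega,
      show (((r + 1 : ℕ) : ℤ) + (q - 1)).toNat = a by push_cast; omega,
      show (((r + 1 : ℕ) : ℤ) - (q - 1)).toNat = b + 1 by push_cast; omega,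
      show (((1 : ℕ) : ℤ) - 1).toNat = 0 by rfl, show (((1 : ℕ) : ℤ) + 1).toNat = 2 by rfl,
      invFact_natCast, invFact_natCast, invFact_one, invFact_zero, Nat.factorial_succ,
      Nat.factorial_succ b]
    have h1 := Nat.factorial_pos a
    have h2 := Nat.factorial_pos b
    have hs : (-1 : ℝ) ^ (r + q) =
        -((-1) ^ (((r + 1 : ℕ) : ℤ) - ((r + 1 : ℕ) : ℤ) - 1) * (-1) ^ a) := by
      rw [← zpow_natCast, ← zpow_add₀ (by norm_num)]
      exact neg_one_zpow_eq_neg (by rw [Int.odd_iff]; omega)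
    have ha' : (a : ℝ) = r + q := by exact_mod_cast ha
    have hb' : (b : ℝ) = r + 1 - q := by exact_mod_cast hb
    rw [hs, coeffL_neg, ← Real.sqrt_mul (by norm_num),
      show (2 : ℝ) * ((((r + 1 : ℕ) : ℝ) + q) * ((r + 1 : ℕ) - q + 1)) = 2 * ((b + 1) * (a + 1)) by
        rw [ha', hb']; push_cast; ring]
    simp only [Nat.factorial_zero, Nat.factorial_two, Nat.cast_mul, Nat.cast_add, Nat.cast_one,
      Nat.cast_two]
    rw [show (b.factorial : ℝ) * ((a + 1) * a.factorial) * a.factorial * ((b + 1) * b.factorial) *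
      2 * 1 = (a.factorial * b.factorial) ^ 2 * (2 * ((b + 1) * (a + 1))) by ring,
      Real.sqrt_mul (by positivity), Real.sqrt_sq (by positivity)]
    field_simp
  · intro t _ ht
    rcases lt_or_gt_of_ne ht with h | h
    · rw [invFact_of_neg (z := ((1 : ℕ) : ℤ) - (r + 1 : ℕ) + t + -q) (by push_cast; omega)]
      ring
    · rw [invFact_of_neg (z := ((r + 1 : ℕ) : ℤ) - t + (q - 1)) (by push_cast; omega)]
      ring
  · intro h
    exact absurd (Finset.mem_range.2 (by omega)) h

/-! ### Closed forms of `α⁽³⁾` -/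

theorem wigner3j_zero_of_ne {p m : ℕ} (h : p ≠ m) (a b c : ℤ) : wigner3j p m 0 a b c = 0 := by
  unfold wigner3j
  rw [if_neg]
  rintro ⟨-, -, -, -, h'⟩
  unfold Triangle at h'
  omega

theorem alpha3_up (p : ℕ) (q l : ℤ) : alpha3 p q (p + 1) l = 0 := by
  simp [alpha3, wigner3j_zero_of_ne (show p ≠ p + 1 by omega), wigner3j_up_two]

theorem alpha3_down (p : ℕ) (q l : ℤ) : alpha3 (p + 1) q p l = 0 := by
  simp [alpha3, wigner3j_zero_of_ne (show p + 1 ≠ p by omega), wigner3j_down_two]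

/-- X stands for the part of the 3j symbol that depends on the orders; all else is common to the
three values of l. The last radical is the normalization of type (3) at degree r + 1. -/
theorem alpha3_self {r : ℕ} {q l : ℤ} {X : ℝ}
    (h : wigner3j (r + 1) (r + 1) 1 (-q) l (kIndex l q) = (-1) ^ (r + q) * X *
      √(1 / ((2 * r + 2) * (2 * r + 3) * (2 * r + 4)))) :
    alpha3 (r + 1) q (r + 1) l =
      Complex.I * ((X / 4 * √(3 / (4 * Real.pi)) * (√((r + 1) * (r + 2)))⁻¹ : ℝ) : ℂ) := by
  unfold alpha3
  rw [wigner_bracket, h]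
  congr 2
  have hs : (-1 : ℝ) ^ q * (-1) ^ (r + q) * (-1) ^ r = 1 := by
    rw [← zpow_natCast, ← zpow_add₀ (by norm_num), ← zpow_add₀ (by norm_num),
      ← zpow_zero (-1 : ℝ)]
    exact neg_one_zpow_congr (by rw [Int.even_iff]; omega)
  have h1 : √((2 * (r + 1 : ℕ) + 1) / (4 * Real.pi)) * √3 *
      √(1 / ((2 * r + 2) * (2 * r + 3) * (2 * r + 4))) =
      √(3 / (4 * Real.pi)) * (√((r + 1) * (r + 2)))⁻¹ / 2 := by
    rw [← Real.sqrt_mul (by positivity), ← Real.sqrt_mul (by positivity), ← Real.sqrt_inv,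
      ← Real.sqrt_mul (by positivity)]
    rw [show √(3 / (4 * Real.pi) * (((r : ℝ) + 1) * (r + 2))⁻¹) / 2 =
      √(3 / (4 * Real.pi) * (((r : ℝ) + 1) * (r + 2))⁻¹ / 2 ^ 2) by
        rw [Real.sqrt_div (by positivity), Real.sqrt_sq (by norm_num)]]
    congr 1
    have := Real.pi_pos
    push_cast
    field_simp
    ring
  have h2 : (2 * ((r + 1 : ℕ) : ℝ) + 1) = 2 * r + 3 := by push_cast; ring
  calc _ = ((-1 : ℝ) ^ q * (-1) ^ (r + q) * (-1) ^ r) * ((2 * ((r + 1 : ℕ) : ℝ) + 1) /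
        (2 * (2 * r + 3))) * X * (√((2 * (r + 1 : ℕ) + 1) / (4 * Real.pi)) * √3 *
      √(1 / ((2 * r + 2) * (2 * r + 3) * (2 * r + 4)))) := by ring
    _ = _ := by
      rw [hs, h1, h2]
      field_simp
      ring

/-! ### Pointwise expansion of the dipole field -/

theorem sphHarm_one_zero (d : S2) : sphHarm 1 0 d = ((√(3 / (4 * Real.pi)) * (d : E3) 2 : ℝ) : ℂ) := by
  have := sphHarm_natCast (n := 1) (k := 0) (by omega) d
  rw [Nat.cast_zero] at this
  rw [this]
  norm_num [shNorm, legendreD, legendre]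
  left; ring

theorem sphHarm_one_one (d : S2) :
    sphHarm 1 1 d = -((√(3 / (8 * Real.pi)) : ℝ) : ℂ) * ePlus d := by
  have := sphHarm_natCast (n := 1) (k := 1) (by omega) d
  rw [Nat.cast_one] at this
  have h1 : shNorm 1 1 = -√(3 / (8 * Real.pi)) := by
    unfold shNorm
    rw [show ((2 * (1 : ℕ) + 1) / (4 * Real.pi) * ((1 - 1 : ℕ).factorial / (1 + 1 : ℕ).factorial) : ℝ) =
      3 / (8 * Real.pi) by norm_num [Nat.factorial]; field_simp; norm_num]
    ring
  have h2 : (legendreD 1 1).eval ((d : E3) 2) = 1 := by norm_num [legendreD, legendre]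
  rw [this, h1, h2]
  push_cast; ring

theorem sphHarm_one_neg_one (d : S2) :
    sphHarm 1 (-1) d = ((√(3 / (8 * Real.pi)) : ℝ) : ℂ) * eMinus d := by
  have h := conj_sphHarm 1 1 d
  rw [sphHarm_one_one, map_mul, map_neg, Complex.conj_ofReal, conj_ePlus] at h
  simp only [zpow_one, neg_mul, one_mul, neg_inj] at h
  exact h.symm

/-- The bilinear product of a real and a complex vector. -/
def bdot (v : E3) (w : C3) : ℂ := v 0 * w 0 + v 1 * w 1 + v 2 * w 2

theorem bdot_eq_components (v : E3) (w : C3) :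
    bdot v w = (eMinus v * cPlus w + ePlus v * cMinus w) / 2 + v 2 * w 2 := by
  unfold bdot eMinus ePlus cPlus cMinus
  linear_combination ((v 1 : ℂ) * w 1) * Complex.I_sq

theorem inner_complexify (w : C3) (v : E3) : inner ℂ w (complexify v) = conj (bdot v w) := by
  simp [PiLp.inner_apply, Fin.sum_univ_three, complexify, bdot]

theorem bdot_self_surfCurlGrad (f : S2 → ℂ) (x : S2) : bdot x (surfCurlGrad f x) = 0 := by
  simp [bdot, surfCurlGrad, complexify, crossProduct]
  ring

theorem bdot_self_surfGrad (n : ℕ) (k : ℤ) (x : S2) : bdot x (surfGrad (sphHarm n k) x) = 0 := by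
  simp only [bdot, surfGrad_sphHarm_apply]
  simp [complexify, crossProduct]
  ring

theorem sphere_sq_add_complex (x : S2) :
    (((x : E3) 0 : ℝ) : ℂ) ^ 2 + (((x : E3) 1 : ℝ) : ℂ) ^ 2 + (((x : E3) 2 : ℝ) : ℂ) ^ 2 = 1 := by
  have h := congrArg (fun t : ℝ => (t : ℂ)) (sphere_sq_add x)
  push_cast at h
  exact h

theorem bdot_self_hardyHodgeHarm_zero {n : ℕ} {k : ℤ} (hk : k.natAbs ≤ n) (x : S2) :
    bdot x (hardyHodgeHarm 0 n k x) = hhScale 0 n * ((n + 1) * sphHarm n k x) := by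
  have h1 := bdot_self_surfGrad n k x
  have h2 := sphere_sq_add_complex x
  unfold bdot at h1 ⊢
  simp only [hardyHodgeHarm, hardyHodgeOp, hhScale, opD_sphHarm hk, complexify, PiLp.smul_apply,
    PiLp.sub_apply, smul_eq_mul]
  linear_combination (((√(hardyHodgeNorm 0 n))⁻¹ : ℝ) : ℂ) *
    (((n + 1) * sphHarm n k x) * h2 - h1)

theorem bdot_self_hardyHodgeHarm_one {n : ℕ} {k : ℤ} (hk : k.natAbs ≤ n) (x : S2) :
    bdot x (hardyHodgeHarm 1 n k x) = hhScale 1 n * (n * sphHarm n k x) := by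
  have h1 := bdot_self_surfGrad n k x
  have h2 := sphere_sq_add_complex x
  unfold bdot at h1 ⊢
  simp only [hardyHodgeHarm, hardyHodgeOp, hhScale, opD_sphHarm hk, complexify, PiLp.smul_apply,
    PiLp.add_apply, smul_eq_mul]
  linear_combination (((√(hardyHodgeNorm 1 n))⁻¹ : ℝ) : ℂ) *
    ((n * sphHarm n k x) * h2 + h1)

theorem bdot_self_hardyHodgeHarm_two (n : ℕ) (k : ℤ) (x : S2) :
    bdot x (hardyHodgeHarm 2 n k x) = 0 := by
  have h1 := bdot_self_surfCurlGrad (sphHarm n k) x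
  unfold bdot at h1 ⊢
  simp only [hardyHodgeHarm, hardyHodgeOp, PiLp.smul_apply, smul_eq_mul]
  linear_combination (((√(hardyHodgeNorm 2 n))⁻¹ : ℝ) : ℂ) * h1

/-- The part of degree `n + 1` of `(d · x) Y_{n,k}(x)`. -/
def dirUp (d x : S2) (n : ℕ) (k : ℤ) : ℂ :=
  ((d : E3) 2 : ℂ) * coeffA n k * sphHarm (n + 1) k x -
    1 / 2 * (eMinus d * coeffB n k * sphHarm (n + 1) (k + 1) x) +
    1 / 2 * (ePlus d * coeffB n (-k) * sphHarm (n + 1) (k - 1) x)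

/-- The part of degree `n - 1` of `(d · x) Y_{n,k}(x)`. -/
def dirDown (d x : S2) (n : ℕ) (k : ℤ) : ℂ :=
  ((d : E3) 2 : ℂ) * coeffA' n k * sphHarm (n - 1) k x +
    1 / 2 * (eMinus d * coeffB' n (-k) * sphHarm (n - 1) (k + 1) x) -
    1 / 2 * (ePlus d * coeffB' n k * sphHarm (n - 1) (k - 1) x)

theorem inner_mul_sphHarm {n : ℕ} {k : ℤ} (hk : k.natAbs ≤ n) (d x : S2) :
    ((inner ℝ (d : E3) (x : E3) : ℝ) : ℂ) * sphHarm n k x = dirUp d x n k + dirDown d x n k := by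
  have h2 := x2_mul_sphHarm hk x
  have hp := ePlus_mul_sphHarm hk x
  have hm := eMinus_mul_sphHarm hk x
  have h : ((inner ℝ (d : E3) (x : E3) : ℝ) : ℂ) =
      (eMinus d * ePlus x + ePlus d * eMinus x) / 2 + ((d : E3) 2 : ℂ) * ((x : E3) 2 : ℂ) := by
    simp [PiLp.inner_apply, Fin.sum_univ_three, eMinus, ePlus]
    linear_combination (((d : E3) 1 : ℂ) * ((x : E3) 1 : ℂ)) * Complex.I_sq
  rw [h]
  unfold dirUp dirDown
  linear_combination (eMinus d) / 2 * hp + ePlus d / 2 * hm + ((d : E3) 2 : ℂ) * h2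

theorem sum_Icc_pred_succ (q : ℤ) (f : ℤ → ℂ) :
    ∑ l ∈ Finset.Icc (q - 1) (q + 1), f l = f (q - 1) + f q + f (q + 1) := by
  have : Finset.Icc (q - 1) (q + 1) = {q - 1, q, q + 1} := by
    ext l; simp only [Finset.mem_Icc, Finset.mem_insert, Finset.mem_singleton]; omega
  rw [this, Finset.sum_insert (by simp; omega), Finset.sum_pair (by omega), add_assoc]

theorem kIndex_self (q : ℤ) : kIndex q q = 0 := sub_self q

theorem kIndex_pred (q : ℤ) : kIndex (q - 1) q = 1 := by unfold kIndex; ring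

theorem kIndex_succ (q : ℤ) : kIndex (q + 1) q = -1 := by unfold kIndex; ring

theorem sqrt_three_div_four_pi_sq :
    ((√(3 / (4 * Real.pi)) : ℝ) : ℂ) ^ 2 = 3 / (4 * Real.pi) := by
  rw [← Complex.ofReal_pow, Real.sq_sqrt (by positivity)]; push_cast; rfl

theorem sqrt_three_div_eight_pi_sq :
    ((√(3 / (8 * Real.pi)) : ℝ) : ℂ) ^ 2 = 3 / (8 * Real.pi) := by
  rw [← Complex.ofReal_pow, Real.sq_sqrt (by positivity)]; push_cast; rfl

/-- The factor 3/(4π) is that of the addition theorem in degree 1: summing Y_{1,k}(d) against the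
coefficients rebuilds multiplication by d·x, here its part of degree p + 1. -/
theorem sum_alpha1_up {p : ℕ} {q : ℤ} (hq : q.natAbs ≤ p) (d x : S2) :
    ∑ l ∈ Finset.Icc (q - 1) (q + 1),
      sphHarm 1 (kIndex l q) d * (alpha1 p q (p + 1) l * sphHarm (p + 1) l x) =
    3 / (4 * Real.pi) * dirUp d x p q := by
  have hq' : |q| ≤ p := by rw [abs_le]; omega
  have hs := sqrt_three_div_four_pi_sq
  have ht := sqrt_three_div_eight_pi_sq
  rw [sum_Icc_pred_succ, kIndex_self, kIndex_pred, kIndex_succ, sphHarm_one_zero, sphHarm_one_one,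
    sphHarm_one_neg_one, alpha1_up_zero hq', alpha1_up_succ hq', alpha1_up_pred hq', dirUp]
  push_cast
  linear_combination (((d : E3) 2 : ℂ) * coeffA p q * sphHarm (p + 1) q x) * hs +
    (-(eMinus d * coeffB p q * sphHarm (p + 1) (q + 1) x) +
      ePlus d * coeffB p (-q) * sphHarm (p + 1) (q - 1) x) * ht

theorem sum_alpha1_down {p : ℕ} {q : ℤ} (d x : S2) :
    ∑ l ∈ Finset.Icc (q - 1) (q + 1),
      sphHarm 1 (kIndex l q) d * (alpha1 (p + 1) q p l * sphHarm p l x) =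
    3 / (4 * Real.pi) * dirDown d x (p + 1) q := by
  have hs := sqrt_three_div_four_pi_sq
  have ht := sqrt_three_div_eight_pi_sq
  -- The closed forms of `alpha1` require |l| ≤ p; for other l the harmonic of degree p vanishes.
  have h0 : (alpha1 (p + 1) q p q : ℂ) * sphHarm p q x =
      ((√(3 / (4 * Real.pi)) * coeffA' (p + 1) q : ℝ) : ℂ) * sphHarm p q x := by
    rcases le_or_gt q.natAbs p with h | h
    · rw [alpha1_down_zero (by rw [abs_le]; omega)]
    · rw [sphHarm_eq_zero h, mul_zero, mul_zero]
  have hp : (alpha1 (p + 1) q p (q + 1) : ℂ) * sphHarm p (q + 1) x =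
      ((√(3 / (8 * Real.pi)) * coeffB' (p + 1) (-q) : ℝ) : ℂ) * sphHarm p (q + 1) x := by
    rcases le_or_gt (q + 1).natAbs p with h | h
    · rw [alpha1_down_succ (by rw [abs_le]; omega)]
    · rw [sphHarm_eq_zero h, mul_zero, mul_zero]
  have hm : (alpha1 (p + 1) q p (q - 1) : ℂ) * sphHarm p (q - 1) x =
      ((√(3 / (8 * Real.pi)) * coeffB' (p + 1) q : ℝ) : ℂ) * sphHarm p (q - 1) x := by
    rcases le_or_gt (q - 1).natAbs p with h | h
    · rw [alpha1_down_pred (by rw [abs_le]; omega)]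
    · rw [sphHarm_eq_zero h, mul_zero, mul_zero]
  rw [sum_Icc_pred_succ, kIndex_self, kIndex_pred, kIndex_succ, sphHarm_one_zero, sphHarm_one_one,
    sphHarm_one_neg_one, h0, hp, hm, dirDown, Nat.add_sub_cancel]
  push_cast
  linear_combination (((d : E3) 2 : ℂ) * coeffA' (p + 1) q * sphHarm p q x) * hs +
    ((eMinus d * coeffB' (p + 1) (-q) * sphHarm p (q + 1) x) -
      ePlus d * coeffB' (p + 1) q * sphHarm p (q - 1) x) * ht

theorem sqrt_div_eq_mul_inv {a : ℝ} (ha : 0 ≤ a) (b : ℝ) : √(a / b) = a * (√(a * b))⁻¹ := by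
  rw [Real.sqrt_div ha, Real.sqrt_mul ha]
  rcases ha.eq_or_lt with rfl | ha
  · simp
  have := Real.sqrt_pos.2 ha
  nth_rewrite 2 [← Real.mul_self_sqrt ha.le]
  field_simp

theorem sqrt_div_mul_inv_sqrt {a b : ℝ} (ha : 0 < a) (hb : 0 ≤ b) (c : ℝ) :
    √(a / c) * (√(a * b))⁻¹ = (√(b * c))⁻¹ := by
  rw [Real.sqrt_div ha.le, Real.sqrt_mul ha.le, Real.sqrt_mul hb]
  have := Real.sqrt_pos.2 ha
  field_simp

/-- For p = 0 the α⁽²⁾ term is void, while the right side still contains 2 - m(m+1); this vanishes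
for m = 1, which explains the hypothesis. -/
theorem alphaTilde_zero_eq {p m : ℕ} (q l : ℤ) (h : p = 0 → m = 1) :
    alphaTilde 0 p q m l = hhScale 0 p *
      (((p : ℂ) + 1) + (2 - m * (m + 1) + p * (p + 1)) / 4) * alpha1 p q m l := by
  have h1 : √(((p : ℝ) + 1) / (2 * p + 1)) = (p + 1) * (√((p + 1) * (2 * p + 1)))⁻¹ :=
    sqrt_div_eq_mul_inv (by positivity) _
  have h2 : √((p : ℝ) / (2 * p + 1)) * (√(p * (p + 1)))⁻¹ * (2 - m * (m + 1) + p * (p + 1)) =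
      (√((p + 1) * (2 * p + 1)))⁻¹ * (2 - m * (m + 1) + p * (p + 1)) := by
    rcases Nat.eq_zero_or_pos p with hp | hp
    · rw [hp, h hp]; norm_num
    · rw [sqrt_div_mul_inv_sqrt (by positivity) (by positivity)]
  have h3 : √(((p : ℝ) + 1) / (2 * p + 1)) * alpha1 p q m l - √(p / (2 * p + 1)) * alpha2 p q m l =
      (√(((p : ℝ) + 1) * (2 * p + 1)))⁻¹ * ((p + 1) + (2 - m * (m + 1) + p * (p + 1)) / 4) *
        alpha1 p q m l := by
    unfold alpha2
    rw [h1, one_div, mul_inv]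
    linear_combination (alpha1 p q m l / 4) * h2
  simp only [alphaTilde, hhScale, hardyHodgeNorm]
  rw [h3]
  push_cast; rfl

theorem alphaTilde_one_eq {p : ℕ} (hp : 1 ≤ p) (q : ℤ) (m : ℕ) (l : ℤ) :
    alphaTilde 1 p q m l = hhScale 1 p *
      ((p : ℂ) - (2 - m * (m + 1) + p * (p + 1)) / 4) * alpha1 p q m l := by
  have h1 : √((p : ℝ) / (2 * p + 1)) = p * (√(p * (2 * p + 1)))⁻¹ :=
    sqrt_div_eq_mul_inv (by positivity) _
  have h2 : √(((p : ℝ) + 1) / (2 * p + 1)) * (√(p * (p + 1)))⁻¹ = (√(p * (2 * p + 1)))⁻¹ := by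
    rw [mul_comm (p : ℝ) (p + 1)]
    exact sqrt_div_mul_inv_sqrt (by positivity) (by positivity) _
  have h3 : √((p : ℝ) / (2 * p + 1)) * alpha1 p q m l +
      √((p + 1) / (2 * p + 1)) * alpha2 p q m l =
      (√((p : ℝ) * (2 * p + 1)))⁻¹ * (p - (2 - m * (m + 1) + p * (p + 1)) / 4) *
        alpha1 p q m l := by
    unfold alpha2
    rw [h1, one_div, mul_inv]
    linear_combination (-(alpha1 p q m l / 4 * (2 - m * (m + 1) + p * (p + 1)))) * h2
  simp only [alphaTilde, hhScale, hardyHodgeNorm]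
  rw [h3]
  push_cast; rfl

theorem alphaTilde_self (p : ℕ) (q l : ℤ) :
    alphaTilde 0 p q p l = 0 ∧ alphaTilde 1 p q p l = 0 := by
  simp [alphaTilde, alpha2, alpha1_self]

/-- The inner sum over the orders in the expansion. -/
def orderSum (d x : S2) (i : Fin 3) (p : ℕ) (q : ℤ) (m : ℕ) : ℂ :=
  ∑ l ∈ Finset.Icc (q - 1) (q + 1),
    sphHarm 1 (kIndex l q) d * conj (alphaTilde i p q m l) * sphHarm m l x

theorem orderSum_of_eq_mul {d x : S2} {i : Fin 3} {p : ℕ} {q : ℤ} {m : ℕ} {c : ℂ}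
    (h : ∀ l, conj (alphaTilde i p q m l) = c * alpha1 p q m l) :
    orderSum d x i p q m = c * ∑ l ∈ Finset.Icc (q - 1) (q + 1),
      sphHarm 1 (kIndex l q) d * (alpha1 p q m l * sphHarm m l x) := by
  rw [orderSum, Finset.mul_sum]
  exact Finset.sum_congr rfl fun l _ => by rw [h]; ring

/-- The bracket 2 - m(m+1) + p(p+1) equals -2p for m = p+1 and 2p+2 for m = p-1. This yields the
weights p+2 and 3(p+1) for type (1), 3p and p-1 for type (2); the downward cases are stated with p +
1 in place of p. -/
theorem orderSum_zero_up {p : ℕ} {q : ℤ} (hq : q.natAbs ≤ p) (d x : S2) :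
    orderSum d x 0 p q (p + 1) = 3 / (8 * Real.pi) * hhScale 0 p * (p + 2) * dirUp d x p q := by
  rw [orderSum_of_eq_mul (c := hhScale 0 p * ((p + 2) / 2)), sum_alpha1_up hq]
  · ring
  · intro l
    rw [alphaTilde_zero_eq q l (by omega)]
    simp only [map_mul, map_add, map_sub, map_div₀, map_natCast, map_one, map_ofNat, conj_hhScale,
      Complex.conj_ofReal]
    push_cast; ring

theorem orderSum_zero_down (p : ℕ) (q : ℤ) (d x : S2) :
    orderSum d x 0 (p + 1) q p =
      3 / (8 * Real.pi) * hhScale 0 (p + 1) * (3 * (p + 2)) * dirDown d x (p + 1) q := by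
  rw [orderSum_of_eq_mul (c := hhScale 0 (p + 1) * (3 * (p + 2) / 2)), sum_alpha1_down]
  · ring
  · intro l
    rw [alphaTilde_zero_eq q l (by omega)]
    simp only [map_mul, map_add, map_sub, map_div₀, map_natCast, map_one, map_ofNat, conj_hhScale,
      Complex.conj_ofReal]
    push_cast; ring

theorem orderSum_one_up {p : ℕ} (hp : 1 ≤ p) {q : ℤ} (hq : q.natAbs ≤ p) (d x : S2) :
    orderSum d x 1 p q (p + 1) = 3 / (8 * Real.pi) * hhScale 1 p * (3 * p) * dirUp d x p q := by
  rw [orderSum_of_eq_mul (c := hhScale 1 p * (3 * p / 2)), sum_alpha1_up hq]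
  · ring
  · intro l
    rw [alphaTilde_one_eq hp]
    simp only [map_mul, map_add, map_sub, map_div₀, map_natCast, map_one, map_ofNat, conj_hhScale,
      Complex.conj_ofReal]
    push_cast; ring

theorem orderSum_one_down (p : ℕ) (q : ℤ) (d x : S2) :
    orderSum d x 1 (p + 1) q p =
      3 / (8 * Real.pi) * hhScale 1 (p + 1) * p * dirDown d x (p + 1) q := by
  rw [orderSum_of_eq_mul (c := hhScale 1 (p + 1) * (p / 2)), sum_alpha1_down]
  · ring
  · intro l
    rw [alphaTilde_one_eq (by omega)]
    simp only [map_mul, map_add, map_sub, map_div₀, map_natCast, map_one, map_ofNat, conj_hhScale,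
      Complex.conj_ofReal]
    push_cast; ring

theorem orderSum_eq_zero {d x : S2} {i : Fin 3} {p : ℕ} {q : ℤ} {m : ℕ}
    (h : ∀ l, alphaTilde i p q m l = 0) : orderSum d x i p q m = 0 := by
  simp [orderSum, h]

theorem bdot_hardyHodgeHarm_zero {p : ℕ} {q : ℤ} (hq : q.natAbs ≤ p) (d x : S2) :
    bdot d (hardyHodgeHarm 0 p q x) = hhScale 0 p * (2 * p + 1) * dirUp d x p q := by
  rw [bdot_eq_components, cPlus_hardyHodgeHarm 0 hq, cMinus_hardyHodgeHarm 0 hq,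
    hardyHodgeHarm_two 0 hq]
  simp only [hhPlus, hhMinus, hhTwo, hhDeg, dirUp]
  ring

theorem bdot_hardyHodgeHarm_one {p : ℕ} {q : ℤ} (hq : q.natAbs ≤ p) (d x : S2) :
    bdot d (hardyHodgeHarm 1 p q x) = hhScale 1 p * (2 * p + 1) * dirDown d x p q := by
  rw [bdot_eq_components, cPlus_hardyHodgeHarm 1 hq, cMinus_hardyHodgeHarm 1 hq,
    hardyHodgeHarm_two 1 hq]
  simp only [hhPlus, hhMinus, hhTwo, hhDeg, dirDown]
  ring

theorem alphaTilde_two_mul_sphHarm {r : ℕ} {q l : ℤ} {X : ℝ} (x : S2)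
    (h : l.natAbs ≤ r + 1 → wigner3j (r + 1) (r + 1) 1 (-q) l (kIndex l q) = (-1) ^ (r + q) * X *
      √(1 / ((2 * r + 2) * (2 * r + 3) * (2 * r + 4)))) :
    conj (alphaTilde 2 (r + 1) q (r + 1) l) * sphHarm (r + 1) l x =
      -Complex.I * (X / 4 * (√(3 / (4 * Real.pi)) : ℝ) * hhScale 2 (r + 1)) *
        sphHarm (r + 1) l x := by
  rcases le_or_gt l.natAbs (r + 1) with hl | hl
  · simp only [alphaTilde, alpha3_self (h hl), map_mul, Complex.conj_I, Complex.conj_ofReal, hhScale,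
      hardyHodgeNorm]
    push_cast
    ring_nf
  · rw [sphHarm_eq_zero hl, mul_zero, mul_zero]

/-- The radial part of type (3) is zero, so the sum must reproduce -d·y alone. The √2 in the symbols
with l = q ± 1 compensates the different constants of Y_{1,±1} and Y_{1,0} (`h2`). -/
theorem orderSum_two_self {r : ℕ} {q : ℤ} (hq : q.natAbs ≤ r + 1) (d x : S2) :
    8 * Real.pi / 3 * orderSum d x 2 (r + 1) q (r + 1) =
      -bdot d (hardyHodgeHarm 2 (r + 1) q x) := by
  have hq' : |q| ≤ r + 1 := by rw [abs_le]; omega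
  have h0 := alphaTilde_two_mul_sphHarm x fun _ => by
    rw [kIndex_self]; exact wigner3j_self_one_zero hq'
  have hp := alphaTilde_two_mul_sphHarm x fun h => by
    rw [kIndex_succ]; exact wigner3j_self_one_succ hq' (by rw [abs_le]; omega)
  have hm := alphaTilde_two_mul_sphHarm x fun h => by
    rw [kIndex_pred]; exact wigner3j_self_one_pred hq' (by rw [abs_le]; omega)
  have hs := sqrt_three_div_four_pi_sq
  have h2 : ((√(3 / (8 * Real.pi)) : ℝ) : ℂ) * ((√2 : ℝ) : ℂ) = ((√(3 / (4 * Real.pi)) : ℝ) : ℂ) := by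
    rw [← Complex.ofReal_mul, ← Real.sqrt_mul (by positivity)]; congr 2; ring
  have hpi : (Real.pi : ℂ) ≠ 0 := by exact_mod_cast Real.pi_ne_zero
  have hs' : 8 * (Real.pi : ℂ) / 3 * ((√(3 / (4 * Real.pi)) : ℝ) : ℂ) ^ 2 = 2 := by
    rw [hs]; field_simp; norm_num
  rw [bdot_eq_components, cPlus_hardyHodgeHarm 2 hq, cMinus_hardyHodgeHarm 2 hq,
    hardyHodgeHarm_two 2 hq, orderSum, sum_Icc_pred_succ, kIndex_self, kIndex_pred, kIndex_succ,
    mul_assoc, mul_assoc, mul_assoc, h0, hp, hm, sphHarm_one_zero, sphHarm_one_one,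
    sphHarm_one_neg_one]
  simp only [hhPlus, hhMinus, hhTwo, hhDeg]
  push_cast at hs' h2 ⊢
  set S : ℂ := ((√(3 / (4 * Real.pi)) : ℝ) : ℂ)
  set T : ℂ := ((√(3 / (8 * Real.pi)) : ℝ) : ℂ)
  set Y := sphHarm (r + 1) q x
  set Yp := sphHarm (r + 1) (q + 1) x
  set Ym := sphHarm (r + 1) (q - 1) x
  linear_combination (-Complex.I * hhScale 2 (r + 1)) *
    (((d : E3) 2 : ℂ) * q / 2 * Y * hs' +
      (eMinus d * coeffL (r + 1) q * Yp + ePlus d * coeffL (r + 1) (-q) * Ym) / 4 *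
        (8 * Real.pi / 3 * S * h2 + hs'))

/-- The weights match: 3(p+1)(U+D) - (2p+1)U = (p+2)U + 3(p+1)D for type (1) and 3p(U+D) - (2p+1)D =
3pU + (p-1)D for type (2), where U and D are `dirUp` and `dirDown`. The factor 8π/3 cancels the
constant 3/(8π) of the order sums. -/
theorem dipole_expansion {i : Fin 3} {p : ℕ} {q : ℤ} (hi : i = 0 ∨ 1 ≤ p) (hq : q.natAbs ≤ p)
    (d x : S2) :
    3 * ((inner ℝ (d : E3) (x : E3) : ℝ) : ℂ) * bdot x (hardyHodgeHarm i p q x) -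
      bdot d (hardyHodgeHarm i p q x) =
    8 * Real.pi / 3 * ∑ m ∈ Finset.Icc (p - 1) (p + 1), orderSum d x i p q m := by
  have hpi : (Real.pi : ℂ) ≠ 0 := by exact_mod_cast Real.pi_ne_zero
  have hI := inner_mul_sphHarm hq d x
  rcases p with _ | r
  · obtain rfl : i = 0 := by omega
    -- For p = 0 there is no downward part, and of the two degrees m = 0, 1 left by truncation the
    -- first is m = p, which drops out.
    have hd : dirDown d x 0 q = 0 := by
      obtain rfl : q = 0 := by omega
      simp [dirDown, coeffA', coeffB']
    rw [show Finset.Icc (0 - 1) (0 + 1) = ({0, 1} : Finset ℕ) from rfl, Finset.sum_pair (by norm_num),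
      orderSum_eq_zero fun l => (alphaTilde_self 0 q l).1, orderSum_zero_up hq,
      bdot_self_hardyHodgeHarm_zero hq, bdot_hardyHodgeHarm_zero hq]
    rw [hd] at hI
    push_cast at hI ⊢
    field_simp
    linear_combination 9 * hhScale 0 0 * hI
  · have hsum : ∑ m ∈ Finset.Icc (r + 1 - 1) (r + 1 + 1), orderSum d x i (r + 1) q m =
        orderSum d x i (r + 1) q r + orderSum d x i (r + 1) q (r + 1) +
          orderSum d x i (r + 1) q (r + 1 + 1) := by
      have : Finset.Icc (r + 1 - 1) (r + 1 + 1) = {r, r + 1, r + 1 + 1} := by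
        ext l; simp only [Finset.mem_Icc, Finset.mem_insert, Finset.mem_singleton]; omega
      rw [this, Finset.sum_insert (by simp; omega), Finset.sum_pair (by omega), ← add_assoc]
    rw [hsum]
    match i with
    | 0 =>
      rw [orderSum_zero_down, orderSum_eq_zero fun l => (alphaTilde_self (r + 1) q l).1,
        orderSum_zero_up hq, bdot_self_hardyHodgeHarm_zero hq, bdot_hardyHodgeHarm_zero hq]
      push_cast at hI ⊢
      field_simp
      linear_combination 9 * hhScale 0 (r + 1) * (r + 2) * hI
    | 1 =>
      rw [orderSum_one_down, orderSum_eq_zero fun l => (alphaTilde_self (r + 1) q l).2,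
        orderSum_one_up (by omega) hq, bdot_self_hardyHodgeHarm_one hq, bdot_hardyHodgeHarm_one hq]
      push_cast at hI ⊢
      field_simp
      linear_combination 9 * hhScale 1 (r + 1) * (r + 1) * hI
    | 2 =>
      rw [orderSum_eq_zero (i := 2) (m := r) fun l => alpha3_down r q l,
        orderSum_eq_zero (i := 2) (m := r + 1 + 1) fun l => alpha3_up (r + 1) q l,
        bdot_self_hardyHodgeHarm_two, zero_add, add_zero, orderSum_two_self hq]
      ring

/-! ### The Fourier coefficients -/

theorem inner_magnetization (Q : S2 → ℝ) (d x : S2) (w : C3) :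
    inner ℂ w (complexify (magnetization Q d x)) =
      Q x * conj (3 * ((inner ℝ (d : E3) (x : E3) : ℝ) : ℂ) * bdot x w - bdot d w) := by
  rw [inner_complexify]
  simp only [bdot, magnetization, PiLp.smul_apply, PiLp.sub_apply, smul_eq_mul, map_add, map_mul,
    map_sub, Complex.conj_ofReal, map_ofNat]
  push_cast
  ring

theorem inner_hardyHodgeHarm_magnetization (Q : S2 → ℝ) {i : Fin 3} {p : ℕ} {q : ℤ}
    (hi : i = 0 ∨ 1 ≤ p) (hq : q.natAbs ≤ p) (d x : S2) :
    inner ℂ (hardyHodgeHarm i p q x) (complexify (magnetization Q d x)) =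
      ((8 * Real.pi / 3 : ℝ) : ℂ) *
        ∑ m ∈ Finset.Icc (p - 1) (p + 1), ∑ l ∈ Finset.Icc (q - 1) (q + 1),
          (Q x * conj (sphHarm m l x)) * (conj (sphHarm 1 (kIndex l q) d) * alphaTilde i p q m l) := by
  rw [inner_magnetization, dipole_expansion hi hq]
  simp only [orderSum, map_mul, map_div₀, map_ofNat, Complex.conj_ofReal, map_sum,
    Complex.conj_conj, Finset.mul_sum]
  push_cast
  refine Finset.sum_congr rfl fun m _ => Finset.sum_congr rfl fun l _ => ?_
  ring

theorem memLp_ofReal {Q : S2 → ℝ} (hQ : MemLp Q 2 surfaceMeasure) :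
    MemLp (fun x => (Q x : ℂ)) 2 surfaceMeasure :=
  hQ.ofReal

theorem integrable_mul_conj_sphHarm {Q : S2 → ℝ} (hQ : MemLp Q 2 surfaceMeasure) (m : ℕ) (l : ℤ) :
    Integrable (fun x => (Q x : ℂ) * conj (sphHarm m l x)) surfaceMeasure :=
  MemLp.integrable_mul (p := 2) (q := 2) (memLp_ofReal hQ)
    (memLp_of_continuous (Complex.continuous_conj.comp (continuous_sphHarm m l)))

theorem integral_inner_magnetization {Q : S2 → ℝ} (hQ : MemLp Q 2 surfaceMeasure) {i : Fin 3}
    {p : ℕ} {q : ℤ} (hi : i = 0 ∨ 1 ≤ p) (hq : q.natAbs ≤ p) (d : S2) :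
    ∫ x, inner ℂ (hardyHodgeHarm i p q x) (complexify (magnetization Q d x)) ∂surfaceMeasure =
      expansionCoeff Q d i p q := by
  simp only [inner_hardyHodgeHarm_magnetization Q hi hq]
  have hint := integrable_mul_conj_sphHarm hQ
  rw [integral_const_mul, integral_finsetSum _ fun m _ =>
    integrable_finsetSum _ fun l _ => (hint m l).mul_const _]
  unfold expansionCoeff shCoeff
  congr 1
  refine Finset.sum_congr rfl fun m _ => ?_
  rw [integral_finsetSum _ fun l _ => (hint m l).mul_const _]
  refine Finset.sum_congr rfl fun l _ => ?_
  rw [integral_mul_const, mul_assoc]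

theorem continuous_complexify : Continuous complexify :=
  (PiLp.continuous_toLp 2 _).comp (continuous_pi fun j =>
    Complex.continuous_ofReal.comp (EuclideanSpace.proj j).continuous)

theorem complexify_smul (r : ℝ) (v : E3) : complexify (r • v) = (r : ℂ) • complexify v := by
  ext j; simp [complexify]

theorem memLp_magnetization {Q : S2 → ℝ} (hQ : MemLp Q 2 surfaceMeasure) (d : S2) :
    MemLp (fun x => complexify (magnetization Q d x)) 2 surfaceMeasure := by
  simp only [magnetization, complexify_smul]
  have hc : Continuous fun x : S2 =>
      complexify ((3 * inner ℝ (d : E3) (x : E3)) • (x : E3) - (d : E3)) := by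
    refine continuous_complexify.comp ?_
    fun_prop
  have hb : MemLp (fun x : S2 =>
      complexify ((3 * inner ℝ (d : E3) (x : E3)) • (x : E3) - (d : E3))) ⊤ surfaceMeasure :=
    hc.memLp_of_hasCompactSupport (HasCompactSupport.of_compactSpace _)
  exact hb.smul (memLp_ofReal hQ)

end DipoleMag

end

/-! ### The main theorem -/

open DipoleMag in
theorem proposition4p2 (Q : S2 → ℝ) (hQ : MemLp Q 2 surfaceMeasure) (d : S2) :
    -- the Fourier expansion, unconditionally convergent in the square-integrable fields
    (∃ (hm : MemLp (fun x => complexify (magnetization Q d x)) 2 surfaceMeasure)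
        (hy : ∀ j : HHIndex,
          MemLp (hardyHodgeHarm j.1.1 j.1.2.deg j.1.2.ord) 2 surfaceMeasure),
      HasSum
        (fun j : HHIndex => expansionCoeff Q d j.1.1 j.1.2.deg j.1.2.ord • (hy j).toLp)
        hm.toLp) ∧
    -- the coefficients are the Fourier coefficients of the magnetization
    (∀ j : HHIndex,
      ∫ x, inner ℂ (hardyHodgeHarm j.1.1 j.1.2.deg j.1.2.ord x)
          (complexify (magnetization Q d x)) ∂surfaceMeasure =
        expansionCoeff Q d j.1.1 j.1.2.deg j.1.2.ord) ∧
    -- the coefficients of types (1) and (2) vanish for `m = p`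
    (∀ (p : ℕ) (q l : ℤ), |q| ≤ p → q - 1 ≤ l → l ≤ q + 1 →
      alphaTilde 0 p q p l = 0 ∧ alphaTilde 1 p q p l = 0) ∧
    -- the Fourier coefficients of order `|l| > m` are zero
    (∀ (m : ℕ) (l : ℤ), (m : ℤ) + 1 ≤ l ∨ l ≤ -(m : ℤ) - 1 →
      shCoeff (fun x => (Q x : ℂ)) m l = 0) := by
  refine ⟨⟨memLp_magnetization hQ d, memLp_hardyHodgeHarm, ?_⟩,
    fun j => integral_inner_magnetization hQ j.2 j.natAbs_ord_le d,
    fun p q l _ _ _ => alphaTilde_self p q l, fun m l h => ?_⟩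
  -- The Hilbert basis expansion, whose inner products are the integrals already identified with
  -- `expansionCoeff`.
  · convert hasSum_hhLp (memLp_magnetization hQ d).toLp using 3 with j
    · rw [hhLp, inner_toLp, integral_inner_magnetization hQ j.2 j.natAbs_ord_le]
    · rfl
  · simp [shCoeff, sphHarm_eq_zero (show m < l.natAbs by omega)]
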